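/- Let $m\ge 2$, $\theta\in\mathbb R$ with $\sin\theta\ne 0$, and let $A\in\mathbb R^{2m\times 2m}$ be the real Jordan block with $m$ diagonal blocks $Q=\begin{pmatrix}\cos\theta&\sin\theta\\-\sin\theta&\cos\theta\end{pmatrix}$ and identity blocks $I_2$ on the block superdiagonal; $b=[0,\dots,0,1]^T$. Agents $i=1,\dots,N$ have dynamics $x^i(t+1)=Ax^i(t)+bu_i(t)$ and measured output $y_i(t)=x_{i1}(t)$. They communicate over an undirected connected graph with symmetric weights $g_{iv}\ge 0$ ($g_{iv}>0$ iff $i,v$ are neighbours) and Laplacian $L$ with eigenvalues $0=\lambda_1<\lambda_2\le\dots\le\lambda_N$. Norms are sup norms. *Scheme.* Let $q_t$ be the uniform quantizer with levels $-M(t),\dots,M(t)$ (odd; for $y>-\frac12$, $q_t(y)=\min(\lfloor y+\frac12\rfloor,M(t))$), $p(t)=p_0\gamma^t$, let $\mathcal O$ be the observability matrix with rows the first rows of $I,A,\dots,A^{2m-1}$, and $S=A^{2m-1}\mathcal O^{-1}$. Put $\pi_i(t)=0$ for $1\le t\le 2m$ and $\pi_i(t)=\cos\theta\,\hat x_{i1}(t-1)+\sin\theta\,\hat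 x_{i2}(t-1)+\hat x_{i3}(t-1)$ for $t>2m$. For $t\ge 1$ agent $i$ sends $s_i(t)=q_t\big((y_i(t)-\pi_i(t))/p(t-1)\big)$ to its neighbours and sets $\hat x_{i1}(t)=\pi_i(t)+p(t-1)s_i(t)$; for $t\ge 2m$ and $2\le j\le 2m$ it sets $\hat x_{ij}(t)=\sum_{n=1}^{2m}S(j,n)\,\hat x_{i1}(t-2m+n)$. Each neighbour $v$ computes estimates $\hat x_{ivj}(t)$ from the received $s_i(t)$ by the same recursion. The control is $u_i(t)=0$ for $t<2m$ and $u_i(t)=\sum_{j=1}^{2m}k_j\sum_v g_{iv}[\hat x_{vij}(t)-\hat x_{ij}(t)]$ for $t\ge 2m$. *Gains.* For $\varepsilon>0$ let $k_{2j-1}=c_{2j-1}\varepsilon^{m-j}$, $k_{2j}=c_{2j}\varepsilon^{m-j}$ for $1\le j\le m-1$, and $k_{2m-1}=c_{2m-1}\varepsilon$, $k_{2m}=c_{2m}\varepsilon$. The constants are fixed by a number $h\in(0,\lambda_2]$: with $\mathrm j=\sqrt{-1}$, $$\sum_{r=0}^{m-2}(c_{2r+2}-\mathrm j\,c_{2r+1})z^r=e^{2\mathrm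 j\theta}\prod_{n=1}^{m-2}(z+ne^{\mathrm j\theta}),$$ $c_{2m-1}=-[(2H+4)/h+1]\sin\theta$ and $c_{2m}=[(2H+4)/h+1]\cos\theta$, where $H=(m-1)(m-2)/2$. Let $\gamma=1-\varepsilon/4$, and let $K$ be the $2m\times 2m$ matrix whose last row is $[k_1,\dots,k_{2m}]$ and whose other rows vanish. **Theorem.** There is $\varepsilon_0>0$, depending only on $m$, $\theta$, the weighted graph and $h$, such that for all $\varepsilon\in(0,\varepsilon_0)$ one has $0<\gamma<1$, the spectral radius of $A-\lambda_iK$ is less than $1-\varepsilon/2$ for $i=2,\dots,N$, and the following holds. Let $C^*,C_\delta^*>0$ and $p_0\ge(\sqrt2+1)^{2m}\max\{C^*,C_\delta^*\}$. If $$M(t)\ge 1\ (1\le t\le 2m),\qquad M(t)\ge 2^{m-1}(1+|\cos\theta|)^m-\tfrac12\ (t>2m),$$ then for all initial states with $|x_{ij}(0)|\le C^*$ and $\big|x_{ij}(0)-\frac1N\sum_v x_{vj}(0)\big|\le C_\delta^*$ for all $i,j$, the scheme achieves consensus at rate $O(\gamma^t)$: $x^i(t)-x^j(t)\to 0$ and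 $\|x^i(t)-x^j(t)\|\le B\gamma^t$ for all $i,j,t$, where $B$ does not depend on $M(\cdot)$ or on the initial states. Consequently $\beta=\big\lceil\log_2 2\lceil 2^{m-1}(1+|\cos\theta|)^m-\frac12\rceil\big\rceil$ bits suffice: with the constant $M(t)=\lceil 2^{m-1}(1+|\cos\theta|)^m-\frac12\rceil$ consensus is achieved as above, and all symbols $s_i(t)$ can be transmitted as words of $\beta$ bits, nothing being sent when $s_i(t)=0$. Moreover $m\le\beta\le 2m$. -/

import Mathlib

open Real Matrix Filter Topology

noncomputable section

namespace QuantizedConsensus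

/-! ### Agent dynamics -/

/-- The real Jordan block of order `2m`: `m` diagonal blocks
`Q = [cos θ, sin θ; -sin θ, cos θ]` and identity blocks `I₂` above them. -/
def jordanBlock (m : ℕ) (θ : ℝ) : Matrix (Fin (2 * m)) (Fin (2 * m)) ℝ :=
  Matrix.of fun i j =>
    if (i : ℕ) / 2 = (j : ℕ) / 2 then
      if (i : ℕ) % 2 = (j : ℕ) % 2 then cos θ
      else if (i : ℕ) % 2 = 0 then sin θ else -sin θ
    else if (j : ℕ) = (i : ℕ) + 2 then 1 else 0

/-- The input vector `b = [0, …, 0, 1]ᵀ`. -/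
def inputVec (m : ℕ) : Fin (2 * m) → ℝ := fun j => if (j : ℕ) + 1 = 2 * m then 1 else 0

/-- The first coordinate of the `2m`-dimensional state. -/
def crd1 {m : ℕ} (hm : 2 ≤ m) : Fin (2 * m) := ⟨0, by omega⟩

/-- The second coordinate of the `2m`-dimensional state. -/
def crd2 {m : ℕ} (hm : 2 ≤ m) : Fin (2 * m) := ⟨1, by omega⟩

/-- The third coordinate of the `2m`-dimensional state. -/
def crd3 {m : ℕ} (hm : 2 ≤ m) : Fin (2 * m) := ⟨2, by omega⟩

/-- The observability matrix: its rows are the first rows of `I, A, …, A^(2m-1)`. -/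
def obsMatrix {m : ℕ} (hm : 2 ≤ m) (θ : ℝ) : Matrix (Fin (2 * m)) (Fin (2 * m)) ℝ :=
  Matrix.of fun k j => (jordanBlock m θ ^ (k : ℕ)) (crd1 hm) j

/-- `S = A^(2m-1) 𝒪⁻¹`. -/
def reconMatrix {m : ℕ} (hm : 2 ≤ m) (θ : ℝ) : Matrix (Fin (2 * m)) (Fin (2 * m)) ℝ :=
  jordanBlock m θ ^ (2 * m - 1) * (obsMatrix hm θ)⁻¹

/-! ### Communication graph -/

/-- `g` is a weight matrix of the undirected graph `𝒢`. -/
structure IsWeight {N : ℕ} (𝒢 : SimpleGraph (Fin N)) (g : Matrix (Fin N) (Fin N) ℝ) : Prop where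
  nonneg : ∀ i v, 0 ≤ g i v
  symm : ∀ i v, g i v = g v i
  pos_iff : ∀ i v, 0 < g i v ↔ 𝒢.Adj v i

/-- The weighted Laplacian `L = diag(∑ᵥ gᵢᵥ) - G`. -/
def laplacian {N : ℕ} (g : Matrix (Fin N) (Fin N) ℝ) : Matrix (Fin N) (Fin N) ℝ :=
  Matrix.diagonal (fun i => ∑ v, g i v) - g

/-- `lam` is a nonzero eigenvalue of the Laplacian; for a connected graph these are
`λ₂ ≤ … ≤ λ_N`. -/
def IsNonzeroEigenvalue {N : ℕ} (g : Matrix (Fin N) (Fin N) ℝ) (lam : ℝ) : Prop :=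
  lam ≠ 0 ∧ Module.End.HasEigenvalue (Matrix.toLin' (laplacian g)) lam

/-! ### Control gains -/

/-- The complex polynomial with leading coefficient `e^{2jθ}` and the `m - 2` roots
`-n e^{jθ}`, `n = 1, …, m - 2`. Its coefficient of degree `r` is `c_{2r+2} - c_{2r+1} j`,
for `r = 0, …, m - 2`. -/
def gainPoly (m : ℕ) (θ : ℝ) : Polynomial ℂ :=
  Polynomial.C (Complex.exp (2 * θ * Complex.I)) *
    ∏ n ∈ Finset.Icc 1 (m - 2),
      (Polynomial.X - Polynomial.C (-(n : ℂ) * Complex.exp (θ * Complex.I)))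

/-- `H = (m-1)(m-2)/2`, which is `Re[(c_{2m-5} j - c_{2m-4}) / (c_{2m-3} j - c_{2m-2}) e^{-jθ}]`
when `m ≥ 3`, and `0` when `m = 2`. -/
def gainH (m : ℕ) : ℝ := ((m : ℝ) - 1) * ((m : ℝ) - 2) / 2

/-- The constants `c₁, …, c_{2m}`; the index `l` is zero-based, so that `l = 2r` is
`c_{2r+1}` and `l = 2r+1` is `c_{2r+2}`. -/
def gainConst (m : ℕ) (θ h : ℝ) (l : Fin (2 * m)) : ℝ :=
  if (l : ℕ) / 2 + 1 = m then
    if (l : ℕ) % 2 = 0 then -((2 * gainH m + 4) / h + 1) * sin θ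
    else ((2 * gainH m + 4) / h + 1) * cos θ
  else
    if (l : ℕ) % 2 = 0 then -((gainPoly m θ).coeff ((l : ℕ) / 2)).im
    else ((gainPoly m θ).coeff ((l : ℕ) / 2)).re

/-- The control gains: `k_{2j-1} = c_{2j-1} ε^{m-j}`, `k_{2j} = c_{2j} ε^{m-j}` for `j < m`, and
`k_{2m-1} = c_{2m-1} ε`, `k_{2m} = c_{2m} ε`. -/
def gain (m : ℕ) (θ h ε : ℝ) (l : Fin (2 * m)) : ℝ :=
  gainConst m θ h l * (if (l : ℕ) / 2 + 1 = m then ε else ε ^ (m - 1 - (l : ℕ) / 2))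

/-- The matrix `K` whose only nonzero row is the last one, `[k₁, …, k_{2m}]`. -/
def gainMatrix (m : ℕ) (θ h ε : ℝ) : Matrix (Fin (2 * m)) (Fin (2 * m)) ℝ :=
  Matrix.vecMulVec (inputVec m) (gain m θ h ε)

/-! ### Quantizer, encoder, decoder and closed loop -/

/-- The uniform quantizer with the levels `-M, …, M`. -/
def quantizer (M : ℕ) (y : ℝ) : ℤ :=
  if -(1 / 2) < y then min ⌊y + 1 / 2⌋ (M : ℤ) else -min ⌊-y + 1 / 2⌋ (M : ℤ)

/-- The prediction of the next output from the estimate `z` of the state. -/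
def predict {m : ℕ} (hm : 2 ≤ m) (θ : ℝ) (z : Fin (2 * m) → ℝ) : ℝ :=
  cos θ * z (crd1 hm) + sin θ * z (crd2 hm) + z (crd3 hm)

/-- The estimates `z 1, z 2, …` are generated from the symbols `s 1, s 2, …` with the scaling
function `p`. (For `t < 2m` only the first coordinate is estimated.) -/
structure IsEstimate {m : ℕ} (hm : 2 ≤ m) (θ : ℝ) (p : ℕ → ℝ) (s : ℕ → ℤ)
    (z : ℕ → Fin (2 * m) → ℝ) : Prop where
  first_init : ∀ t, t < 2 * m → z (t + 1) (crd1 hm) = p t * s (t + 1)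
  first_step : ∀ t, 2 * m ≤ t → z (t + 1) (crd1 hm) = predict hm θ (z t) + p t * s (t + 1)
  others : ∀ t, 2 * m ≤ t → ∀ j, j ≠ crd1 hm →
    z t j = ∑ n : Fin (2 * m), reconMatrix hm θ j n * z (t - (2 * m - 1) + n) (crd1 hm)

/-- The signals of the multi-agent system; the first argument is the time.
`dec t v i` is the estimate of the state of agent `i` computed by the decoder at agent `v`. -/
structure Signals (N m : ℕ) where
  x : ℕ → Fin N → Fin (2 * m) → ℝ
  u : ℕ → Fin N → ℝ
  s : ℕ → Fin N → ℤ
  enc : ℕ → Fin N → Fin (2 * m) → ℝ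
  dec : ℕ → Fin N → Fin N → Fin (2 * m) → ℝ

/-- The closed loop: agent dynamics, encoders (quantizer with parameter `M t` at time `t`),
decoders along the edges of the graph, and the distributed control law with the gains `k`
(note that `g i v = 0` unless `v` is a neighbour of `i`). -/
structure IsClosedLoop {N m : ℕ} (hm : 2 ≤ m) (θ : ℝ) (𝒢 : SimpleGraph (Fin N))
    (g : Matrix (Fin N) (Fin N) ℝ) (k : Fin (2 * m) → ℝ) (p : ℕ → ℝ) (M : ℕ → ℕ)
    (R : Signals N m) : Prop where
  dynamics : ∀ t i, R.x (t + 1) i = jordanBlock m θ *ᵥ R.x t i + R.u t i • inputVec m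
  symbol_init : ∀ t, t < 2 * m → ∀ i,
    R.s (t + 1) i = quantizer (M (t + 1)) (R.x (t + 1) i (crd1 hm) / p t)
  symbol_step : ∀ t, 2 * m ≤ t → ∀ i,
    R.s (t + 1) i =
      quantizer (M (t + 1)) ((R.x (t + 1) i (crd1 hm) - predict hm θ (R.enc t i)) / p t)
  encoder : ∀ i, IsEstimate hm θ p (fun t => R.s t i) (fun t => R.enc t i)
  decoder : ∀ i v, 𝒢.Adj i v → IsEstimate hm θ p (fun t => R.s t i) (fun t => R.dec t v i)
  control_init : ∀ t, t < 2 * m → ∀ i, R.u t i = 0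
  control_step : ∀ t, 2 * m ≤ t → ∀ i,
    R.u t i = ∑ j, k j * ∑ v, g i v * (R.dec t i v j - R.enc t i j)

/-- The initial states are bounded: `max_j ‖x_j(0)‖ ≤ C` and `max_j ‖δ_j(0)‖ ≤ Cδ` in the sup norm,
where `x_j = [x_{1j}, …, x_{Nj}]ᵀ` and `δ_j` is `x_j` minus its average. -/
def InitBound {N m : ℕ} (C Cδ : ℝ) (x₀ : Fin N → Fin (2 * m) → ℝ) : Prop :=
  ∀ j, ‖fun i => x₀ i j‖ ≤ C ∧ ‖fun i => x₀ i j - (∑ v, x₀ v j) / N‖ ≤ Cδ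

/-- Consensus, with all differences of states bounded by `B γ^t`. -/
def ConsensusAtRate {N m : ℕ} (B γ : ℝ) (R : Signals N m) : Prop :=
  ∀ i j, Tendsto (fun t => R.x t i - R.x t j) atTop (𝓝 0) ∧
    ∀ t, ‖R.x t i - R.x t j‖ ≤ B * γ ^ t

/-! ### Data rate -/

/-- The required size of the quantizer, `2^(m-1) (1 + |cos θ|)^m - 1/2`. -/
def levelBound (m : ℕ) (θ : ℝ) : ℝ := 2 ^ (m - 1) * (1 + |cos θ|) ^ m - 1 / 2

/-- The number of bits, `⌈log₂ (2 ⌈2^(m-1) (1 + |cos θ|)^m - 1/2⌉)⌉`. -/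
def bits (m : ℕ) (θ : ℝ) : ℕ := ⌈Real.logb 2 (2 * (⌈levelBound m θ⌉₊ : ℝ))⌉₊

/-! ### The closed loop has a solution from every initial state -/

section Existence

variable {N m : ℕ} (hm : 2 ≤ m) (θ : ℝ) (g : Matrix (Fin N) (Fin N) ℝ)
  (k : Fin (2 * m) → ℝ) (p : ℕ → ℝ) (M : ℕ → ℕ)

def estOf (f : ℕ → Fin N → ℝ) (t : ℕ) (i : Fin N) (j : Fin (2 * m)) : ℝ :=
  if j = crd1 hm then f t i
  else ∑ n : Fin (2 * m), reconMatrix hm θ j n * f (t - (2 * m - 1) + n) i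

def ctlOf (f : ℕ → Fin N → ℝ) (t : ℕ) (i : Fin N) : ℝ :=
  if t < 2 * m then 0
  else ∑ j, k j * ∑ v, g i v * (estOf hm θ f t v j - estOf hm θ f t i j)

def nextX (t : ℕ) (a : (Fin N → Fin (2 * m) → ℝ) × (ℕ → Fin N → ℝ)) :
    Fin N → Fin (2 * m) → ℝ := fun i =>
  jordanBlock m θ *ᵥ a.1 i + ctlOf hm θ g k a.2 t i • inputVec m

def predOf (f : ℕ → Fin N → ℝ) (t : ℕ) (i : Fin N) : ℝ :=
  if t < 2 * m then 0 else predict hm θ (estOf hm θ f t i)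

def symOf (t : ℕ) (a : (Fin N → Fin (2 * m) → ℝ) × (ℕ → Fin N → ℝ)) (i : Fin N) : ℤ :=
  quantizer (M (t + 1)) ((nextX hm θ g k t a i (crd1 hm) - predOf hm θ a.2 t i) / p t)

def stateOf (x₀ : Fin N → Fin (2 * m) → ℝ) :
    ℕ → (Fin N → Fin (2 * m) → ℝ) × (ℕ → Fin N → ℝ)
  | 0 => (x₀, fun _ _ => 0)
  | t + 1 =>
    (nextX hm θ g k t (stateOf x₀ t),
      Function.update (stateOf x₀ t).2 (t + 1) fun i =>
        predOf hm θ (stateOf x₀ t).2 t i + p t * symOf hm θ g k p M t (stateOf x₀ t) i)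

theorem stateOf_stable (x₀ : Fin N → Fin (2 * m) → ℝ) (τ d : ℕ) :
    (stateOf hm θ g k p M x₀ (τ + d)).2 τ = (stateOf hm θ g k p M x₀ τ).2 τ := by
  induction d with
  | zero => rfl
  | succ d ih =>
    rw [← ih]
    exact congrFun (Function.update_of_ne (by omega) _ _ :
      Function.update (stateOf hm θ g k p M x₀ (τ + d)).2 (τ + d + 1) _ τ = _) |> funext

theorem exists_isClosedLoop (𝒢 : SimpleGraph (Fin N)) (x₀ : Fin N → Fin (2 * m) → ℝ) :
    ∃ R : Signals N m, IsClosedLoop hm θ 𝒢 g k p M R ∧ R.x 0 = x₀ := by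
  set F := stateOf hm θ g k p M x₀ with hF
  have hst : ∀ τ t, τ ≤ t → (F t).2 τ = (F τ).2 τ := by
    intro τ t h
    obtain ⟨d, rfl⟩ := Nat.exists_eq_add_of_le h
    exact stateOf_stable hm θ g k p M x₀ τ d
  have hfst : ∀ t, (F (t + 1)).1 = nextX hm θ g k t (F t) := fun t => rfl
  have hsnd : ∀ t i, (F (t + 1)).2 (t + 1) i =
      predOf hm θ (F t).2 t i + p t * symOf hm θ g k p M t (F t) i := by
    intro t i
    simp [hF, stateOf]
  have hc1 : ∀ (f : ℕ → Fin N → ℝ) t i, estOf hm θ f t i (crd1 hm) = f t i := by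
    intro f t i
    simp [estOf]
  have hest : ∀ i, IsEstimate hm θ p
      (fun t => if t = 0 then 0 else symOf hm θ g k p M (t - 1) (F (t - 1)) i)
      (fun t => estOf hm θ (F t).2 t i) := by
    intro i
    refine ⟨fun t ht => ?_, fun t ht => ?_, fun t ht j hj => ?_⟩
    · simp [hc1, hsnd, predOf, ht]
    · simp [hc1, hsnd, predOf, not_lt.mpr ht]
    · simp only [hc1]
      rw [estOf, if_neg hj]
      refine Finset.sum_congr rfl fun n _ => ?_
      rw [hst _ t (by omega)]
  refine ⟨⟨fun t => (F t).1, fun t i => ctlOf hm θ g k (F t).2 t i,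
    fun t i => if t = 0 then 0 else symOf hm θ g k p M (t - 1) (F (t - 1)) i,
    fun t i => estOf hm θ (F t).2 t i, fun t _ i => estOf hm θ (F t).2 t i⟩,
    ⟨fun t i => ?_, fun t ht i => ?_, fun t ht i => ?_, hest, fun i v _ => hest i,
      fun t ht i => ?_, fun t ht i => ?_⟩, rfl⟩
  · simp [hfst, nextX]
  · simp [symOf, hfst, predOf, ht]
  · simp [symOf, hfst, predOf, not_lt.mpr ht]
  · simp [ctlOf, ht]
  · simp [ctlOf, not_lt.mpr ht]

end Existence

end QuantizedConsensus

end

/-!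
In the complex coordinates `W_k = x_{2k+1} - j x_{2k+2}` the Jordan block reads
`W_k ↦ e^{jθ} W_k + W_{k+1}`, the input enters only the last coordinate, and the control is the
imaginary part of a complex linear form, that is, a combination of the form and its conjugate. An
orthonormal eigenbasis of the Laplacian (`exists_isEigenbasis`) splits the disagreement of the
agents into modes, each of which evolves under `A - λ K` with `λ ≥ h` and is driven by the
estimation errors.

One mode. After rescaling `W_k` by `(e^{jθ} ε)^k`, the gains, whose polynomial has the roots
`-n e^{jθ}`, are such that the operators `S + 1, S + 2, …` (`S` the shift) applied successively
turn the chain into a cascade of scalar modes with the factors `1 - i ε` (`casc`) followed by a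
pair of variables that oscillate with the frequency `√(λ ε / 2)`. The conjugate terms are
nonresonant because `e^{2jθ} ≠ 1`, as `sin θ ≠ 0`; a change of variables close to the identity
removes them up to terms of the order `ε^{3/2}` (`ModeData.pair`, `ModeData.exists_pair_step`),
and the constant `(2H + 4) / h + 1` makes the damping of the pair strong enough. Hence a weighted
maximum of these coordinates contracts by the factor `1 - 3 ε / 4` (`exists_isModeNorm`). This
gives the bound of the spectral radius, and the same function shows that the control is of the
order `√ε` relative to the size of the mode, which is what makes the quantizer error the dominant
part of the estimation error.

The quantizers never saturate. By the Cayley-Hamilton theorem for `(X² - 2 cos θ X + 1)^m`,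
without control the output at time `t + 1` is a combination of the last `2m` outputs whose
coefficients have absolute sum at most `(2 + 2 |cos θ|)^m - 1`; the prediction is the same
combination of the estimates (`exists_estimate_bound`). If the past output errors are at most half
a quantizer step, the next prediction error is therefore at most `((2 + 2 |cos θ|)^m - 1) / 2`
steps plus a small term from the controls and from the decay of the step over the window of length
`2m`, which stays below the saturation level `M + 1/2`, so the next output error is again at most
half a step. In turn the modes stay of the order of the step, since `1 - ε / 4` exceeds
`1 - 3 ε / 4`, and the controls stay small. All three bounds are propagated together
(`bounds_init`, `bounds_step`), and the bound of the modes is consensus at the rate of the scaling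
function.
-/

noncomputable section

namespace QuantizedConsensus

open ComplexConjugate

/-! ### The Jordan block in complex coordinates -/

/-- The `i`-th coordinate of a state, with the value `0` beyond the last coordinate. -/
def pad {m : ℕ} (x : Fin (2 * m) → ℝ) (i : ℕ) : ℝ := if hi : i < 2 * m then x ⟨i, hi⟩ else 0

/-- The complex coordinate `x_{2k} - x_{2k+1} j` (zero-based), equal to `0` for `k ≥ m`. With this
sign the rotation block acts on it as multiplication by `e^{jθ}`. -/
def cplx {m : ℕ} (x : Fin (2 * m) → ℝ) (k : ℕ) : ℂ := ⟨pad x (2 * k), -pad x (2 * k + 1)⟩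

theorem pad_val {m : ℕ} (x : Fin (2 * m) → ℝ) (i : Fin (2 * m)) : pad x i = x i := by
  simp [pad]

theorem pad_of_le {m : ℕ} (x : Fin (2 * m) → ℝ) {i : ℕ} (hi : 2 * m ≤ i) : pad x i = 0 := by
  simp [pad, not_lt.mpr hi]

theorem pad_add {m : ℕ} (x y : Fin (2 * m) → ℝ) (i : ℕ) : pad (x + y) i = pad x i + pad y i := by
  unfold pad; split_ifs <;> simp

theorem pad_smul {m : ℕ} (c : ℝ) (x : Fin (2 * m) → ℝ) (i : ℕ) :
    pad (c • x) i = c * pad x i := by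
  unfold pad; split_ifs <;> simp

theorem abs_pad_le {m : ℕ} (x : Fin (2 * m) → ℝ) (i : ℕ) : |pad x i| ≤ ‖x‖ := by
  unfold pad
  split_ifs with hi
  · exact norm_le_pi_norm x ⟨i, hi⟩
  · simp

theorem sum_ite_val_eq {m : ℕ} (x : Fin (2 * m) → ℝ) (i : ℕ) :
    ∑ j : Fin (2 * m), (if (j : ℕ) = i then x j else 0) = pad x i := by
  unfold pad
  split_ifs with hi
  · rw [Finset.sum_eq_single (⟨i, hi⟩ : Fin (2 * m))]
    · simp
    · intro b _ hb
      rw [if_neg]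
      intro h
      exact hb (Fin.ext h)
    · simp
  · refine Finset.sum_eq_zero fun j _ => if_neg ?_
    have := j.2
    omega

theorem pad_jordanBlock_even {m : ℕ} (θ : ℝ) (x : Fin (2 * m) → ℝ) (k : ℕ) :
    pad (jordanBlock m θ *ᵥ x) (2 * k) =
      cos θ * pad x (2 * k) + sin θ * pad x (2 * k + 1) + pad x (2 * k + 2) := by
  by_cases hk : 2 * k < 2 * m
  · have h0 : pad (jordanBlock m θ *ᵥ x) (2 * k) = (jordanBlock m θ *ᵥ x) ⟨2 * k, hk⟩ := by
      simp [pad, hk]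
    rw [h0, ← sum_ite_val_eq x (2 * k), ← sum_ite_val_eq x (2 * k + 1),
      ← sum_ite_val_eq x (2 * k + 2), Finset.mul_sum, Finset.mul_sum, ← Finset.sum_add_distrib,
      ← Finset.sum_add_distrib]
    simp only [Matrix.mulVec, dotProduct]
    refine Finset.sum_congr rfl fun j _ => ?_
    simp only [jordanBlock, Matrix.of_apply]
    split_ifs <;> first | omega | ring
  · rw [pad_of_le _ (by omega), pad_of_le _ (by omega), pad_of_le _ (by omega),
      pad_of_le _ (by omega)]
    ring

theorem pad_jordanBlock_odd {m : ℕ} (θ : ℝ) (x : Fin (2 * m) → ℝ) (k : ℕ) :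
    pad (jordanBlock m θ *ᵥ x) (2 * k + 1) =
      -sin θ * pad x (2 * k) + cos θ * pad x (2 * k + 1) + pad x (2 * k + 3) := by
  by_cases hk : 2 * k + 1 < 2 * m
  · have h0 : pad (jordanBlock m θ *ᵥ x) (2 * k + 1) =
        (jordanBlock m θ *ᵥ x) ⟨2 * k + 1, hk⟩ := by
      simp [pad, hk]
    rw [h0, ← sum_ite_val_eq x (2 * k), ← sum_ite_val_eq x (2 * k + 1),
      ← sum_ite_val_eq x (2 * k + 3), Finset.mul_sum, Finset.mul_sum, ← Finset.sum_add_distrib,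
      ← Finset.sum_add_distrib]
    simp only [Matrix.mulVec, dotProduct]
    refine Finset.sum_congr rfl fun j _ => ?_
    simp only [jordanBlock, Matrix.of_apply]
    split_ifs <;> first | omega | ring
  · rw [pad_of_le _ (by omega), pad_of_le _ (by omega), pad_of_le _ (by omega),
      pad_of_le _ (by omega)]
    ring

/-- The unit complex number `e^{jθ}`. -/
def rot (θ : ℝ) : ℂ := ⟨cos θ, sin θ⟩

theorem rot_eq_exp (θ : ℝ) : rot θ = Complex.exp (θ * Complex.I) := by
  rw [Complex.exp_mul_I]
  apply Complex.ext <;> simp [rot, Complex.cos_ofReal_re, Complex.sin_ofReal_re]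

theorem norm_rot (θ : ℝ) : ‖rot θ‖ = 1 := by
  rw [rot_eq_exp, Complex.norm_exp_ofReal_mul_I]

theorem cplx_add {m : ℕ} (x y : Fin (2 * m) → ℝ) (k : ℕ) :
    cplx (x + y) k = cplx x k + cplx y k := by
  apply Complex.ext <;> simp [cplx, pad_add]
  ring

theorem cplx_smul {m : ℕ} (c : ℝ) (x : Fin (2 * m) → ℝ) (k : ℕ) :
    cplx (c • x) k = c * cplx x k := by
  apply Complex.ext <;> simp [cplx, pad_smul]

theorem cplx_of_le {m : ℕ} (x : Fin (2 * m) → ℝ) {k : ℕ} (hk : m ≤ k) : cplx x k = 0 := by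
  apply Complex.ext <;> simp [cplx, pad_of_le, hk, show 2 * m ≤ 2 * k + 1 by omega]

theorem cplx_jordanBlock {m : ℕ} (θ : ℝ) (x : Fin (2 * m) → ℝ) (k : ℕ) :
    cplx (jordanBlock m θ *ᵥ x) k = rot θ * cplx x k + cplx x (k + 1) := by
  apply Complex.ext
  · simp only [cplx, rot, pad_jordanBlock_even, Complex.add_re, Complex.mul_re]
    rw [show 2 * (k + 1) = 2 * k + 2 by ring]
    ring
  · simp only [cplx, rot, pad_jordanBlock_odd, Complex.add_im, Complex.mul_im]
    rw [show 2 * (k + 1) + 1 = 2 * k + 3 by ring]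
    ring

theorem eq_zero_of_cplx {m : ℕ} {x : Fin (2 * m) → ℝ} (hx : ∀ k, cplx x k = 0) : x = 0 := by
  funext i
  rw [← pad_val x i]
  have h1 := congrArg Complex.re (hx ((i : ℕ) / 2))
  have h2 := congrArg Complex.im (hx ((i : ℕ) / 2))
  simp only [cplx, Complex.zero_re, Complex.zero_im, neg_eq_zero] at h1 h2
  rcases Nat.mod_two_eq_zero_or_one i with h | h
  · rwa [show 2 * ((i : ℕ) / 2) = i by omega] at h1
  · rwa [show 2 * ((i : ℕ) / 2) + 1 = i by omega] at h2

theorem norm_cplx_le {m : ℕ} (x : Fin (2 * m) → ℝ) (k : ℕ) : ‖cplx x k‖ ≤ 2 * ‖x‖ := by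
  refine (Complex.norm_le_abs_re_add_abs_im _).trans ?_
  have h1 := abs_pad_le x (2 * k)
  have h2 := abs_pad_le x (2 * k + 1)
  simp only [cplx, abs_neg]
  linarith

theorem norm_le_of_cplx {m : ℕ} (x : Fin (2 * m) → ℝ) {r : ℝ} (hr : 0 ≤ r)
    (hx : ∀ k < m, ‖cplx x k‖ ≤ r) : ‖x‖ ≤ r := by
  refine (pi_norm_le_iff_of_nonneg hr).2 fun i => ?_
  have hi := i.2
  have h := hx ((i : ℕ) / 2) (by omega)
  have h1 := (Complex.abs_re_le_norm (cplx x ((i : ℕ) / 2))).trans h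
  have h2 := (Complex.abs_im_le_norm (cplx x ((i : ℕ) / 2))).trans h
  simp only [cplx, abs_neg] at h1 h2
  rw [← pad_val x i, Real.norm_eq_abs]
  rcases Nat.mod_two_eq_zero_or_one i with h | h
  · rwa [show 2 * ((i : ℕ) / 2) = i by omega] at h1
  · rwa [show 2 * ((i : ℕ) / 2) + 1 = i by omega] at h2

theorem abs_cos_add_abs_sin_le (θ : ℝ) : |cos θ| + |sin θ| ≤ √2 := by
  apply Real.le_sqrt_of_sq_le
  have h1 := sq_abs (cos θ)
  have h2 := sq_abs (sin θ)
  nlinarith [sq_nonneg (|cos θ| - |sin θ|), Real.cos_sq_add_sin_sq θ]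

theorem norm_jordanBlock_mulVec_le {m : ℕ} (θ : ℝ) (x : Fin (2 * m) → ℝ) :
    ‖jordanBlock m θ *ᵥ x‖ ≤ (√2 + 1) * ‖x‖ := by
  refine (pi_norm_le_iff_of_nonneg (by positivity)).2 fun i => ?_
  have key : ∀ a b c d e : ℝ, |a| + |b| ≤ √2 → |c| ≤ ‖x‖ → |d| ≤ ‖x‖ → |e| ≤ ‖x‖ →
      |a * c + b * d + e| ≤ (√2 + 1) * ‖x‖ := by
    intro a b c d e hab hc hd he
    calc |a * c + b * d + e| ≤ |a| * |c| + |b| * |d| + |e| := by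
          rw [← abs_mul, ← abs_mul]; exact abs_add_three _ _ _
      _ ≤ |a| * ‖x‖ + |b| * ‖x‖ + ‖x‖ := by gcongr
      _ = (|a| + |b| + 1) * ‖x‖ := by ring
      _ ≤ _ := by gcongr
  have hcs := abs_cos_add_abs_sin_le θ
  rw [← pad_val (jordanBlock m θ *ᵥ x) i, Real.norm_eq_abs]
  rcases Nat.mod_two_eq_zero_or_one i with h | h
  · rw [show (i : ℕ) = 2 * ((i : ℕ) / 2) by omega, pad_jordanBlock_even]
    exact key _ _ _ _ _ hcs (abs_pad_le _ _) (abs_pad_le _ _) (abs_pad_le _ _)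
  · rw [show (i : ℕ) = 2 * ((i : ℕ) / 2) + 1 by omega, pad_jordanBlock_odd]
    exact key _ _ _ _ _ (by rw [abs_neg]; linarith) (abs_pad_le _ _) (abs_pad_le _ _)
      (abs_pad_le _ _)

theorem norm_jordanBlock_pow_mulVec_le {m : ℕ} (θ : ℝ) (x : Fin (2 * m) → ℝ) (t : ℕ) :
    ‖jordanBlock m θ ^ t *ᵥ x‖ ≤ (√2 + 1) ^ t * ‖x‖ := by
  induction t with
  | zero => simp
  | succ t ih =>
    rw [pow_succ', ← Matrix.mulVec_mulVec]
    refine (norm_jordanBlock_mulVec_le θ _).trans ?_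
    rw [pow_succ', mul_assoc]
    gcongr

/-! ### Annihilating polynomial and observability -/

/-- `A² - 2 cos θ A + 1`, the value at `A` of the real polynomial with the roots `e^{±jθ}`. -/
def quadJordan (m : ℕ) (θ : ℝ) : Matrix (Fin (2 * m)) (Fin (2 * m)) ℝ :=
  jordanBlock m θ ^ 2 - (2 * cos θ) • jordanBlock m θ + 1

theorem cplx_quadJordan {m : ℕ} (θ : ℝ) (x : Fin (2 * m) → ℝ) (k : ℕ) :
    cplx (quadJordan m θ *ᵥ x) k =
      2 * sin θ * Complex.I * cplx x (k + 1) + cplx x (k + 2) := by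
  have h : quadJordan m θ *ᵥ x = jordanBlock m θ *ᵥ (jordanBlock m θ *ᵥ x) +
      ((-(2 * cos θ)) • (jordanBlock m θ *ᵥ x) + x) := by
    rw [quadJordan, Matrix.add_mulVec, Matrix.sub_mulVec, pow_two, ← Matrix.mulVec_mulVec,
      Matrix.smul_mulVec, Matrix.one_mulVec, neg_smul]
    abel
  have h1 : rot θ * rot θ - 2 * (cos θ : ℂ) * rot θ + 1 = 0 := by
    apply Complex.ext
    · simp only [rot, Complex.add_re, Complex.sub_re, Complex.mul_re, Complex.mul_im,
        Complex.ofReal_re, Complex.ofReal_im, Complex.re_ofNat, Complex.im_ofNat, Complex.one_re,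
        Complex.zero_re]
      linear_combination -(Real.cos_sq_add_sin_sq θ)
    · simp only [rot, Complex.add_im, Complex.sub_im, Complex.mul_re, Complex.mul_im,
        Complex.ofReal_re, Complex.ofReal_im, Complex.re_ofNat, Complex.im_ofNat, Complex.one_im,
        Complex.zero_im]
      ring
  have h2 : 2 * rot θ - 2 * (cos θ : ℂ) = 2 * sin θ * Complex.I := by
    apply Complex.ext <;>
    simp only [rot, Complex.sub_re, Complex.sub_im, Complex.mul_re, Complex.mul_im,
        Complex.ofReal_re, Complex.ofReal_im, Complex.re_ofNat, Complex.im_ofNat, Complex.I_re,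
        Complex.I_im] <;> ring
  rw [h, cplx_add, cplx_add, cplx_smul, cplx_jordanBlock, cplx_jordanBlock, cplx_jordanBlock]
  push_cast [-Complex.ofReal_cos, -Complex.ofReal_sin]
  linear_combination cplx x k * h1 + cplx x (k + 1) * h2

theorem cplx_quadJordan_pow_eq_zero {m : ℕ} (θ : ℝ) (x : Fin (2 * m) → ℝ) (l : ℕ) :
    ∀ k, m ≤ k + l → cplx (quadJordan m θ ^ l *ᵥ x) k = 0 := by
  induction l with
  | zero => intro k hk; simpa using cplx_of_le x hk
  | succ l ih =>
    intro k hk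
    rw [pow_succ', ← Matrix.mulVec_mulVec, cplx_quadJordan, ih _ (by omega), ih _ (by omega)]
    ring

theorem quadJordan_pow_eq_zero (m : ℕ) (θ : ℝ) : quadJordan m θ ^ m = 0 := by
  apply Matrix.ext_of_mulVec_single
  intro i
  rw [Matrix.zero_mulVec]
  exact eq_zero_of_cplx fun k => cplx_quadJordan_pow_eq_zero θ _ m k (by omega)

open Polynomial in
/-- `(X² - 2 cos θ X + 1)^m`, the characteristic polynomial of the Jordan block. -/
def jordanPoly (m : ℕ) (θ : ℝ) : Polynomial ℝ := (X ^ 2 - C (2 * cos θ) * X + 1) ^ m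

open Polynomial in
theorem aeval_jordanPoly (m : ℕ) (θ : ℝ) : aeval (jordanBlock m θ) (jordanPoly m θ) = 0 := by
  rw [jordanPoly, map_pow, ← quadJordan_pow_eq_zero m θ]
  congr 1
  rw [quadJordan, Algebra.smul_def, map_add, map_sub, map_mul, map_pow, aeval_X, aeval_C, map_one]

open Polynomial in
theorem jordanPoly_monic (m : ℕ) (θ : ℝ) :
    (jordanPoly m θ).Monic ∧ (jordanPoly m θ).natDegree = 2 * m := by
  have h : (X ^ 2 - C (2 * cos θ) * X + 1 : Polynomial ℝ) =
      C 1 * X ^ 2 + C (-(2 * cos θ)) * X + C 1 := by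
    simp only [map_neg, map_one]; ring
  have h1 : (X ^ 2 - C (2 * cos θ) * X + 1 : Polynomial ℝ).Monic := by
    rw [h, Monic, leadingCoeff_quadratic one_ne_zero]
  have h2 : (X ^ 2 - C (2 * cos θ) * X + 1 : Polynomial ℝ).natDegree = 2 := by
    rw [h, natDegree_quadratic one_ne_zero]
  exact ⟨h1.pow m, by rw [jordanPoly, h1.natDegree_pow, h2, mul_comm]⟩

/-- The coefficients of the linear recursion of order `2m` satisfied by `A^t`. -/
def recCoeff (m : ℕ) (θ : ℝ) (n : ℕ) : ℝ := -(jordanPoly m θ).coeff n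

theorem jordanBlock_pow_two_mul (m : ℕ) (θ : ℝ) :
    jordanBlock m θ ^ (2 * m) =
      ∑ n : Fin (2 * m), recCoeff m θ n • jordanBlock m θ ^ (n : ℕ) := by
  have h := aeval_jordanPoly m θ
  rw [Polynomial.aeval_eq_sum_range, (jordanPoly_monic m θ).2, Finset.sum_range_succ] at h
  have h1 : (jordanPoly m θ).coeff (2 * m) = 1 := by
    have := (jordanPoly_monic m θ).1.coeff_natDegree
    rwa [(jordanPoly_monic m θ).2] at this
  rw [h1, one_smul] at h
  rw [eq_neg_of_add_eq_zero_right h, Fin.sum_univ_eq_sum_range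
    (fun n => recCoeff m θ n • jordanBlock m θ ^ n), ← Finset.sum_neg_distrib]
  simp [recCoeff]

open Polynomial in
/-- Replacing the coefficients of `X² - 2 cos θ X + 1` by their absolute values dominates the
coefficients of its powers. -/
theorem abs_coeff_jordanPoly_le (θ : ℝ) (m n : ℕ) :
    |(jordanPoly m θ).coeff n| ≤
      ((X ^ 2 + C (2 * |cos θ|) * X + 1 : Polynomial ℝ) ^ m).coeff n := by
  induction m generalizing n with
  | zero => simp [jordanPoly, coeff_one]; split_ifs <;> simp
  | succ m ih =>
    rw [jordanPoly, pow_succ _ m, pow_succ _ m, coeff_mul, coeff_mul]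
    refine (Finset.abs_sum_le_sum_abs _ _).trans (Finset.sum_le_sum fun ij _ => ?_)
    rw [abs_mul]
    refine mul_le_mul (ih _) ?_ (abs_nonneg _) ((abs_nonneg _).trans (ih _))
    simp only [coeff_add, coeff_sub, coeff_X_pow, coeff_C_mul, coeff_X, coeff_one]
    rcases ij with ⟨_, _ | _ | _ | j⟩ <;> simp [abs_mul]

open Polynomial in
theorem sum_abs_recCoeff_le (m : ℕ) (θ : ℝ) :
    ∑ n : Fin (2 * m), |recCoeff m θ n| ≤ (2 + 2 * |cos θ|) ^ m - 1 := by
  have h : (X ^ 2 + C (2 * |cos θ|) * X + 1 : Polynomial ℝ) =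
      C 1 * X ^ 2 + C (2 * |cos θ|) * X + C 1 := by
    simp only [map_one]; ring
  have h1 : (X ^ 2 + C (2 * |cos θ|) * X + 1 : Polynomial ℝ).Monic := by
    rw [h, Monic, leadingCoeff_quadratic one_ne_zero]
  have h2 : (X ^ 2 + C (2 * |cos θ|) * X + 1 : Polynomial ℝ).natDegree = 2 := by
    rw [h, natDegree_quadratic one_ne_zero]
  have h3 : ((X ^ 2 + C (2 * |cos θ|) * X + 1 : Polynomial ℝ) ^ m).natDegree = 2 * m := by
    rw [h1.natDegree_pow, h2, mul_comm]
  have h4 := (h1.pow m).coeff_natDegree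
  rw [h3] at h4
  have h5 : ((X ^ 2 + C (2 * |cos θ|) * X + 1 : Polynomial ℝ) ^ m).eval 1 =
      (2 + 2 * |cos θ|) ^ m := by
    simp; ring
  rw [eval_eq_sum_range, h3, Finset.sum_range_succ, h4] at h5
  rw [Fin.sum_univ_eq_sum_range (fun n => |recCoeff m θ n|)]
  have h6 : ∑ n ∈ Finset.range (2 * m), |recCoeff m θ n| ≤ ∑ n ∈ Finset.range (2 * m),
      ((X ^ 2 + C (2 * |cos θ|) * X + 1 : Polynomial ℝ) ^ m).coeff n * 1 ^ n := by
    refine Finset.sum_le_sum fun n _ => ?_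
    rw [recCoeff, abs_neg, one_pow, mul_one]
    exact abs_coeff_jordanPoly_le θ m n
  rw [one_pow, mul_one] at h5
  exact h6.trans (by linarith)

/-- If the output vanishes along the whole free trajectory, then so does the state. The number of
blocks of the state that may be nonzero is reduced by `A² - 2 cos θ A + 1`, which is nilpotent and
shifts the blocks upwards with an invertible leading factor, since `sin θ ≠ 0`. -/
theorem eq_zero_of_output_eq_zero {m : ℕ} {θ : ℝ} (hθ : sin θ ≠ 0) (l : ℕ) :
    ∀ x : Fin (2 * m) → ℝ, (∀ k, l ≤ k → cplx x k = 0) →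
      (∀ t, pad (jordanBlock m θ ^ t *ᵥ x) 0 = 0) → x = 0 := by
  induction l with
  | zero => exact fun x hx _ => eq_zero_of_cplx fun k => hx k (Nat.zero_le k)
  | succ l ih =>
    intro x hx hout
    have hs : (2 * (sin θ : ℂ) * Complex.I) ≠ 0 := by
      simp only [ne_eq, mul_eq_zero, Complex.I_ne_zero, OfNat.ofNat_ne_zero, false_or, or_false]
      exact_mod_cast hθ
    have hB : quadJordan m θ *ᵥ x = 0 := by
      refine ih _ (fun k hk => ?_) fun t => ?_
      · rw [cplx_quadJordan, hx _ (by omega), hx _ (by omega)]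
        ring
      · have h : jordanBlock m θ ^ t *ᵥ (quadJordan m θ *ᵥ x) =
            jordanBlock m θ ^ (t + 2) *ᵥ x +
              ((-(2 * cos θ)) • (jordanBlock m θ ^ (t + 1) *ᵥ x) + jordanBlock m θ ^ t *ᵥ x) := by
          rw [Matrix.mulVec_mulVec, quadJordan, mul_add, mul_sub, ← pow_add, Matrix.mul_smul,
            ← pow_succ, mul_one, Matrix.add_mulVec, Matrix.sub_mulVec, Matrix.smul_mulVec, neg_smul]
          abel
        rw [h, pad_add, pad_add, pad_smul, hout, hout, hout]
        ring
    refine eq_zero_of_cplx fun k => ?_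
    rcases k with _ | k
    · rcases l with _ | l
      · have h0 := hout 0
        have h1 := hout 1
        have h2 := pad_jordanBlock_even θ x 0
        have h3 := congrArg Complex.re (hx 1 (by omega))
        simp only [cplx, mul_one, Complex.zero_re] at h3
        simp only [pow_zero, Matrix.one_mulVec, pow_one, mul_zero, zero_add] at h0 h1 h2
        rw [h1, h0, h3] at h2
        have h4 : pad x 1 = 0 := by
          have : sin θ * pad x 1 = 0 := by linarith
          exact (mul_eq_zero.1 this).resolve_left hθ
        apply Complex.ext <;> simp [cplx, h0, h4]
      · -- the block `l + 1` vanishes, so the induction hypothesis applies to `x` itself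
        have h0 := cplx_quadJordan θ x l
        rw [hB, hx (l + 2) (by omega)] at h0
        have h1 : cplx x (l + 1) = 0 := by
          have h2 : cplx (0 : Fin (2 * m) → ℝ) l = 0 := by
            apply Complex.ext <;> simp [cplx, pad]
          rw [h2, add_zero] at h0
          exact (mul_eq_zero.1 h0.symm).resolve_left hs
        have hx0 : x = 0 := by
          refine ih x (fun k hk => ?_) hout
          rcases Nat.eq_or_lt_of_le hk with h | h
          · rw [← h, h1]
          · exact hx k h
        rw [hx0]
        apply Complex.ext <;> simp [cplx, pad]
    · have key : ∀ d k, l ≤ k + d → cplx x (k + 1) = 0 := by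
        intro d
        induction d with
        | zero => exact fun k hk => hx _ (by omega)
        | succ d ihd =>
          intro k hk
          have h0 := cplx_quadJordan θ x k
          have h2 : cplx (0 : Fin (2 * m) → ℝ) k = 0 := by
            apply Complex.ext <;> simp [cplx, pad]
          rw [hB, ihd (k + 1) (by omega), h2, add_zero] at h0
          exact (mul_eq_zero.1 h0.symm).resolve_left hs
      exact key l k (by omega)

theorem obsMatrix_mulVec {m : ℕ} (hm : 2 ≤ m) (θ : ℝ) (x : Fin (2 * m) → ℝ) (k : Fin (2 * m)) :
    (obsMatrix hm θ *ᵥ x) k = (jordanBlock m θ ^ (k : ℕ) *ᵥ x) (crd1 hm) := rfl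

theorem isUnit_obsMatrix {m : ℕ} (hm : 2 ≤ m) {θ : ℝ} (hθ : sin θ ≠ 0) :
    IsUnit (obsMatrix hm θ).det := by
  rw [isUnit_iff_ne_zero]
  intro hdet
  obtain ⟨x, hx0, hx⟩ := Matrix.exists_mulVec_eq_zero_iff.2 hdet
  apply hx0
  have h1 : ∀ t < 2 * m, (jordanBlock m θ ^ t *ᵥ x) (crd1 hm) = 0 := by
    intro t ht
    rw [← obsMatrix_mulVec hm θ x ⟨t, ht⟩, hx]
    rfl
  have h2 : ∀ t, (jordanBlock m θ ^ t *ᵥ x) (crd1 hm) = 0 := by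
    intro t
    induction t using Nat.strong_induction_on with
    | _ t ih =>
      rcases lt_or_ge t (2 * m) with ht | ht
      · exact h1 t ht
      · obtain ⟨d, rfl⟩ := Nat.exists_eq_add_of_le ht
        rw [pow_add, jordanBlock_pow_two_mul, Finset.sum_mul, Matrix.sum_mulVec, Finset.sum_apply]
        refine Finset.sum_eq_zero fun n _ => ?_
        rw [Matrix.smul_mul, ← pow_add, Matrix.smul_mulVec, Pi.smul_apply, ih _ (by omega),
          smul_zero]
  refine eq_zero_of_output_eq_zero hθ m x (fun k hk => cplx_of_le x hk) fun t => ?_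
  rw [← h2 t]
  exact pad_val _ (crd1 hm)

theorem reconMatrix_mul_obsMatrix {m : ℕ} (hm : 2 ≤ m) {θ : ℝ} (hθ : sin θ ≠ 0) :
    reconMatrix hm θ * obsMatrix hm θ = jordanBlock m θ ^ (2 * m - 1) := by
  rw [reconMatrix, Matrix.mul_assoc, Matrix.nonsing_inv_mul _ (isUnit_obsMatrix hm hθ), mul_one]

/-! ### The quantizer and its data rate -/

/-- The quantizer does not saturate on `[-(M + 1/2), M + 1/2]`. -/
theorem abs_sub_quantizer_le {M : ℕ} {y : ℝ} (hy : |y| ≤ M + 1 / 2) :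
    |y - quantizer M y| ≤ 1 / 2 := by
  have key : ∀ z : ℝ, z ≤ M + 1 / 2 → |z - (min ⌊z + 1 / 2⌋ (M : ℤ) : ℤ)| ≤ 1 / 2 := by
    intro z hz
    rw [abs_le]
    have h1 := Int.floor_le (z + 1 / 2)
    have h2 := Int.lt_floor_add_one (z + 1 / 2)
    rcases le_total ⌊z + 1 / 2⌋ (M : ℤ) with h | h
    · rw [min_eq_left h]
      constructor <;> linarith
    · rw [min_eq_right h]
      have h3 : ((M : ℤ) : ℝ) ≤ (⌊z + 1 / 2⌋ : ℝ) := by exact_mod_cast h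
      push_cast at h3 ⊢
      constructor <;> linarith
  rw [abs_le] at hy
  unfold quantizer
  split_ifs with h
  · exact key y hy.2
  · have := key (-y) (by linarith)
    rw [← abs_neg]
    have h1 : -(y - ((-min ⌊-y + 1 / 2⌋ (M : ℤ) : ℤ) : ℝ)) =
        -y - ((min ⌊-y + 1 / 2⌋ (M : ℤ) : ℤ) : ℝ) := by
      rw [Int.cast_neg]; ring
    rwa [h1]

theorem abs_quantizer_le (M : ℕ) (y : ℝ) : |quantizer M y| ≤ M := by
  have key : ∀ z : ℝ, 0 ≤ z + 1 / 2 → |min ⌊z + 1 / 2⌋ (M : ℤ)| ≤ M := by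
    intro z hz
    have h1 : 0 ≤ ⌊z + 1 / 2⌋ := Int.floor_nonneg.2 hz
    rw [abs_of_nonneg (le_min h1 (by positivity))]
    exact min_le_right _ _
  unfold quantizer
  split_ifs with h
  · exact key y (by linarith)
  · rw [abs_neg]
    exact key (-y) (by linarith)

theorem two_pow_sub_half_le_levelBound (m : ℕ) (θ : ℝ) :
    (2 : ℝ) ^ (m - 1) - 1 / 2 ≤ levelBound m θ := by
  unfold levelBound
  have h1 : (1 : ℝ) ≤ (1 + |cos θ|) ^ m := one_le_pow₀ (by linarith [abs_nonneg (cos θ)])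
  have h2 : (0 : ℝ) < 2 ^ (m - 1) := by positivity
  nlinarith

theorem two_pow_le_ceil_levelBound (m : ℕ) (θ : ℝ) : 2 ^ (m - 1) ≤ ⌈levelBound m θ⌉₊ := by
  have h := (two_pow_sub_half_le_levelBound m θ).trans (Nat.le_ceil _)
  by_contra! hlt
  have h2 : ((⌈levelBound m θ⌉₊ + 1 : ℕ) : ℝ) ≤ ((2 ^ (m - 1) : ℕ) : ℝ) := by exact_mod_cast hlt
  push_cast at h2
  linarith

theorem ceil_levelBound_le {m : ℕ} (hm : 2 ≤ m) (θ : ℝ) :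
    ⌈levelBound m θ⌉₊ ≤ 2 ^ (2 * m - 1) := by
  rw [Nat.ceil_le]
  have h1 : (1 + |cos θ|) ^ m ≤ (2 : ℝ) ^ m :=
    pow_le_pow_left₀ (by positivity) (by linarith [Real.abs_cos_le_one θ]) m
  have h2 : (0 : ℝ) < 2 ^ (m - 1) := by positivity
  have h3 : ((2 ^ (2 * m - 1) : ℕ) : ℝ) = 2 ^ (m - 1) * 2 ^ m := by
    push_cast
    rw [← pow_add]
    congr 1
    omega
  rw [h3]
  unfold levelBound
  nlinarith

theorem le_bits {m : ℕ} (hm : 2 ≤ m) (θ : ℝ) : m ≤ bits m θ := by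
  have h : (m : ℝ) ≤ Real.logb 2 (2 * (⌈levelBound m θ⌉₊ : ℝ)) := by
    have h1 : ((2 ^ (m - 1) : ℕ) : ℝ) ≤ (⌈levelBound m θ⌉₊ : ℝ) := by
      exact_mod_cast two_pow_le_ceil_levelBound m θ
    have h0 : (0 : ℝ) < ((2 ^ (m - 1) : ℕ) : ℝ) := by positivity
    rw [Real.le_logb_iff_rpow_le one_lt_two (by linarith), Real.rpow_natCast]
    calc (2 : ℝ) ^ m = 2 * ((2 ^ (m - 1) : ℕ) : ℝ) := by
          push_cast
          rw [← pow_succ']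
          congr 1
          omega
      _ ≤ _ := by linarith
  exact Nat.cast_le.1 (h.trans (Nat.le_ceil _))

theorem bits_le {m : ℕ} (hm : 2 ≤ m) (θ : ℝ) : bits m θ ≤ 2 * m := by
  unfold bits
  rw [Nat.ceil_le]
  have h1 : (⌈levelBound m θ⌉₊ : ℝ) ≤ ((2 ^ (2 * m - 1) : ℕ) : ℝ) := by
    exact_mod_cast ceil_levelBound_le hm θ
  have h2 : 0 < ⌈levelBound m θ⌉₊ := lt_of_lt_of_le (by positivity) (two_pow_le_ceil_levelBound m θ)
  have h2' : (0 : ℝ) < (⌈levelBound m θ⌉₊ : ℝ) := by exact_mod_cast h2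
  rw [Real.logb_le_iff_le_rpow one_lt_two (by linarith), Real.rpow_natCast]
  calc 2 * (⌈levelBound m θ⌉₊ : ℝ) ≤ 2 * ((2 ^ (2 * m - 1) : ℕ) : ℝ) := by linarith
    _ = (2 : ℝ) ^ (2 * m) := by
      push_cast
      rw [← pow_succ']
      congr 1
      omega

theorem two_mul_ceil_le_two_pow_bits (m : ℕ) (θ : ℝ) :
    2 * ⌈levelBound m θ⌉₊ ≤ 2 ^ bits m θ := by
  have h2 : 0 < ⌈levelBound m θ⌉₊ := lt_of_lt_of_le (by positivity) (two_pow_le_ceil_levelBound m θ)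
  have h2' : (0 : ℝ) < (⌈levelBound m θ⌉₊ : ℝ) := by exact_mod_cast h2
  have h := Nat.le_ceil (Real.logb 2 (2 * (⌈levelBound m θ⌉₊ : ℝ)))
  rw [Real.logb_le_iff_le_rpow one_lt_two (by linarith), Real.rpow_natCast] at h
  have h3 : ((2 * ⌈levelBound m θ⌉₊ : ℕ) : ℝ) ≤ ((2 ^ bits m θ : ℕ) : ℝ) := by
    rw [Nat.cast_mul, Nat.cast_pow]
    exact h
  exact Nat.cast_le.1 h3

open Classical in
/-- The `2M` nonzero symbols are words of `β` bits if `2M ≤ 2^β`, and the symbol zero is the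
absence of a word. -/
theorem exists_code {M β : ℕ} (hM : 2 * M ≤ 2 ^ β) :
    ∃ (send : ℤ → Option (Fin β → Bool)) (receive : Option (Fin β → Bool) → ℤ),
      send 0 = none ∧ ∀ s : ℤ, |s| ≤ M → receive (send s) = s := by
  let T : Finset ℤ := (Finset.Icc (-(M : ℤ)) M).erase 0
  have hT : Fintype.card T ≤ Fintype.card (Fin β → Bool) := by
    rw [Fintype.card_coe, Finset.card_erase_of_mem (by simp), Int.card_Icc, Fintype.card_fun,
      Fintype.card_bool, Fintype.card_fin]
    omega
  obtain ⟨f⟩ := Function.Embedding.nonempty_of_card_le hT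
  let send : ℤ → Option (Fin β → Bool) := fun s => if h : s ∈ T then some (f ⟨s, h⟩) else none
  have h0 : send 0 = none := by simp [send, T]
  have hinj : ∀ s s' : ℤ, |s| ≤ M → |s'| ≤ M → send s = send s' → s = s' := by
    have hmem : ∀ s : ℤ, |s| ≤ M → s ∉ T → s = 0 := by
      intro s hs hsT
      by_contra hne
      exact hsT (Finset.mem_erase.2 ⟨hne, Finset.mem_Icc.2 (abs_le.1 hs)⟩)
    intro s s' hs hs' heq
    by_cases h1 : s ∈ T <;> by_cases h2 : s' ∈ T <;> simp [send, h1, h2] at heq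
    · exact heq
    · rw [hmem s hs h1, hmem s' hs' h2]
  refine ⟨send, fun w => if h : ∃ s : ℤ, |s| ≤ M ∧ send s = w then h.choose else 0, h0,
    fun s hs => ?_⟩
  have h : ∃ s' : ℤ, |s'| ≤ M ∧ send s' = send s := ⟨s, hs, rfl⟩
  simp only
  rw [dif_pos h]
  exact hinj _ _ h.choose_spec.1 hs h.choose_spec.2

/-! ### The oscillating pair of modes -/

theorem eventually_small (c b : ℝ) (hb : 0 < b) : ∀ᶠ η : ℝ in 𝓝[>] 0, c * η ≤ b := by
  have h : Tendsto (fun η : ℝ => c * η) (𝓝[>] 0) (𝓝 0) := by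
    have : Tendsto (fun η : ℝ => c * η) (𝓝 0) (𝓝 (c * 0)) := (continuous_const_mul c).tendsto 0
    rw [mul_zero] at this
    exact this.mono_left nhdsWithin_le_nhds
  exact (h.eventually (ge_mem_nhds hb))

/-- The constants of one mode: `lam` is a nonzero eigenvalue of the Laplacian, `kap` the size of the
leading gain, `H` the sum of the moduli of the roots of the gain polynomial, `q = e^{-2jθ}`, and `r`
a phase. -/
structure ModeData where
  lam : ℝ
  kap : ℝ
  H : ℝ
  q : ℂ
  r : ℂ
  lam_pos : 0 < lam
  damping : 2 ≤ lam * (kap - 1) / 2 - H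
  q_ne : q ≠ 1
  norm_q : ‖q‖ = 1
  norm_r : ‖r‖ = 1

namespace ModeData

variable (d : ModeData)

/-- The sum of the two oscillating roots is `-a η`. -/
def a : ℝ := d.lam * d.kap / 2 - d.H

/-- Coefficient of the conjugate of the first variable in the corrected second variable. -/
def cμ : ℂ := -(d.lam / 2 * d.r) / (1 - d.q)

/-- Coefficient of the conjugate of the first variable in the corrected first variable. -/
def cν : ℂ := -d.cμ / (1 - d.q)

/-- Coefficient of the conjugate of the second variable in the corrected second variable. -/
def cτ : ℂ := (d.cμ * d.q - d.lam / 2 * d.r * d.kap) / (1 - d.q)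

theorem one_sub_q_ne : 1 - d.q ≠ 0 := sub_ne_zero.2 (Ne.symm d.q_ne)

theorem cμ_mul : d.cμ * (1 - d.q) = -(d.lam / 2 * d.r) := div_mul_cancel₀ _ d.one_sub_q_ne

theorem cν_mul : d.cν * (1 - d.q) = -d.cμ := div_mul_cancel₀ _ d.one_sub_q_ne

theorem cτ_mul : d.cτ * (1 - d.q) = d.cμ * d.q - d.lam / 2 * d.r * d.kap :=
  div_mul_cancel₀ _ d.one_sub_q_ne

/-- The roots of `X² + a η X + lam / 2`; the sign of the imaginary part is that of `s = ± 1`. -/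
def root (s η : ℝ) : ℂ := ⟨-(d.a * η) / 2, s * √(d.lam / 2 - (d.a * η) ^ 2 / 4)⟩

theorem root_add (s η : ℝ) : d.root s η + d.root (-s) η = -(d.a * η) := by
  apply Complex.ext <;> simp [root]

theorem root_mul {s η : ℝ} (hs : s ^ 2 = 1) (hη : (d.a * η) ^ 2 ≤ d.lam) :
    d.root s η * d.root (-s) η = d.lam / 2 := by
  have h0 : 0 ≤ d.lam / 2 - (d.a * η) ^ 2 / 4 := by have := d.lam_pos; linarith
  have h := Real.sq_sqrt h0
  apply Complex.ext
  · simp only [root, Complex.mul_re, Complex.div_ofNat_re, Complex.ofReal_re]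
    linear_combination s ^ 2 * h + (d.lam / 2 - (d.a * η) ^ 2 / 4) * hs
  · simp only [root, Complex.mul_im, Complex.div_ofNat_im, Complex.ofReal_im]
    ring

theorem norm_root_sq {s η : ℝ} (hs : s ^ 2 = 1) (hη : (d.a * η) ^ 2 ≤ d.lam) :
    ‖d.root s η‖ ^ 2 = d.lam / 2 := by
  have h0 : 0 ≤ d.lam / 2 - (d.a * η) ^ 2 / 4 := by have := d.lam_pos; linarith
  have h := Real.sq_sqrt h0
  rw [Complex.sq_norm, Complex.normSq_apply]
  simp only [root]
  linear_combination s ^ 2 * h + (d.lam / 2 - (d.a * η) ^ 2 / 4) * hs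

theorem norm_root_le {s η : ℝ} (hs : s ^ 2 = 1) (hη : (d.a * η) ^ 2 ≤ d.lam) :
    ‖d.root s η‖ ≤ 1 + d.lam := by
  have h := d.norm_root_sq hs hη
  have := d.lam_pos
  nlinarith [norm_nonneg (d.root s η)]

theorem norm_one_add_root_le {s η : ℝ} (hs : s ^ 2 = 1) (hη : (d.a * η) ^ 2 ≤ d.lam)
    (hη1 : η ^ 2 ≤ 1) : ‖1 + η * d.root s η‖ ≤ 1 - η ^ 2 := by
  have h0 : 0 ≤ d.lam / 2 - (d.a * η) ^ 2 / 4 := by have := d.lam_pos; linarith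
  have h := Real.sq_sqrt h0
  refine abs_le_of_sq_le_sq' ?_ (by linarith) |>.2
  rw [Complex.sq_norm, Complex.normSq_apply]
  simp only [root, Complex.add_re, Complex.add_im, Complex.mul_re, Complex.mul_im,
    Complex.ofReal_re, Complex.ofReal_im, Complex.one_re, Complex.one_im]
  have hd := d.damping
  have ha : d.a - d.lam / 2 = d.lam * (d.kap - 1) / 2 - d.H := by unfold a; ring
  have h1 : (1 + (η * (-(d.a * η) / 2) - 0 * (s * √(d.lam / 2 - (d.a * η) ^ 2 / 4)))) *
      (1 + (η * (-(d.a * η) / 2) - 0 * (s * √(d.lam / 2 - (d.a * η) ^ 2 / 4)))) +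
      (0 + (η * (s * √(d.lam / 2 - (d.a * η) ^ 2 / 4)) + 0 * (-(d.a * η) / 2))) *
      (0 + (η * (s * √(d.lam / 2 - (d.a * η) ^ 2 / 4)) + 0 * (-(d.a * η) / 2))) =
      1 - (d.a - d.lam / 2) * η ^ 2 := by
    linear_combination η ^ 2 * s ^ 2 * h + η ^ 2 * (d.lam / 2 - (d.a * η) ^ 2 / 4) * hs
  rw [h1, ha]
  nlinarith [sq_nonneg η, sq_nonneg (η ^ 2)]

/-- The corrected oscillating modes. The corrections by conjugates, of relative order `η`, remove
the conjugates from the dynamics up to the order `η³`; this is possible since `q ≠ 1`. -/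
def pair (s η : ℝ) (P Z : ℂ) : ℂ :=
  (Z - η * d.cμ * conj P - η ^ 2 * d.cτ * conj Z) -
    d.root (-s) η * (P - η ^ 2 * d.cν * conj P)

theorem pair_add (s η : ℝ) (P Z P' Z' : ℂ) :
    d.pair s η (P + P') (Z + Z') = d.pair s η P Z + d.pair s η P' Z' := by
  simp only [pair, map_add]
  ring

/-- The increment of the second variable, with an error `ρ`. -/
def incr (η : ℝ) (P Z ρ : ℂ) : ℂ :=
  -(d.lam / 2) * (η * P + d.kap * η ^ 2 * Z) +
    d.lam / 2 * d.r * (η * conj P + d.kap * η ^ 2 * conj Z) + d.H * η ^ 2 * Z + ρ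

theorem pair_step_eq {s η : ℝ} (hs : s ^ 2 = 1) (hη : (d.a * η) ^ 2 ≤ d.lam) {e : ℂ}
    (he : e * conj e = 1) (hq : conj e ^ 2 = d.q) (P Z ρ : ℂ) :
    d.pair s η (e * (P + η * Z)) (e * (Z + d.incr η P Z ρ)) =
      e * ((1 + η * d.root s η) * d.pair s η P Z +
        ((ρ - η ^ 2 * d.cτ * d.q * conj (d.incr η P Z ρ) -
            η ^ 3 * (d.lam / 2 * d.cν + d.a * d.cμ) * conj P - η ^ 4 * d.a * d.cτ * conj Z) -
          d.root (-s) η * η ^ 3 * (d.cτ - d.cν * d.q) * conj Z)) := by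
  have ha : (d.a : ℂ) = d.lam * d.kap / 2 - d.H := by unfold a; push_cast; ring
  have hce : conj e = e * d.q := by rw [← hq]; linear_combination -conj e * he
  have h1 := d.cμ_mul
  have h2 := d.cν_mul
  have h3 := d.cτ_mul
  have h4 := d.root_add s η
  have h5 := d.root_mul hs hη
  have hi : d.incr η P Z ρ = -(d.lam / 2) * (η * P + d.kap * η ^ 2 * Z) +
    d.lam / 2 * d.r * (η * conj P + d.kap * η ^ 2 * conj Z) + d.H * η ^ 2 * Z + ρ := rfl
  rw [ha] at h4 ⊢
  simp only [pair, map_mul, map_add, Complex.conj_ofReal, hce]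
  generalize conj (d.incr η P Z ρ) = w
  rw [hi]
  generalize conj P = p at *
  generalize conj Z = z at *
  generalize d.root (-s) η = σ' at *
  generalize d.root s η = σ at *
  linear_combination e * η * p * h1 + e * η ^ 2 * z * h3 - e * σ' * η ^ 2 * p * h2 -
    e * η * (Z - η * d.cμ * p - η ^ 2 * d.cτ * z) * h4 + e * η * (P - η ^ 2 * d.cν * p) * h5

/-- A step multiplies the corrected oscillating modes by `e (1 + η σ)`, with `σ` a root, up to the
error `ρ` and terms of the order `η³`; the factor has modulus at most `1 - η²`. -/
theorem exists_pair_step : ∃ C, 0 < C ∧ ∀ η : ℝ, 0 < η → η ≤ 1 → (d.a * η) ^ 2 ≤ d.lam →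
    ∀ (e : ℂ), e * conj e = 1 → conj e ^ 2 = d.q → ∀ s : ℝ, s ^ 2 = 1 → ∀ P Z ρ : ℂ,
      ‖d.pair s η (e * (P + η * Z)) (e * (Z + d.incr η P Z ρ))‖ ≤
        (1 - η ^ 2) * ‖d.pair s η P Z‖ + C * (‖ρ‖ + η ^ 3 * (‖P‖ + ‖Z‖)) := by
  set L := d.lam * (1 + |d.kap|) + |d.H| with hL
  set C := 1 + ‖d.cτ‖ * (L + 1) + (d.lam * ‖d.cν‖ + |d.a| * ‖d.cμ‖) + |d.a| * ‖d.cτ‖ +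
    (1 + d.lam) * (‖d.cτ‖ + ‖d.cν‖) with hC
  have hl := d.lam_pos
  have hL0 : 0 ≤ L := by positivity
  have hC0 : 0 < C := by positivity
  refine ⟨C, hC0, fun η hη0 hη1 hη e he hq s hs P Z ρ => ?_⟩
  have hne : ‖e‖ = 1 := by
    have h : ‖e‖ * ‖e‖ = 1 := by
      rw [← norm_one (α := ℂ), ← he, norm_mul, Complex.norm_conj]
    nlinarith [norm_nonneg e]
  have hn2 : η ^ 2 ≤ η := by nlinarith
  have hn21 : η ^ 2 ≤ 1 := by linarith
  have hn4 : η ^ 4 ≤ η ^ 3 := pow_le_pow_of_le_one hη0.le hη1 (by norm_num)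
  set S := ‖P‖ + ‖Z‖ with hS
  have hP : ‖P‖ ≤ S := by have := norm_nonneg Z; linarith
  have hZ : ‖Z‖ ≤ S := by have := norm_nonneg P; linarith
  have hS0 : 0 ≤ S := (norm_nonneg P).trans hP
  have hnη : ‖(η : ℂ)‖ = η := by rw [Complex.norm_real, Real.norm_of_nonneg hη0.le]
  have hnl : ‖(d.lam : ℂ)‖ = d.lam := by rw [Complex.norm_real, Real.norm_of_nonneg hl.le]
  have hnl2 : ‖(d.lam / 2 : ℂ)‖ = d.lam / 2 := by
    rw [norm_div, hnl]; simp
  have hnk : ‖(d.kap : ℂ)‖ = |d.kap| := by rw [Complex.norm_real, Real.norm_eq_abs]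
  have hnH : ‖(d.H : ℂ)‖ = |d.H| := by rw [Complex.norm_real, Real.norm_eq_abs]
  have hna : ‖(d.a : ℂ)‖ = |d.a| := by rw [Complex.norm_real, Real.norm_eq_abs]
  have hincr : ‖d.incr η P Z ρ‖ ≤ L * (η * S) + ‖ρ‖ := by
    unfold incr
    have t1 : ‖(η : ℂ) * P + d.kap * η ^ 2 * Z‖ ≤ η * ((1 + |d.kap|) * S) := by
      refine (norm_add_le _ _).trans ?_
      rw [norm_mul, norm_mul, norm_mul, norm_pow, hnη, hnk]
      calc η * ‖P‖ + |d.kap| * η ^ 2 * ‖Z‖ ≤ η * S + |d.kap| * η * S := by gcongr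
        _ = _ := by ring
    have t2 : ‖(η : ℂ) * conj P + d.kap * η ^ 2 * conj Z‖ ≤ η * ((1 + |d.kap|) * S) := by
      have : (η : ℂ) * conj P + d.kap * η ^ 2 * conj Z = conj (η * P + d.kap * η ^ 2 * Z) := by
        simp only [map_add, map_mul, map_pow, Complex.conj_ofReal]
      rwa [this, Complex.norm_conj]
    refine (norm_add_le _ _).trans (add_le_add_left ?_ _)
    refine (norm_add_le _ _).trans ?_
    refine (add_le_add_left (norm_add_le _ _) _).trans ?_
    rw [norm_mul, norm_mul, norm_mul, norm_mul, norm_mul, norm_neg, hnl2, d.norm_r, hnH, norm_pow,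
      hnη]
    calc d.lam / 2 * ‖(η : ℂ) * P + d.kap * η ^ 2 * Z‖ +
          d.lam / 2 * 1 * ‖(η : ℂ) * conj P + d.kap * η ^ 2 * conj Z‖ + |d.H| * η ^ 2 * ‖Z‖
        ≤ d.lam / 2 * (η * ((1 + |d.kap|) * S)) + d.lam / 2 * 1 * (η * ((1 + |d.kap|) * S)) +
          |d.H| * η * S := by gcongr
      _ = _ := by rw [hL]; ring
  rw [d.pair_step_eq hs hη he hq, norm_mul, hne, one_mul]
  refine (norm_add_le _ _).trans (add_le_add ?_ ?_)
  · rw [norm_mul]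
    exact mul_le_mul_of_nonneg_right (d.norm_one_add_root_le hs hη hn21) (norm_nonneg _)
  · have hs' : (-s) ^ 2 = 1 := by rw [neg_sq, hs]
    refine (norm_sub_le _ _).trans ?_
    refine (add_le_add_left (norm_sub_le _ _) _).trans ?_
    refine (add_le_add_left (add_le_add_left (norm_sub_le _ _) _) _).trans ?_
    refine (add_le_add_left (add_le_add_left (add_le_add_left (norm_sub_le _ _) _) _) _).trans ?_
    have u1 : ‖(η : ℂ) ^ 2 * d.cτ * d.q * conj (d.incr η P Z ρ)‖ ≤
        ‖d.cτ‖ * (L + 1) * (‖ρ‖ + η ^ 3 * S) := by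
      rw [norm_mul, norm_mul, norm_mul, norm_pow, hnη, d.norm_q, mul_one, Complex.norm_conj]
      have hρ := norm_nonneg ρ
      have hη3 : 0 ≤ η ^ 3 * S := by positivity
      calc η ^ 2 * ‖d.cτ‖ * ‖d.incr η P Z ρ‖ ≤ η ^ 2 * ‖d.cτ‖ * (L * (η * S) + ‖ρ‖) := by gcongr
        _ = ‖d.cτ‖ * (L * (η ^ 3 * S) + η ^ 2 * ‖ρ‖) := by ring
        _ ≤ ‖d.cτ‖ * ((L + 1) * (‖ρ‖ + η ^ 3 * S)) := by
          refine mul_le_mul_of_nonneg_left ?_ (norm_nonneg _)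
          nlinarith
        _ = _ := by ring
    have u2 : ‖(η : ℂ) ^ 3 * (d.lam / 2 * d.cν + d.a * d.cμ) * conj P‖ ≤
        (d.lam * ‖d.cν‖ + |d.a| * ‖d.cμ‖) * (η ^ 3 * S) := by
      rw [norm_mul, norm_mul, norm_pow, hnη, Complex.norm_conj]
      have : ‖(d.lam / 2 * d.cν + d.a * d.cμ : ℂ)‖ ≤ d.lam * ‖d.cν‖ + |d.a| * ‖d.cμ‖ := by
        refine (norm_add_le _ _).trans ?_
        rw [norm_mul, norm_mul, hnl2, hna]
        have := norm_nonneg d.cν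
        nlinarith
      calc _ ≤ η ^ 3 * (d.lam * ‖d.cν‖ + |d.a| * ‖d.cμ‖) * S := by gcongr
        _ = _ := by ring
    have u3 : ‖(η : ℂ) ^ 4 * d.a * d.cτ * conj Z‖ ≤ |d.a| * ‖d.cτ‖ * (η ^ 3 * S) := by
      rw [norm_mul, norm_mul, norm_mul, norm_pow, hnη, hna, Complex.norm_conj]
      calc _ ≤ η ^ 3 * |d.a| * ‖d.cτ‖ * S := by gcongr
        _ = _ := by ring
    have u4 : ‖d.root (-s) η * η ^ 3 * (d.cτ - d.cν * d.q) * conj Z‖ ≤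
        (1 + d.lam) * (‖d.cτ‖ + ‖d.cν‖) * (η ^ 3 * S) := by
      rw [norm_mul, norm_mul, norm_mul, norm_pow, hnη, Complex.norm_conj]
      have v1 := d.norm_root_le hs' hη
      have v2 : ‖d.cτ - d.cν * d.q‖ ≤ ‖d.cτ‖ + ‖d.cν‖ := by
        refine (norm_sub_le _ _).trans ?_
        rw [norm_mul, d.norm_q, mul_one]
      calc _ ≤ (1 + d.lam) * η ^ 3 * (‖d.cτ‖ + ‖d.cν‖) * S := by gcongr
        _ = _ := by ring
    have hρ := norm_nonneg ρ
    have hη3 : 0 ≤ η ^ 3 * S := by positivity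
    have w : ∀ c : ℝ, 0 ≤ c → c * (η ^ 3 * S) ≤ c * (‖ρ‖ + η ^ 3 * S) := fun c hc =>
      mul_le_mul_of_nonneg_left (by linarith) hc
    have w2 := w (d.lam * ‖d.cν‖ + |d.a| * ‖d.cμ‖) (by positivity)
    have w3 := w (|d.a| * ‖d.cτ‖) (by positivity)
    have w4 := w ((1 + d.lam) * (‖d.cτ‖ + ‖d.cν‖)) (by positivity)
    rw [hC]
    linarith

theorem eventually_root : ∀ᶠ η : ℝ in 𝓝[>] 0, (d.a * η) ^ 2 ≤ d.lam := by
  have hl := d.lam_pos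
  filter_upwards [eventually_small |d.a| (√d.lam) (Real.sqrt_pos.2 hl), self_mem_nhdsWithin]
    with η h1 h2
  have h3 : |d.a * η| ≤ √d.lam := by
    rw [abs_mul, abs_of_pos (show 0 < η from h2)]
    exact h1
  calc (d.a * η) ^ 2 = |d.a * η| ^ 2 := (sq_abs _).symm
    _ ≤ √d.lam ^ 2 := pow_le_pow_left₀ (abs_nonneg _) h3 2
    _ = d.lam := Real.sq_sqrt hl.le

/-- The corrected oscillating modes control both variables. -/
theorem exists_le_pair : ∃ C, 0 < C ∧ ∀ᶠ η : ℝ in 𝓝[>] 0, ∀ (R : ℝ) (P Z : ℂ),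
    ‖d.pair 1 η P Z‖ ≤ R → ‖d.pair (-1) η P Z‖ ≤ R → ‖P‖ ≤ C * R ∧ ‖Z‖ ≤ C * R := by
  have hl := d.lam_pos
  have hsl := Real.sqrt_pos.2 hl
  set c := 2 / √d.lam with hc
  have hc0 : 0 < c := by positivity
  set C₁ := 2 * c with hC₁
  set C₂ := 2 * (1 + (1 + d.lam) * c + C₁) with hC₂
  have hC₁0 : 0 < C₁ := by positivity
  have hC₂0 : 0 < C₂ := by positivity
  refine ⟨C₁ + C₂, by positivity, ?_⟩
  filter_upwards [d.eventually_root, eventually_small ‖d.cν‖ (1 / 2) (by norm_num),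
    eventually_small ‖d.cτ‖ (1 / 2) (by norm_num), eventually_small ‖d.cμ‖ 1 one_pos,
    eventually_small 1 1 one_pos, self_mem_nhdsWithin] with η hη hν hτ hμ hη1 hη0 R P Z h1 h2
  rw [one_mul] at hη1
  replace hη0 : 0 < η := hη0
  have hR : 0 ≤ R := (norm_nonneg _).trans h1
  have hnη : ‖(η : ℂ)‖ = η := by rw [Complex.norm_real, Real.norm_of_nonneg hη0.le]
  set F := P - η ^ 2 * d.cν * conj P with hF
  set G := Z - η * d.cμ * conj P - η ^ 2 * d.cτ * conj Z with hG
  have hp1 : d.pair 1 η P Z = G - d.root (-1) η * F := rfl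
  have hp2 : d.pair (-1) η P Z = G - d.root 1 η * F := by
    rw [pair, neg_neg]
  have hdiff : d.pair 1 η P Z - d.pair (-1) η P Z = (d.root 1 η - d.root (-1) η) * F := by
    rw [hp1, hp2]; ring
  have hroot : √d.lam ≤ ‖d.root 1 η - d.root (-1) η‖ := by
    have h3 : d.root 1 η - d.root (-1) η =
        ((2 * √(d.lam / 2 - (d.a * η) ^ 2 / 4) : ℝ) : ℂ) * Complex.I := by
      apply Complex.ext <;> simp [root]
      ring
    rw [h3, norm_mul, Complex.norm_I, mul_one, Complex.norm_real,
      Real.norm_of_nonneg (by positivity)]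
    calc √d.lam = √(2 ^ 2 * (d.lam / 4)) := by congr 1; ring
      _ = 2 * √(d.lam / 4) := by
        rw [Real.sqrt_mul (by norm_num), Real.sqrt_sq (by norm_num)]
      _ ≤ _ := by
        refine mul_le_mul_of_nonneg_left (Real.sqrt_le_sqrt (by linarith)) (by norm_num)
  have hFb : ‖F‖ ≤ c * R := by
    have h3 : √d.lam * ‖F‖ ≤ 2 * R := by
      calc √d.lam * ‖F‖ ≤ ‖d.root 1 η - d.root (-1) η‖ * ‖F‖ := by gcongr
        _ = ‖d.pair 1 η P Z - d.pair (-1) η P Z‖ := by rw [hdiff, norm_mul]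
        _ ≤ _ := (norm_sub_le _ _).trans (by linarith)
    rw [hc, div_mul_eq_mul_div, le_div_iff₀ hsl]
    linarith
  have hGb : ‖G‖ ≤ (1 + (1 + d.lam) * c) * R := by
    have h3 : G = d.pair 1 η P Z + d.root (-1) η * F := by rw [hp1]; ring
    rw [h3]
    refine (norm_add_le _ _).trans ?_
    rw [norm_mul]
    have := d.norm_root_le (s := -1) (by norm_num) hη
    calc _ ≤ R + (1 + d.lam) * (c * R) := by gcongr
      _ = _ := by ring
  have hP : ‖P‖ ≤ C₁ * R := by
    have h3 : P = F + η ^ 2 * d.cν * conj P := by rw [hF]; ring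
    have h4 : ‖P‖ ≤ ‖F‖ + ‖(η : ℂ) ^ 2 * d.cν * conj P‖ := by
      conv_lhs => rw [h3]
      exact norm_add_le _ _
    rw [norm_mul, norm_mul, norm_pow, hnη, Complex.norm_conj] at h4
    have h5 : η ^ 2 * ‖d.cν‖ ≤ 1 / 2 := by nlinarith [norm_nonneg d.cν]
    have h6 := mul_le_mul_of_nonneg_right h5 (norm_nonneg P)
    rw [hC₁]
    linarith
  have hZ : ‖Z‖ ≤ C₂ * R := by
    have h3 : Z = G + η * d.cμ * conj P + η ^ 2 * d.cτ * conj Z := by rw [hG]; ring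
    have h4 : ‖Z‖ ≤ ‖G‖ + ‖(η : ℂ) * d.cμ * conj P‖ + ‖(η : ℂ) ^ 2 * d.cτ * conj Z‖ := by
      conv_lhs => rw [h3]
      exact norm_add₃_le
    rw [norm_mul, norm_mul, norm_mul, norm_mul, norm_pow, hnη, Complex.norm_conj,
      Complex.norm_conj] at h4
    have h5 : η ^ 2 * ‖d.cτ‖ ≤ 1 / 2 := by nlinarith [norm_nonneg d.cτ]
    have h6 := mul_le_mul_of_nonneg_right h5 (norm_nonneg Z)
    have h7 : η * ‖d.cμ‖ ≤ 1 := by linarith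
    have h8 := mul_le_mul_of_nonneg_right h7 (norm_nonneg P)
    rw [hC₂]
    linarith
  constructor
  · have : 0 ≤ C₂ * R := by positivity
    linarith
  · have : 0 ≤ C₁ * R := by positivity
    linarith

theorem exists_pair_le : ∃ C, 0 < C ∧ ∀ η : ℝ, 0 < η → η ≤ 1 → (d.a * η) ^ 2 ≤ d.lam →
    ∀ s : ℝ, s ^ 2 = 1 → ∀ P Z : ℂ, ‖d.pair s η P Z‖ ≤ C * (‖P‖ + ‖Z‖) := by
  have hl := d.lam_pos
  refine ⟨1 + ‖d.cμ‖ + ‖d.cτ‖ + (1 + d.lam) * (1 + ‖d.cν‖), by positivity,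
    fun η hη0 hη1 hη s hs P Z => ?_⟩
  have hnη : ‖(η : ℂ)‖ = η := by rw [Complex.norm_real, Real.norm_of_nonneg hη0.le]
  have hη2 : η ^ 2 ≤ 1 := by nlinarith
  unfold pair
  refine (norm_sub_le _ _).trans ?_
  refine (add_le_add_left (norm_sub_le _ _) _).trans ?_
  refine (add_le_add_left (add_le_add_left (norm_sub_le _ _) _) _).trans ?_
  have h1 : ‖(η : ℂ) * d.cμ * conj P‖ ≤ ‖d.cμ‖ * ‖P‖ := by
    rw [norm_mul, norm_mul, hnη, Complex.norm_conj]
    calc _ ≤ 1 * ‖d.cμ‖ * ‖P‖ := by gcongr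
      _ = _ := by ring
  have h2 : ‖(η : ℂ) ^ 2 * d.cτ * conj Z‖ ≤ ‖d.cτ‖ * ‖Z‖ := by
    rw [norm_mul, norm_mul, norm_pow, hnη, Complex.norm_conj]
    calc _ ≤ 1 * ‖d.cτ‖ * ‖Z‖ := by gcongr
      _ = _ := by ring
  have h3 : ‖d.root (-s) η * (P - η ^ 2 * d.cν * conj P)‖ ≤ (1 + d.lam) * ((1 + ‖d.cν‖) * ‖P‖) := by
    rw [norm_mul]
    have := d.norm_root_le (s := -s) (by rw [neg_sq, hs]) hη
    have h4 : ‖P - η ^ 2 * d.cν * conj P‖ ≤ (1 + ‖d.cν‖) * ‖P‖ := by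
      refine (norm_sub_le _ _).trans ?_
      rw [norm_mul, norm_mul, norm_pow, hnη, Complex.norm_conj]
      calc _ ≤ ‖P‖ + 1 * ‖d.cν‖ * ‖P‖ := by gcongr
        _ = _ := by ring
    gcongr
  have e1 := norm_nonneg P
  have e2 := norm_nonneg Z
  have e3 : 0 ≤ ‖d.cμ‖ * ‖Z‖ := by positivity
  have e4 : 0 ≤ ‖d.cτ‖ * ‖P‖ := by positivity
  have e5 : 0 ≤ (1 + d.lam) * ((1 + ‖d.cν‖) * ‖Z‖) := by positivity
  linarith

end ModeData

/-! ### The cascade of slow modes -/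

/-- `casc Ω i k` is the value at `k` of `(S + 1) ⋯ (S + i) Ω`, where `S` is the shift. -/
def casc (Ω : ℕ → ℂ) : ℕ → ℕ → ℂ
  | 0, k => Ω k
  | i + 1, k => casc Ω i (k + 1) + (i + 1) * casc Ω i k

theorem casc_add (Ω Ω' : ℕ → ℂ) (i : ℕ) :
    ∀ k, casc (fun l => Ω l + Ω' l) i k = casc Ω i k + casc Ω' i k := by
  induction i with
  | zero => intro k; rfl
  | succ i ih => intro k; simp only [casc, ih]; ring

theorem casc_congr {Ω Ω' : ℕ → ℂ} (i : ℕ) :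
    ∀ k, (∀ l ≤ i + k, Ω l = Ω' l) → casc Ω i k = casc Ω' i k := by
  induction i with
  | zero => exact fun k h => h k (by omega)
  | succ i ih =>
    intro k h
    simp only [casc]
    rw [ih (k + 1) fun l hl => h l (by omega), ih k fun l hl => h l (by omega)]

theorem casc_step {Ω Ω' : ℕ → ℂ} {e c : ℂ} {n : ℕ}
    (h : ∀ k ≤ n, Ω' k = e * (Ω k + c * Ω (k + 1))) (i : ℕ) :
    ∀ k, i + k ≤ n → casc Ω' i k = e * (casc Ω i k + c * casc Ω i (k + 1)) := by
  induction i with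
  | zero => exact fun k hk => h k (by omega)
  | succ i ih =>
    intro k hk
    simp only [casc]
    rw [ih (k + 1) (by omega), ih k (by omega)]
    ring

theorem norm_nat_add_one (i : ℕ) : ‖((i : ℂ) + 1)‖ = i + 1 := by
  have : ((i : ℂ) + 1) = ((i + 1 : ℕ) : ℂ) := by push_cast; ring
  rw [this, Complex.norm_natCast]
  push_cast
  ring

theorem norm_casc_le {Ω : ℕ → ℂ} {D : ℝ} (i : ℕ) :
    ∀ k, (∀ l ≤ i + k, ‖Ω l‖ ≤ D) → ‖casc Ω i k‖ ≤ (i + 1 : ℕ).factorial * D := by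
  induction i with
  | zero => intro k h; simpa [casc] using h k (by omega)
  | succ i ih =>
    intro k h
    have h1 := ih (k + 1) fun l hl => h l (by omega)
    have h2 := ih k fun l hl => h l (by omega)
    refine (norm_add_le _ _).trans ?_
    rw [norm_mul, norm_nat_add_one]
    rw [Nat.factorial_succ (i + 1)]
    push_cast
    calc _ ≤ ((i + 1 : ℕ).factorial * D : ℝ) + (i + 1) * ((i + 1 : ℕ).factorial * D) := by gcongr
      _ = _ := by ring

/-- The values of the cascade at `0` control all its values below the top. -/
theorem norm_casc_le_of_zero {Ω : ℕ → ℂ} {n : ℕ} {D : ℝ} (h : ∀ i ≤ n, ‖casc Ω i 0‖ ≤ D) (k : ℕ) :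
    ∀ i, i + k ≤ n → ‖casc Ω i k‖ ≤ (n + 1) ^ k * D := by
  induction k with
  | zero => intro i hi; simpa using h i (by omega)
  | succ k ih =>
    intro i hi
    have h1 : casc Ω i (k + 1) = casc Ω (i + 1) k - (i + 1) * casc Ω i k := by
      simp only [casc]; ring
    have h2 := ih (i + 1) (by omega)
    have h3 := ih i (by omega)
    have h4 : (i : ℝ) + 1 ≤ n := by exact_mod_cast (by omega : i + 1 ≤ n)
    have h5 := (norm_nonneg _).trans h3
    rw [h1]
    refine (norm_sub_le _ _).trans ?_
    rw [norm_mul, norm_nat_add_one]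
    calc _ ≤ ((n : ℝ) + 1) ^ k * D + n * (((n : ℝ) + 1) ^ k * D) := by gcongr
      _ = _ := by ring

theorem norm_casc_one_sub_le {Ω : ℕ → ℂ} {n : ℕ} {D : ℝ}
    (h : ∀ i k, i + k ≤ n → ‖casc Ω i k‖ ≤ D) (i : ℕ) :
    ∀ k, i + k = n + 1 → ‖casc Ω i k - Ω (n + 1)‖ ≤ i * ((n + 1) * D) := by
  induction i with
  | zero => intro k hk; rw [zero_add] at hk; simp [hk, casc]
  | succ i ih =>
    intro k hk
    have h1 := ih (k + 1) (by omega)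
    have h2 := h i k (by omega)
    have h3 : casc Ω (i + 1) k - Ω (n + 1) =
        (casc Ω i (k + 1) - Ω (n + 1)) + (i + 1) * casc Ω i k := by
      simp only [casc]; ring
    have h4 : (i : ℝ) ≤ n := by exact_mod_cast (by omega : i ≤ n)
    rw [h3]
    refine (norm_add_le _ _).trans ?_
    rw [norm_mul, norm_nat_add_one]
    push_cast
    calc _ ≤ (i : ℝ) * ((n + 1) * D) + (n + 1) * D := by gcongr
      _ = _ := by ring

theorem norm_casc_two_sub_le {Ω : ℕ → ℂ} {n : ℕ} {D : ℝ} (hD : 0 ≤ D)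
    (h : ∀ i k, i + k ≤ n → ‖casc Ω i k‖ ≤ D) (i : ℕ) :
    ∀ k, i ≤ n → i + k = n + 2 →
      ‖casc Ω i k - Ω (n + 2) - ((i * (i + 1) / 2 : ℝ) : ℂ) * Ω (n + 1)‖ ≤
        i * ((n + 1) * (n * ((n + 1) * D))) := by
  induction i with
  | zero => intro k _ hk; rw [zero_add] at hk; simp [hk, casc]
  | succ i ih =>
    intro k hi hk
    have h1 := ih (k + 1) (by omega) (by omega)
    have h2 := norm_casc_one_sub_le h i k (by omega)
    have h3 : casc Ω (i + 1) k - Ω (n + 2) -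
        ((((i + 1 : ℕ) : ℝ) * (((i + 1 : ℕ) : ℝ) + 1) / 2 : ℝ) : ℂ) * Ω (n + 1) =
        (casc Ω i (k + 1) - Ω (n + 2) - ((i * (i + 1) / 2 : ℝ) : ℂ) * Ω (n + 1)) +
          (i + 1) * (casc Ω i k - Ω (n + 1)) := by
      simp only [casc]; push_cast; ring
    have h4 : (i : ℝ) ≤ n := by exact_mod_cast (by omega : i ≤ n)
    rw [h3]
    refine (norm_add_le _ _).trans ?_
    rw [norm_mul, norm_nat_add_one]
    have h5 : (i : ℝ) * ((n + 1) * D) ≤ n * ((n + 1) * D) := by gcongr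
    have h6 : ((i : ℝ) + 1) * ‖casc Ω i k - Ω (n + 1)‖ ≤ (n + 1) * (n * ((n + 1) * D)) :=
      mul_le_mul (by linarith) (h2.trans h5) (norm_nonneg _) (by positivity)
    refine (add_le_add h1 h6).trans (le_of_eq ?_)
    push_cast
    ring

/-! ### The norm that contracts one mode -/

namespace ModeData

variable (d : ModeData)

/-- One step of a mode with vanishing disturbance, in the scaled coordinates `0, …, n + 1`. -/
structure IsStep (n : ℕ) (η : ℝ) (e : ℂ) (Ω Ω' : ℕ → ℂ) : Prop where
  low : ∀ k ≤ n, Ω' k = e * (Ω k + (η : ℂ) ^ 2 * Ω (k + 1))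
  top : Ω' (n + 1) = e * (Ω (n + 1) - d.lam / 2 * ((casc Ω n 0 + d.kap * η ^ 2 * Ω (n + 1)) -
    d.r * conj (casc Ω n 0 + d.kap * η ^ 2 * Ω (n + 1))))

/-- The coordinates in which a step of a mode is nearly diagonal: the cascade of slow modes with
geometric weights, which make its coupling small, and the two oscillating modes. -/
def modeVec (n : ℕ) (W η : ℝ) (Ω : ℕ → ℂ) : (Fin n → ℂ) × ℂ × ℂ :=
  (fun i => (W : ℂ)⁻¹ ^ (n - (i : ℕ)) * casc Ω i 0,
    d.pair 1 η (casc Ω n 0) (η * casc Ω n 1), d.pair (-1) η (casc Ω n 0) (η * casc Ω n 1))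

theorem modeVec_add (n : ℕ) (W η : ℝ) (Ω Ω' : ℕ → ℂ) :
    d.modeVec n W η (fun l => Ω l + Ω' l) = d.modeVec n W η Ω + d.modeVec n W η Ω' := by
  simp only [modeVec, casc_add, mul_add, pair_add]
  rfl

variable {d}

theorem norm_pair_one_le_modeVec (n : ℕ) (W η : ℝ) (Ω : ℕ → ℂ) :
    ‖d.pair 1 η (casc Ω n 0) (η * casc Ω n 1)‖ ≤ ‖d.modeVec n W η Ω‖ :=
  (norm_fst_le (d.modeVec n W η Ω).2).trans (norm_snd_le _)

theorem norm_pair_neg_one_le_modeVec (n : ℕ) (W η : ℝ) (Ω : ℕ → ℂ) :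
    ‖d.pair (-1) η (casc Ω n 0) (η * casc Ω n 1)‖ ≤ ‖d.modeVec n W η Ω‖ :=
  (norm_snd_le (d.modeVec n W η Ω).2).trans (norm_snd_le _)

theorem norm_casc_le_modeVec {n : ℕ} {W : ℝ} (hW : 0 < W) (η : ℝ) (Ω : ℕ → ℂ) {i : ℕ}
    (hi : i < n) : ‖casc Ω i 0‖ ≤ W ^ (n - i) * ‖d.modeVec n W η Ω‖ := by
  have hnW : ‖(W : ℂ)‖ = W := by rw [Complex.norm_real, Real.norm_of_nonneg hW.le]
  have h5 : ‖(d.modeVec n W η Ω).1 ⟨i, hi⟩‖ ≤ ‖d.modeVec n W η Ω‖ :=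
    (norm_le_pi_norm (d.modeVec n W η Ω).1 _).trans (norm_fst_le _)
  rw [← inv_mul_le_iff₀ (by positivity)]
  calc (W ^ (n - i))⁻¹ * ‖casc Ω i 0‖ = ‖(d.modeVec n W η Ω).1 ⟨i, hi⟩‖ := by
        simp only [modeVec]
        rw [norm_mul, norm_pow, norm_inv, hnW, inv_pow]
    _ ≤ _ := h5

theorem norm_modeVec_le {n : ℕ} {W : ℝ} (hW : 0 < W) (η : ℝ) (Ω : ℕ → ℂ) {R : ℝ} (hR : 0 ≤ R)
    (h : ∀ i < n, ‖casc Ω i 0‖ ≤ W ^ (n - i) * R)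
    (h1 : ‖d.pair 1 η (casc Ω n 0) (η * casc Ω n 1)‖ ≤ R)
    (h2 : ‖d.pair (-1) η (casc Ω n 0) (η * casc Ω n 1)‖ ≤ R) : ‖d.modeVec n W η Ω‖ ≤ R := by
  have hnW : ‖(W : ℂ)‖ = W := by rw [Complex.norm_real, Real.norm_of_nonneg hW.le]
  refine norm_prod_le_iff.2 ⟨(pi_norm_le_iff_of_nonneg hR).2 fun i => ?_,
    norm_prod_le_iff.2 ⟨h1, h2⟩⟩
  simp only [modeVec]
  rw [norm_mul, norm_pow, norm_inv, hnW, inv_pow, inv_mul_le_iff₀ (by positivity)]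
  exact h i i.2

/-- One step in the coordinates of the cascade. The shift structure extends to the top coordinate
if the control is taken as the next, fictitious coordinate. The error of the oscillating modes is
of the order `η³`. -/
theorem IsStep.casc_eq {n : ℕ} {η : ℝ} {e : ℂ} {Ω Ω' : ℕ → ℂ} (hΩ : d.IsStep n η e Ω Ω')
    (hH : d.H = n * (n + 1) / 2) (hη0 : 0 < η) {D : ℝ}
    (hall : ∀ i k, i + k ≤ n → ‖casc Ω i k‖ ≤ D) :
    (∀ i < n, casc Ω' i 0 =
      e * ((1 - (i + 1) * (η : ℂ) ^ 2) * casc Ω i 0 + (η : ℂ) ^ 2 * casc Ω (i + 1) 0)) ∧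
    casc Ω' n 0 = e * (casc Ω n 0 + η * (η * casc Ω n 1)) ∧
    ∃ ρ : ℂ, ‖ρ‖ ≤ η ^ 3 * (((d.lam * |d.kap| + |d.H|) * (n * (n + 1)) +
        n * (n + 1) * (n * (n + 1))) * D) ∧
      η * casc Ω' n 1 = e * (η * casc Ω n 1 + d.incr η (casc Ω n 0) (η * casc Ω n 1) ρ) := by
  have hl := d.lam_pos
  have hD0 : 0 ≤ D := (norm_nonneg _).trans (hall 0 0 (by omega))
  have hnη : ‖(η : ℂ)‖ = η := by rw [Complex.norm_real, Real.norm_of_nonneg hη0.le]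
  set U := casc Ω n 0 + d.kap * η ^ 2 * Ω (n + 1) with hU
  set top : ℂ := -(d.lam / 2 * (U - d.r * conj U)) / η ^ 2 with htop
  have hηc : (η : ℂ) ≠ 0 := by exact_mod_cast hη0.ne'
  set Ψ : ℕ → ℂ := fun l => if l = n + 2 then top else Ω l with hΨ
  have hΨΩ : ∀ l ≤ n + 1, Ψ l = Ω l := fun l hl => if_neg (by omega)
  have hΨtop : Ψ (n + 2) = top := if_pos rfl
  have hcΨ : ∀ i k, i + k ≤ n + 1 → casc Ψ i k = casc Ω i k := fun i k hik =>
    casc_congr i k fun l hl => hΨΩ l (by omega)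
  have hΨstep : ∀ k ≤ n + 1, Ω' k = e * (Ψ k + (η : ℂ) ^ 2 * Ψ (k + 1)) := by
    intro k hk
    rcases Nat.eq_or_lt_of_le hk with rfl | hk
    · have h3 : (η : ℂ) ^ 2 * top = -(d.lam / 2 * (U - d.r * conj U)) := by
        rw [htop]; field_simp
      rw [hΩ.top, hΨΩ _ le_rfl, hΨtop, h3, ← hU]
      ring
    · rw [hΩ.low k (by omega), hΨΩ k (by omega), hΨΩ (k + 1) (by omega)]
  clear_value Ψ
  have hcs := casc_step hΨstep
  have hall' : ∀ i k, i + k ≤ n → ‖casc Ψ i k‖ ≤ D := fun i k hik => by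
    rw [hcΨ i k (by omega)]; exact hall i k hik
  have hb1 := norm_casc_one_sub_le hall' n 1 rfl
  have hb2 := norm_casc_two_sub_le hD0 hall' n 2 le_rfl rfl
  rw [← hH, hΨΩ _ le_rfl, hΨtop] at hb2
  rw [hΨΩ _ le_rfl, hcΨ n 1 le_rfl] at hb1
  refine ⟨fun i hi => ?_, ?_, ?_⟩
  · rw [hcs i 0 (by omega), hcΨ _ _ (by omega), hcΨ _ _ (by omega)]
    simp only [casc]
    ring
  · rw [hcs n 0 (by omega), hcΨ n 0 (by omega), hcΨ n (0 + 1) (by omega)]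
    ring
  obtain ⟨e₁, he₁⟩ : ∃ e₁, casc Ω n 1 - Ω (n + 1) = e₁ := ⟨_, rfl⟩
  obtain ⟨e₂, he₂⟩ : ∃ e₂, casc Ψ n 2 - top - d.H * Ω (n + 1) = e₂ := ⟨_, rfl⟩
  rw [he₁] at hb1
  rw [he₂] at hb2
  refine ⟨d.lam / 2 * d.kap * η ^ 3 * (e₁ - d.r * conj e₁) - d.H * η ^ 3 * e₁ + η ^ 3 * e₂, ?_, ?_⟩
  · have hnl2 : ‖(d.lam / 2 : ℂ)‖ = d.lam / 2 := by
      rw [norm_div, Complex.norm_real, Real.norm_of_nonneg hl.le]; simp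
    have t1 : ‖e₁ - d.r * conj e₁‖ ≤ 2 * (n * ((n + 1) * D)) := by
      refine (norm_sub_le _ _).trans ?_
      rw [norm_mul, d.norm_r, Complex.norm_conj]
      linarith
    refine (norm_add_le _ _).trans ?_
    refine (add_le_add_left (norm_sub_le _ _) _).trans ?_
    rw [norm_mul, norm_mul, norm_mul, norm_mul, norm_mul, norm_mul, norm_pow, hnη, hnl2,
      Complex.norm_real, Complex.norm_real, Real.norm_eq_abs, Real.norm_eq_abs]
    calc _ ≤ d.lam / 2 * |d.kap| * η ^ 3 * (2 * (n * ((n + 1) * D))) +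
          |d.H| * η ^ 3 * (n * ((n + 1) * D)) + η ^ 3 * (n * ((n + 1) * (n * ((n + 1) * D)))) := by
          gcongr
      _ = _ := by ring
  · rw [hcs n 1 (by omega), hcΨ n 1 (by omega)]
    have h1 : casc Ω n 1 = Ω (n + 1) + e₁ := by rw [← he₁]; ring
    have h2 : casc Ψ n (1 + 1) = top + d.H * Ω (n + 1) + e₂ := by rw [← he₂]; ring
    have h3 : (η : ℂ) ^ 2 * top = -(d.lam / 2 * (U - d.r * conj U)) := by
      rw [htop]; field_simp
    rw [h2, incr, h1]
    clear_value top
    simp only [map_add, map_mul, Complex.conj_ofReal, map_pow, hU] at h3 ⊢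
    linear_combination e * η * h3

variable (d)

/-- The bounds of the original coordinates by the coordinates of the modes. -/
theorem exists_le_modeVec (n : ℕ) : ∃ W C : ℝ, 4 ≤ W ∧ 0 < C ∧ ∀ᶠ η : ℝ in 𝓝[>] 0, ∀ Ω : ℕ → ℂ,
    ‖casc Ω n 0‖ ≤ W / 4 * ‖d.modeVec n W η Ω‖ ∧
    ‖η * casc Ω n 1‖ ≤ W / 4 * ‖d.modeVec n W η Ω‖ ∧
    (∀ i k, i + k ≤ n → ‖casc Ω i k‖ ≤ C * ‖d.modeVec n W η Ω‖) ∧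
    η * ‖Ω (n + 1)‖ ≤ C * ‖d.modeVec n W η Ω‖ := by
  obtain ⟨C₁, hC₁, hpair⟩ := d.exists_le_pair
  set W := 4 + 4 * C₁ with hW
  have hW0 : 0 < W := by linarith
  set D₁ := ((n : ℝ) + 1) ^ n * (W ^ n + C₁) with hD₁
  have hD₁0 : 0 < D₁ := by positivity
  refine ⟨W, D₁ + (C₁ + n * ((n + 1) * D₁)), by linarith, by positivity, ?_⟩
  filter_upwards [hpair, eventually_small 1 1 one_pos, self_mem_nhdsWithin] with η hpair hη1 hη0 Ω
  rw [one_mul] at hη1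
  replace hη0 : 0 < η := hη0
  have hnη : ‖(η : ℂ)‖ = η := by rw [Complex.norm_real, Real.norm_of_nonneg hη0.le]
  have hR0 : 0 ≤ ‖d.modeVec n W η Ω‖ := norm_nonneg _
  have h3 := hpair _ _ _ (norm_pair_one_le_modeVec n W η Ω) (norm_pair_neg_one_le_modeVec n W η Ω)
  have hCW : C₁ * ‖d.modeVec n W η Ω‖ ≤ W / 4 * ‖d.modeVec n W η Ω‖ :=
    mul_le_mul_of_nonneg_right (by linarith) hR0
  have h4 : ∀ i ≤ n, ‖casc Ω i 0‖ ≤ (W ^ n + C₁) * ‖d.modeVec n W η Ω‖ := by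
    intro i hi
    rcases Nat.eq_or_lt_of_le hi with rfl | hi
    · refine h3.1.trans (mul_le_mul_of_nonneg_right ?_ hR0)
      have : 0 < W ^ i := by positivity
      linarith
    · refine (norm_casc_le_modeVec hW0 η Ω hi).trans (mul_le_mul_of_nonneg_right ?_ hR0)
      have : W ^ (n - i) ≤ W ^ n := pow_le_pow_right₀ (by linarith) (by omega)
      linarith
  have hall : ∀ i k, i + k ≤ n → ‖casc Ω i k‖ ≤ D₁ * ‖d.modeVec n W η Ω‖ := fun i k hik => by
    refine (norm_casc_le_of_zero h4 k i hik).trans ?_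
    rw [hD₁, mul_assoc]
    refine mul_le_mul_of_nonneg_right ?_ (by positivity)
    exact pow_le_pow_right₀ (by linarith [(Nat.cast_nonneg n : (0 : ℝ) ≤ n)]) (by omega)
  have hb1 := norm_casc_one_sub_le hall n 1 rfl
  generalize ‖d.modeVec n W η Ω‖ = R at *
  have hC₁R : 0 ≤ C₁ * R := by positivity
  have hD₁R : 0 ≤ D₁ * R := by positivity
  have hER : 0 ≤ n * ((n + 1) * D₁) * R := by positivity
  refine ⟨h3.1.trans hCW, h3.2.trans hCW, fun i k hik => (hall i k hik).trans (by linarith), ?_⟩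
  have h1 : Ω (n + 1) = casc Ω n 1 - (casc Ω n 1 - Ω (n + 1)) := by ring
  have h2 : ‖Ω (n + 1)‖ ≤ ‖casc Ω n 1‖ + ‖casc Ω n 1 - Ω (n + 1)‖ := by
    conv_lhs => rw [h1]
    exact norm_sub_le _ _
  have h5 : η * ‖casc Ω n 1 - Ω (n + 1)‖ ≤ 1 * (n * ((n + 1) * (D₁ * R))) :=
    mul_le_mul hη1 hb1 (norm_nonneg _) zero_le_one
  have h6 := h3.2
  rw [norm_mul, hnη] at h6
  have h7 := mul_le_mul_of_nonneg_left h2 hη0.le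
  linarith

/-- The coordinates of the modes are bounded by the original coordinates. -/
theorem exists_modeVec_le (n : ℕ) {W : ℝ} (hW : 1 ≤ W) : ∃ C : ℝ, 0 < C ∧ ∀ᶠ η : ℝ in 𝓝[>] 0,
    ∀ (Ω : ℕ → ℂ) (D : ℝ), (∀ k ≤ n, ‖Ω k‖ ≤ D) → η * ‖Ω (n + 1)‖ ≤ D →
      ‖d.modeVec n W η Ω‖ ≤ C * D := by
  obtain ⟨C₃, hC₃, hle⟩ := d.exists_pair_le
  set f : ℝ := ((n + 1 : ℕ).factorial : ℝ) with hf
  have hf0 : 0 < f := by positivity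
  set C₅ := f + C₃ * (f + (1 + n * ((n + 1) * f))) with hC₅
  have hC₅0 : 0 < C₅ := by positivity
  refine ⟨C₅, hC₅0, ?_⟩
  filter_upwards [d.eventually_root, eventually_small 1 1 one_pos, self_mem_nhdsWithin]
    with η hη hη1 hη0 Ω D hD hD'
  rw [one_mul] at hη1
  replace hη0 : 0 < η := hη0
  have hnη : ‖(η : ℂ)‖ = η := by rw [Complex.norm_real, Real.norm_of_nonneg hη0.le]
  have hD0 : 0 ≤ D := (norm_nonneg _).trans (hD 0 (Nat.zero_le n))
  have hcb : ∀ i k, i + k ≤ n → ‖casc Ω i k‖ ≤ f * D := fun i k hik => by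
    refine (norm_casc_le i k fun l hl => hD l (by omega)).trans
      (mul_le_mul_of_nonneg_right ?_ hD0)
    rw [hf]
    exact Nat.cast_le.2 (Nat.factorial_le (by omega))
  have hb1 := norm_casc_one_sub_le hcb n 1 rfl
  have h1 : ‖η * casc Ω n 1‖ ≤ (1 + n * ((n + 1) * f)) * D := by
    have h2 : casc Ω n 1 = Ω (n + 1) + (casc Ω n 1 - Ω (n + 1)) := by ring
    have h3 : ‖casc Ω n 1‖ ≤ ‖Ω (n + 1)‖ + ‖casc Ω n 1 - Ω (n + 1)‖ := by
      conv_lhs => rw [h2]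
      exact norm_add_le _ _
    have h4 : η * ‖casc Ω n 1 - Ω (n + 1)‖ ≤ 1 * (n * ((n + 1) * (f * D))) :=
      mul_le_mul hη1 hb1 (norm_nonneg _) zero_le_one
    have h5 := mul_le_mul_of_nonneg_left h3 hη0.le
    rw [norm_mul, hnη]
    linarith
  have h0 := hcb n 0 le_rfl
  have hpairs : ∀ s : ℝ, s ^ 2 = 1 → ‖d.pair s η (casc Ω n 0) (η * casc Ω n 1)‖ ≤
      C₅ * D := by
    intro s hs
    refine (hle η hη0 hη1 hη s hs _ _).trans ?_
    have h6 : C₃ * (‖casc Ω n 0‖ + ‖η * casc Ω n 1‖) ≤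
        C₃ * (f * D + (1 + n * ((n + 1) * f)) * D) := by gcongr
    have h7 : 0 ≤ f * D := by positivity
    refine h6.trans ?_
    rw [hC₅]
    linarith
  refine norm_modeVec_le (by linarith) η Ω (by positivity) (fun i hi => ?_) (hpairs 1 (by norm_num))
    (hpairs (-1) (by norm_num))
  have h8 : 1 ≤ W ^ (n - i) := one_le_pow₀ hW
  have h9 : 0 ≤ C₃ * (f + (1 + n * ((n + 1) * f))) * D := by positivity
  calc _ ≤ f * D := hcb i 0 (by omega)
    _ ≤ C₅ * D := by rw [hC₅]; linarith
    _ ≤ W ^ (n - i) * (C₅ * D) := le_mul_of_one_le_left (by positivity) h8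

/-- In the coordinates of the modes, one step contracts by the factor `1 - 3 η² / 4`. -/
theorem exists_modeVec (n : ℕ) (hH : d.H = n * (n + 1) / 2) : ∃ W C : ℝ, 0 < C ∧
    ∀ᶠ η : ℝ in 𝓝[>] 0,
      (∀ e : ℂ, e * conj e = 1 → conj e ^ 2 = d.q → ∀ Ω Ω' : ℕ → ℂ, d.IsStep n η e Ω Ω' →
        ‖d.modeVec n W η Ω'‖ ≤ (1 - 3 * η ^ 2 / 4) * ‖d.modeVec n W η Ω‖) ∧
      (∀ Ω : ℕ → ℂ, (∀ k ≤ n, ‖Ω k‖ ≤ C * ‖d.modeVec n W η Ω‖) ∧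
        ‖casc Ω n 0‖ ≤ C * ‖d.modeVec n W η Ω‖ ∧
        η * ‖Ω (n + 1)‖ ≤ C * ‖d.modeVec n W η Ω‖) ∧
      ∀ (Ω : ℕ → ℂ) (D : ℝ), (∀ k ≤ n, ‖Ω k‖ ≤ D) → η * ‖Ω (n + 1)‖ ≤ D →
        ‖d.modeVec n W η Ω‖ ≤ C * D := by
  obtain ⟨W, D₁, hW4, hD₁0, hlow⟩ := d.exists_le_modeVec n
  obtain ⟨C₂, hC₂, hstep⟩ := d.exists_pair_step
  obtain ⟨C₃, hC₃, hle⟩ := d.exists_modeVec_le n (by linarith : 1 ≤ W)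
  have hl := d.lam_pos
  have hW0 : 0 < W := by linarith
  set Cρ := ((d.lam * |d.kap| + |d.H|) * (n * (n + 1)) + (n : ℝ) * (n + 1) * (n * (n + 1))) * D₁
    with hCρ
  have hCρ0 : 0 ≤ Cρ := by positivity
  refine ⟨W, D₁ + C₃, by positivity, ?_⟩
  filter_upwards [hlow, hle, d.eventually_root, eventually_small 1 1 one_pos,
    eventually_small n 1 one_pos, eventually_small (C₂ * (Cρ + W / 2)) (1 / 4) (by norm_num),
    self_mem_nhdsWithin] with η hlow hle hη hη1 hnη1 hCη hη0
  rw [one_mul] at hη1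
  replace hη0 : 0 < η := hη0
  have hη2 : η ^ 2 ≤ η := by nlinarith
  have hnη : ‖(η : ℂ)‖ = η := by rw [Complex.norm_real, Real.norm_of_nonneg hη0.le]
  refine ⟨fun e he hq Ω Ω' hΩ => ?_, fun Ω => ?_, fun Ω D hD hD' => ?_⟩
  · obtain ⟨hP, hZ, hall, -⟩ := hlow Ω
    have hlt : ∀ i < n, ‖casc Ω i 0‖ ≤ W ^ (n - i) * ‖d.modeVec n W η Ω‖ :=
      fun i hi => norm_casc_le_modeVec hW0 η Ω hi
    have hone := norm_pair_one_le_modeVec (d := d) n W η Ω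
    have hneg := norm_pair_neg_one_le_modeVec (d := d) n W η Ω
    obtain ⟨hcas, hP', ρ, hρ, hZ'⟩ := hΩ.casc_eq hH hη0 hall
    generalize ‖d.modeVec n W η Ω‖ = R at *
    have hR0 : 0 ≤ R := (norm_nonneg _).trans hone
    have hne : ‖e‖ = 1 := by
      have h : ‖e‖ * ‖e‖ = 1 := by
        rw [← norm_one (α := ℂ), ← he, norm_mul, Complex.norm_conj]
      nlinarith [norm_nonneg e]
    rw [← mul_assoc _ D₁ R, ← hCρ] at hρ
    have hpairs : ∀ s : ℝ, s ^ 2 = 1 → ‖d.pair s η (casc Ω n 0) (η * casc Ω n 1)‖ ≤ R →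
        ‖d.pair s η (casc Ω' n 0) (η * casc Ω' n 1)‖ ≤ (1 - 3 * η ^ 2 / 4) * R := by
      intro s hs hsR
      rw [hP', hZ']
      refine (hstep η hη0 hη1 hη e he hq s hs _ _ ρ).trans ?_
      have h1 : C₂ * (‖ρ‖ + η ^ 3 * (‖casc Ω n 0‖ + ‖η * casc Ω n 1‖)) ≤
          C₂ * (η ^ 3 * (Cρ * R) + η ^ 3 * (W / 4 * R + W / 4 * R)) := by gcongr
      have h2 : C₂ * (η ^ 3 * (Cρ * R) + η ^ 3 * (W / 4 * R + W / 4 * R)) =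
          (C₂ * (Cρ + W / 2) * η) * (η ^ 2 * R) := by ring
      have h3 : (C₂ * (Cρ + W / 2) * η) * (η ^ 2 * R) ≤ 1 / 4 * (η ^ 2 * R) := by gcongr
      have h4 : (1 - η ^ 2) * ‖d.pair s η (casc Ω n 0) (η * casc Ω n 1)‖ ≤ (1 - η ^ 2) * R :=
        mul_le_mul_of_nonneg_left hsR (by linarith)
      linarith
    have hfac : 0 ≤ (1 - 3 * η ^ 2 / 4) * R := mul_nonneg (by linarith) hR0
    refine norm_modeVec_le hW0 η Ω' hfac (fun i hi => ?_) (hpairs 1 (by norm_num) hone)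
      (hpairs (-1) (by norm_num) hneg)
    have h2 : ‖casc Ω (i + 1) 0‖ ≤ W ^ (n - i) * R / 4 := by
      have h3 : W ^ (n - i) = W * W ^ (n - (i + 1)) := by
        rw [← pow_succ']; congr 1; omega
      rcases Nat.eq_or_lt_of_le (Nat.succ_le_of_lt hi) with h | h
      · have h4 : casc Ω (i + 1) 0 = casc Ω n 0 := by rw [← h]
        rw [h4, h3, show n - (i + 1) = 0 by omega, pow_zero, mul_one]
        exact hP.trans (le_of_eq (by ring))
      · refine (hlt _ h).trans ?_
        rw [h3]
        have : 0 ≤ W ^ (n - (i + 1)) * R := by positivity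
        nlinarith
    have h3 := hlt i hi
    have h4 : (i : ℝ) + 1 ≤ n := by exact_mod_cast hi
    have h5 : ((i : ℝ) + 1) * η ^ 2 ≤ 1 := by
      calc ((i : ℝ) + 1) * η ^ 2 ≤ n * η := by gcongr
        _ ≤ 1 := hnη1
    have h6 : ‖(1 - (i + 1) * (η : ℂ) ^ 2)‖ = 1 - ((i : ℝ) + 1) * η ^ 2 := by
      have : (1 - (i + 1) * (η : ℂ) ^ 2) = ((1 - ((i : ℝ) + 1) * η ^ 2 : ℝ) : ℂ) := by
        push_cast; ring
      rw [this, Complex.norm_real, Real.norm_of_nonneg (by linarith)]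
    rw [hcas i hi, norm_mul, hne, one_mul]
    refine (norm_add_le _ _).trans ?_
    rw [norm_mul, norm_mul, h6, norm_pow, hnη]
    have h7 : 0 ≤ W ^ (n - i) * R := by positivity
    have h8 : 0 ≤ 1 - ((i : ℝ) + 1) * η ^ 2 := by linarith
    calc _ ≤ (1 - ((i : ℝ) + 1) * η ^ 2) * (W ^ (n - i) * R) +
          η ^ 2 * (W ^ (n - i) * R / 4) := by gcongr
      _ = (1 - 3 * η ^ 2 / 4 - i * η ^ 2) * (W ^ (n - i) * R) := by ring
      _ ≤ (1 - 3 * η ^ 2 / 4) * (W ^ (n - i) * R) := by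
        have : 0 ≤ (i : ℝ) * η ^ 2 := by positivity
        exact mul_le_mul_of_nonneg_right (by linarith) h7
      _ = _ := by ring
  · obtain ⟨-, -, hall, htop⟩ := hlow Ω
    have hle' : D₁ * ‖d.modeVec n W η Ω‖ ≤ (D₁ + C₃) * ‖d.modeVec n W η Ω‖ :=
      mul_le_mul_of_nonneg_right (by linarith) (norm_nonneg _)
    exact ⟨fun k hk => (hall 0 k (by omega)).trans hle', (hall n 0 le_rfl).trans hle',
      htop.trans hle'⟩
  · have hD0 : 0 ≤ D := (norm_nonneg _).trans (hD 0 (Nat.zero_le n))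
    exact (hle Ω D hD hD').trans (mul_le_mul_of_nonneg_right (by linarith) hD0)

end ModeData

/-! ### The modes of the closed loop -/

theorem sum_eq_sum_pad {m : ℕ} (y : Fin (2 * m) → ℝ) :
    ∑ l, y l = ∑ k ∈ Finset.range m, (pad y (2 * k) + pad y (2 * k + 1)) := by
  have h1 : ∑ l, y l = ∑ l ∈ Finset.range (2 * m), pad y l := by
    rw [← Fin.sum_univ_eq_sum_range]
    exact Finset.sum_congr rfl fun l _ => (pad_val y l).symm
  have h2 : ∀ M : ℕ, ∑ l ∈ Finset.range (2 * M), pad y l =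
      ∑ k ∈ Finset.range M, (pad y (2 * k) + pad y (2 * k + 1)) := by
    intro M
    induction M with
    | zero => simp
    | succ M ih =>
      rw [show 2 * (M + 1) = 2 * M + 1 + 1 by ring, Finset.sum_range_succ, Finset.sum_range_succ,
        ih, Finset.sum_range_succ]
      ring
  rw [h1, h2]

/-- The complex gain of the `k`-th block. -/
def cplxGain {m : ℕ} (g : Fin (2 * m) → ℝ) (k : ℕ) : ℂ := ⟨pad g (2 * k + 1), -pad g (2 * k)⟩

/-- The control is minus the imaginary part of a complex linear form. -/
theorem dotProduct_eq_im {m : ℕ} (g x : Fin (2 * m) → ℝ) :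
    g ⬝ᵥ x = -(∑ k ∈ Finset.range m, cplxGain g k * cplx x k).im := by
  have hp : ∀ i, pad (fun l => g l * x l) i = pad g i * pad x i := by
    intro i; unfold pad; split_ifs <;> simp
  rw [dotProduct, sum_eq_sum_pad, Complex.im_sum, ← Finset.sum_neg_distrib]
  refine Finset.sum_congr rfl fun k _ => ?_
  rw [hp, hp, Complex.mul_im]
  simp only [cplxGain, cplx]
  ring

open Polynomial in
/-- The monic polynomial with the roots `-i e^{jθ}`, `i = 1, …, j`. -/
def rootPoly (θ : ℝ) (j : ℕ) : Polynomial ℂ :=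
  ∏ i ∈ Finset.Icc 1 j, (X - C (-(i : ℂ) * Complex.exp (θ * Complex.I)))

open Polynomial in
theorem rootPoly_succ (θ : ℝ) (j : ℕ) :
    rootPoly θ (j + 1) = rootPoly θ j * (X + C (((j : ℂ) + 1) * rot θ)) := by
  rw [rootPoly, Finset.prod_Icc_succ_top (by omega), rootPoly, rot_eq_exp]
  congr 1
  rw [sub_eq_add_neg, ← C_neg]
  congr 2
  push_cast
  ring

theorem natDegree_rootPoly_le (θ : ℝ) (j : ℕ) : (rootPoly θ j).natDegree ≤ j := by
  refine (Polynomial.natDegree_prod_le _ _).trans ?_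
  calc _ ≤ ∑ _i ∈ Finset.Icc 1 j, 1 := Finset.sum_le_sum fun i _ => by
        rw [Polynomial.natDegree_X_sub_C]
    _ = j := by simp

theorem sum_coeff_rootPoly (θ : ℝ) (Ω : ℕ → ℂ) (j : ℕ) : ∀ k,
    ∑ l ∈ Finset.range (j + 1), (rootPoly θ j).coeff l * (rot θ ^ l * Ω (l + k)) =
      rot θ ^ j * casc Ω j k := by
  induction j with
  | zero => intro k; simp [rootPoly, casc]
  | succ j ih =>
    intro k
    have h0 : (rootPoly θ j).coeff (j + 1) = 0 :=
      Polynomial.coeff_eq_zero_of_natDegree_lt (by have := natDegree_rootPoly_le θ j; omega)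
    have h1 : ∀ l, (rootPoly θ (j + 1)).coeff (l + 1) =
        (rootPoly θ j).coeff l + (rootPoly θ j).coeff (l + 1) * (((j : ℂ) + 1) * rot θ) := by
      intro l
      rw [rootPoly_succ, mul_add, Polynomial.coeff_add, Polynomial.coeff_mul_X,
        Polynomial.coeff_mul_C]
    have h2 : (rootPoly θ (j + 1)).coeff 0 =
        (rootPoly θ j).coeff 0 * (((j : ℂ) + 1) * rot θ) := by
      rw [rootPoly_succ, mul_add, Polynomial.coeff_add, Polynomial.coeff_mul_X_zero,
        Polynomial.coeff_mul_C, zero_add]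
    have h3 := ih k
    have h4 := ih (k + 1)
    have h5 : ∑ l ∈ Finset.range (j + 1 + 1),
        (rootPoly θ j).coeff l * (rot θ ^ l * Ω (l + k)) = rot θ ^ j * casc Ω j k := by
      rw [Finset.sum_range_succ, h0, h3]; ring
    rw [Finset.sum_range_succ'] at h5 ⊢
    simp only [h1, h2, casc]
    calc _ = rot θ * ∑ l ∈ Finset.range (j + 1),
            (rootPoly θ j).coeff l * (rot θ ^ l * Ω (l + (k + 1))) +
          ((j : ℂ) + 1) * rot θ * (∑ l ∈ Finset.range (j + 1),
            (rootPoly θ j).coeff (l + 1) * (rot θ ^ (l + 1) * Ω (l + 1 + k)) +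
            (rootPoly θ j).coeff 0 * (rot θ ^ 0 * Ω (0 + k))) := by
          rw [mul_add, Finset.mul_sum, Finset.mul_sum, ← add_assoc, ← Finset.sum_add_distrib]
          congr 1
          · refine Finset.sum_congr rfl fun l _ => ?_
            rw [show l + (k + 1) = l + 1 + k by ring]
            ring
          · ring
      _ = _ := by rw [h4, h5]; ring

theorem gainPoly_coeff (n : ℕ) (θ : ℝ) (l : ℕ) :
    (gainPoly (n + 2) θ).coeff l = rot θ ^ 2 * (rootPoly θ n).coeff l := by
  have h : Complex.exp (2 * θ * Complex.I) = rot θ ^ 2 := by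
    rw [rot_eq_exp, ← Complex.exp_nat_mul]
    congr 1
    push_cast
    ring
  rw [gainPoly, Polynomial.coeff_C_mul, h]
  rfl

theorem cplxGain_gain_low {n : ℕ} (θ h ε : ℝ) {k : ℕ} (hk : k ≤ n) :
    cplxGain (gain (n + 2) θ h ε) k =
      rot θ ^ 2 * (rootPoly θ n).coeff k * (ε : ℂ) ^ (n + 1 - k) := by
  have e1 : (2 * k + 1) / 2 = k := by omega
  have e2 : (2 * k) / 2 = k := by omega
  rw [← gainPoly_coeff, ← Complex.ofReal_pow]
  apply Complex.ext
  · simp [cplxGain, pad, gain, gainConst, e1, show 2 * k + 1 < 2 * (n + 2) by omega,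
      show ¬ k = n + 1 by omega, show (2 * k + 1) % 2 = 1 by omega, -Complex.ofReal_pow]
  · simp [cplxGain, pad, gain, gainConst, e2, show 2 * k < 2 * (n + 2) by omega,
      show ¬ k = n + 1 by omega, -Complex.ofReal_pow]

theorem cplxGain_gain_top (n : ℕ) (θ h ε : ℝ) :
    cplxGain (gain (n + 2) θ h ε) (n + 1) =
      ((2 * gainH (n + 2) + 4) / h + 1 : ℝ) * rot θ * ε := by
  have e1 : (2 * (n + 1) + 1) / 2 = n + 1 := by omega
  have e2 : (2 * (n + 1)) / 2 = n + 1 := by omega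
  apply Complex.ext
  · simp only [cplxGain, pad, gain, gainConst, e1, show 2 * (n + 1) + 1 < 2 * (n + 2) by omega,
      show (2 * (n + 1) + 1) % 2 = 1 by omega, rot, Complex.mul_re, Complex.mul_im,
      Complex.ofReal_re, Complex.ofReal_im, dite_true]
    simp
  · simp only [cplxGain, pad, gain, gainConst, e2, show 2 * (n + 1) < 2 * (n + 2) by omega,
      show (2 * (n + 1)) % 2 = 0 by omega, rot, Complex.mul_re, Complex.mul_im,
      Complex.ofReal_re, Complex.ofReal_im, dite_true]
    simp
    ring

/-- The complex coordinates in the rotating frame; the `k`-th one is scaled with `ε^{-k}`. -/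
def scaled {m : ℕ} (θ η : ℝ) (x : Fin (2 * m) → ℝ) (k : ℕ) : ℂ :=
  cplx x k / (rot θ * η ^ 2) ^ k

theorem rot_mul_conj (θ : ℝ) : rot θ * conj (rot θ) = 1 := by
  rw [Complex.mul_conj, Complex.normSq_eq_norm_sq, norm_rot]
  simp

theorem rot_ne_zero (θ : ℝ) : rot θ ≠ 0 := by
  intro h
  have := rot_mul_conj θ
  rw [h, zero_mul] at this
  exact zero_ne_one this

theorem cplx_eq_scaled {m : ℕ} (θ : ℝ) {η : ℝ} (hη : 0 < η) (x : Fin (2 * m) → ℝ) (k : ℕ) :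
    cplx x k = (rot θ * η ^ 2) ^ k * scaled θ η x k := by
  have h : (η : ℂ) ≠ 0 := by exact_mod_cast hη.ne'
  rw [scaled, mul_div_cancel₀]
  exact pow_ne_zero _ (mul_ne_zero (rot_ne_zero θ) (pow_ne_zero 2 h))

theorem norm_scaled {m : ℕ} (θ : ℝ) {η : ℝ} (hη : 0 < η) (x : Fin (2 * m) → ℝ) (k : ℕ) :
    ‖cplx x k‖ = η ^ (2 * k) * ‖scaled θ η x k‖ := by
  rw [cplx_eq_scaled θ hη x k, norm_mul, norm_pow, norm_mul, norm_rot, norm_pow,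
    Complex.norm_real, Real.norm_of_nonneg hη.le, one_mul, ← pow_mul]

/-- The complex linear form that gives the control, in scaled coordinates. -/
theorem sum_cplxGain_gain {n : ℕ} (θ h : ℝ) {η : ℝ} (hη : 0 < η) (x : Fin (2 * (n + 2)) → ℝ) :
    ∑ k ∈ Finset.range (n + 2), cplxGain (gain (n + 2) θ h (η ^ 2)) k * cplx x k =
      rot θ ^ (n + 2) * (η ^ 2) ^ (n + 1) * (casc (scaled θ η x) n 0 +
        ((2 * gainH (n + 2) + 4) / h + 1 : ℝ) * η ^ 2 * scaled θ η x (n + 1)) := by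
  rw [Finset.sum_range_succ, cplxGain_gain_top, cplx_eq_scaled θ hη x (n + 1)]
  have h1 : ∑ k ∈ Finset.range (n + 1), cplxGain (gain (n + 2) θ h (η ^ 2)) k * cplx x k =
      rot θ ^ 2 * (η ^ 2) ^ (n + 1) * ∑ k ∈ Finset.range (n + 1),
        (rootPoly θ n).coeff k * (rot θ ^ k * scaled θ η x (k + 0)) := by
    rw [Finset.mul_sum]
    refine Finset.sum_congr rfl fun k hk => ?_
    have hk' : k ≤ n := by have := Finset.mem_range.1 hk; omega
    have h2 : ((η : ℂ) ^ 2) ^ (n + 1) = ((η : ℂ) ^ 2) ^ (n + 1 - k) * ((η : ℂ) ^ 2) ^ k := by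
      rw [← pow_add]; congr 1; omega
    rw [cplxGain_gain_low θ h _ hk', cplx_eq_scaled θ hη x k, h2, mul_pow, add_zero]
    push_cast
    ring
  rw [h1, sum_coeff_rootPoly]
  push_cast
  ring

theorem cplx_inputVec {n : ℕ} (k : ℕ) :
    cplx (inputVec (n + 2)) k = if k = n + 1 then -Complex.I else 0 := by
  have h1 : pad (inputVec (n + 2)) (2 * k) = 0 := by
    unfold pad inputVec
    split_ifs with h1 h2
    · dsimp only at h2; omega
    · rfl
    · rfl
  have h2 : pad (inputVec (n + 2)) (2 * k + 1) = if k = n + 1 then 1 else 0 := by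
    unfold pad inputVec
    dsimp only
    split_ifs <;> first | rfl | omega
  rw [cplx, h1, h2]
  split_ifs <;> apply Complex.ext <;> simp

theorem loop_mulVec {m : ℕ} (θ h ε lam : ℝ) (x : Fin (2 * m) → ℝ) :
    (jordanBlock m θ - lam • gainMatrix m θ h ε) *ᵥ x =
      jordanBlock m θ *ᵥ x + (-(lam * (gain m θ h ε ⬝ᵥ x))) • inputVec m := by
  rw [Matrix.sub_mulVec, Matrix.smul_mulVec, gainMatrix, Matrix.vecMulVec_mulVec, sub_eq_add_neg]
  congr 1
  ext i
  simp
  ring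

theorem gainH_nonneg (n : ℕ) : 0 ≤ gainH (n + 2) := by
  unfold gainH
  push_cast
  have : (0 : ℝ) ≤ n := Nat.cast_nonneg n
  have h1 : (n : ℝ) + 2 - 1 = n + 1 := by ring
  have h2 : (n : ℝ) + 2 - 2 = n := by ring
  rw [h1, h2]
  positivity

/-- The mode of the closed loop that belongs to the eigenvalue `lam ≥ h` of the Laplacian. -/
def modeData (n : ℕ) {θ h lam : ℝ} (hθ : sin θ ≠ 0) (hpos : 0 < h) (hle : h ≤ lam) : ModeData where
  lam := lam
  kap := (2 * gainH (n + 2) + 4) / h + 1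
  H := gainH (n + 2)
  q := conj (rot θ) ^ 2
  r := conj (rot θ) ^ (2 * (n + 2))
  lam_pos := hpos.trans_le hle
  damping := by
    have hH := gainH_nonneg n
    have h1 : 1 ≤ lam / h := (one_le_div hpos).2 hle
    have h2 : lam * ((2 * gainH (n + 2) + 4) / h + 1 - 1) / 2 =
        lam / h * (gainH (n + 2) + 2) := by
      field_simp
      ring
    rw [h2]
    nlinarith
  q_ne := by
    intro hq
    have h1 := congrArg Complex.re hq
    simp only [pow_two, Complex.mul_re, Complex.conj_re, Complex.conj_im, rot,
      Complex.one_re] at h1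
    have h2 := Real.cos_sq_add_sin_sq θ
    exact hθ (pow_eq_zero_iff (two_ne_zero) |>.1 (by nlinarith : sin θ ^ 2 = 0))
  norm_q := by rw [norm_pow, Complex.norm_conj, norm_rot, one_pow]
  norm_r := by rw [norm_pow, Complex.norm_conj, norm_rot, one_pow]

theorem isStep_scaled {n : ℕ} {θ h lam : ℝ} (hθ : sin θ ≠ 0) (hpos : 0 < h) (hle : h ≤ lam)
    {η : ℝ} (hη : 0 < η) (x : Fin (2 * (n + 2)) → ℝ) :
    (modeData n hθ hpos hle).IsStep n η (rot θ) (scaled θ η x) (scaled θ η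
      ((jordanBlock (n + 2) θ - lam • gainMatrix (n + 2) θ h (η ^ 2)) *ᵥ x)) := by
  have hηc : (η : ℂ) ≠ 0 := by exact_mod_cast hη.ne'
  have hr := rot_ne_zero θ
  have hd : ∀ k, (rot θ * (η : ℂ) ^ 2) ^ k ≠ 0 := fun k =>
    pow_ne_zero _ (mul_ne_zero hr (pow_ne_zero 2 hηc))
  rw [loop_mulVec]
  refine ⟨fun k hk => ?_, ?_⟩
  · rw [scaled, div_eq_iff (hd k), cplx_add, cplx_smul, cplx_jordanBlock, cplx_inputVec,
      if_neg (by omega), cplx_eq_scaled θ hη x k, cplx_eq_scaled θ hη x (k + 1)]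
    ring
  · have hV := sum_cplxGain_gain θ h hη x
    have him := dotProduct_eq_im (gain (n + 2) θ h (η ^ 2)) x
    rw [hV] at him
    change scaled θ η _ (n + 1) = rot θ * (scaled θ η x (n + 1) - (lam : ℂ) / 2 *
      ((casc (scaled θ η x) n 0 + ((2 * gainH (n + 2) + 4) / h + 1 : ℝ) * η ^ 2 *
        scaled θ η x (n + 1)) - conj (rot θ) ^ (2 * (n + 2)) *
        conj (casc (scaled θ η x) n 0 + ((2 * gainH (n + 2) + 4) / h + 1 : ℝ) * η ^ 2 *
        scaled θ η x (n + 1))))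
    generalize (casc (scaled θ η x) n 0 + ((2 * gainH (n + 2) + 4) / h + 1 : ℝ) * (η : ℂ) ^ 2 *
        scaled θ η x (n + 1)) = U at *
    obtain ⟨V, hVdef⟩ : ∃ V, rot θ ^ (n + 2) * ((η : ℂ) ^ 2) ^ (n + 1) * U = V := ⟨_, rfl⟩
    have hVc : conj (rot θ) ^ (n + 2) * ((η : ℂ) ^ 2) ^ (n + 1) * conj U = conj V := by
      rw [← hVdef]
      simp only [map_mul, map_pow, Complex.conj_ofReal]
    rw [hVdef] at him
    have h1 : (V.im : ℂ) * Complex.I = (V - conj V) / 2 := by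
      apply Complex.ext <;> simp
    have h2 : conj (rot θ) ^ (n + 2) = rot θ ^ (n + 2) * conj (rot θ) ^ (2 * (n + 2)) := by
      rw [two_mul, pow_add _ (n + 2) (n + 2), ← mul_assoc, ← mul_pow, rot_mul_conj, one_pow,
        one_mul]
    rw [scaled, div_eq_iff (hd _), cplx_add, cplx_smul, cplx_jordanBlock, cplx_inputVec,
      if_pos rfl, cplx_of_le x (show n + 2 ≤ n + 1 + 1 by omega), cplx_eq_scaled θ hη x (n + 1),
      him]
    push_cast
    rw [h2] at hVc
    linear_combination -(lam : ℂ) * h1 - (lam : ℂ) / 2 * hVdef.symm + (lam : ℂ) / 2 * hVc.symm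

theorem scaled_add {m : ℕ} (θ η : ℝ) (x y : Fin (2 * m) → ℝ) :
    scaled θ η (x + y) = fun l => scaled θ η x l + scaled θ η y l := by
  funext k
  rw [scaled, cplx_add, add_div]
  rfl

/-- A function adapted to one mode of the closed loop: it contracts by the factor
`1 - 3 η² / 4 = 1 - 3 ε / 4`, it is bounded by the norm uniformly in `ε`, and the control of the
mode is smaller by a factor of the order `η = √ε`. Only the last bound is not uniform. -/
structure IsModeNorm {m : ℕ} (θ h lam C B η : ℝ) (f : (Fin (2 * m) → ℝ) → ℝ) : Prop where
  add_le : ∀ x y, f (x + y) ≤ f x + f y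
  contr : ∀ x, f ((jordanBlock m θ - lam • gainMatrix m θ h (η ^ 2)) *ᵥ x) ≤
    (1 - 3 * η ^ 2 / 4) * f x
  control : ∀ x, |gain m θ h (η ^ 2) ⬝ᵥ x| ≤ C * η * f x
  le_norm : ∀ x, f x ≤ C * ‖x‖
  norm_le : ∀ x, ‖x‖ ≤ B * f x

theorem exists_isModeNorm {m : ℕ} (hm : 2 ≤ m) {θ h lam : ℝ} (hθ : sin θ ≠ 0) (hpos : 0 < h)
    (hle : h ≤ lam) : ∃ C, 0 < C ∧ ∀ᶠ η : ℝ in 𝓝[>] 0, ∃ B, 0 < B ∧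
      ∃ f : (Fin (2 * m) → ℝ) → ℝ, IsModeNorm θ h lam C B η f := by
  obtain ⟨n, rfl⟩ : ∃ n, m = n + 2 := ⟨m - 2, by omega⟩
  set d := modeData n hθ hpos hle with hd
  have hH : d.H = n * (n + 1) / 2 := by
    change gainH (n + 2) = _
    unfold gainH
    push_cast
    ring
  obtain ⟨W, C, hC, hev⟩ := d.exists_modeVec n hH
  set κ := (2 * gainH (n + 2) + 4) / h + 1 with hκ
  set C' := 2 * C + C * (1 + |κ|) with hC'
  have hC'0 : 0 < C' := by positivity
  refine ⟨C', hC'0, ?_⟩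
  filter_upwards [hev, eventually_small 1 1 one_pos, self_mem_nhdsWithin] with η hev hη1 hη0
  obtain ⟨hstep, hlow, hup⟩ := hev
  rw [one_mul] at hη1
  replace hη0 : 0 < η := hη0
  have hnη : ‖(η : ℂ)‖ = η := by rw [Complex.norm_real, Real.norm_of_nonneg hη0.le]
  have hp : 0 < η ^ (2 * n + 1) := by positivity
  -- the factor `η ^ (2 n + 1)` undoes the scaling of the coordinates and makes the upper bound by the
  -- norm uniform in `η`
  refine ⟨C / η ^ (2 * n + 1), by positivity,
    fun x => η ^ (2 * n + 1) * ‖d.modeVec n W η (scaled θ η x)‖,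
    fun x y => ?_, fun x => ?_, fun x => ?_, fun x => ?_, fun x => ?_⟩
  · rw [scaled_add, d.modeVec_add, ← mul_add]
    exact mul_le_mul_of_nonneg_left (norm_add_le _ _) hp.le
  · have := hstep (rot θ) (rot_mul_conj θ) rfl _ _ (isStep_scaled hθ hpos hle hη0 x)
    calc _ ≤ η ^ (2 * n + 1) * ((1 - 3 * η ^ 2 / 4) * ‖d.modeVec n W η (scaled θ η x)‖) :=
          mul_le_mul_of_nonneg_left this hp.le
      _ = _ := by ring
  · obtain ⟨-, hP, hZ⟩ := hlow (scaled θ η x)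
    rw [dotProduct_eq_im, abs_neg]
    refine (Complex.abs_im_le_norm _).trans ?_
    rw [sum_cplxGain_gain θ h hη0, norm_mul, norm_mul, norm_pow, norm_pow, norm_pow, norm_rot, hnη,
      one_pow, one_mul]
    generalize ‖d.modeVec n W η (scaled θ η x)‖ = R at *
    have hR : 0 ≤ C * R := (norm_nonneg _).trans hP
    have hR' : 0 ≤ R := nonneg_of_mul_nonneg_right hR hC
    have h1 : ‖casc (scaled θ η x) n 0 + (κ : ℂ) * η ^ 2 * scaled θ η x (n + 1)‖ ≤
        C * (1 + |κ|) * R := by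
      refine (norm_add_le _ _).trans ?_
      rw [norm_mul, norm_mul, norm_pow, hnη, Complex.norm_real, Real.norm_eq_abs]
      have h2 : |κ| * η ^ 2 * ‖scaled θ η x (n + 1)‖ =
          |κ| * (η * (η * ‖scaled θ η x (n + 1)‖)) := by ring
      have h3 : η * (η * ‖scaled θ η x (n + 1)‖) ≤ 1 * (C * R) := by gcongr
      have h4 := mul_le_mul_of_nonneg_left h3 (abs_nonneg κ)
      rw [h2]
      linarith
    calc (η ^ 2) ^ (n + 1) * _ ≤ (η ^ 2) ^ (n + 1) * (C * (1 + |κ|) * R) := by gcongr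
      _ ≤ (η ^ 2) ^ (n + 1) * (C' * R) := by
        gcongr
        rw [hC']
        linarith
      _ = _ := by ring
  · have h1 : ∀ k, ‖scaled θ η x k‖ = ‖cplx x k‖ / η ^ (2 * k) := fun k => by
      rw [norm_scaled θ hη0 x k]; field_simp
    have h2 := hup (scaled θ η x) (2 * ‖x‖ / η ^ (2 * n + 1)) (fun k hk => ?_) ?_
    · calc _ ≤ η ^ (2 * n + 1) * (C * (2 * ‖x‖ / η ^ (2 * n + 1))) := by gcongr
        _ = 2 * C * ‖x‖ := by field_simp
        _ ≤ C' * ‖x‖ := by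
          gcongr
          rw [hC']
          have : 0 ≤ C * (1 + |κ|) := by positivity
          linarith
    · rw [h1]
      exact div_le_div₀ (by positivity) (norm_cplx_le x k) hp
        (pow_le_pow_of_le_one hη0.le hη1 (by omega))
    · rw [h1]
      calc _ ≤ η * (2 * ‖x‖ / η ^ (2 * (n + 1))) := by gcongr; exact norm_cplx_le x _
        _ = _ := by field_simp; ring
  · obtain ⟨hk, -, hZ⟩ := hlow (scaled θ η x)
    have h0 : C / η ^ (2 * n + 1) * (η ^ (2 * n + 1) * ‖d.modeVec n W η (scaled θ η x)‖) =
        C * ‖d.modeVec n W η (scaled θ η x)‖ := by field_simp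
    rw [h0]
    refine norm_le_of_cplx x (by positivity) fun k hkn => ?_
    rw [norm_scaled θ hη0 x k]
    rcases Nat.lt_or_ge k (n + 1) with h1 | h1
    · refine le_trans ?_ (hk k (by omega))
      exact mul_le_of_le_one_left (norm_nonneg _) (pow_le_one₀ hη0.le hη1)
    · obtain rfl : k = n + 1 := by omega
      refine le_trans ?_ hZ
      refine mul_le_mul_of_nonneg_right ?_ (norm_nonneg _)
      calc η ^ (2 * (n + 1)) ≤ η ^ 1 := pow_le_pow_of_le_one hη0.le hη1 (by omega)
        _ = η := pow_one η

/-- A function that contracts along a real matrix and is equivalent to the norm bounds the spectral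
radius. -/
theorem spectralRadius_le_of_contraction {ι : Type*} [Fintype ι] [DecidableEq ι]
    (M : Matrix ι ι ℝ) {ρ B : ℝ} (hρ : 0 < ρ) (hB : 0 ≤ B) (f : (ι → ℝ) → ℝ)
    (hf : ∀ x, f (M *ᵥ x) ≤ ρ * f x) (hfB : ∀ x, ‖x‖ ≤ B * f x) :
    spectralRadius ℂ (M.map (algebraMap ℝ ℂ)) ≤ ENNReal.ofReal ρ := by
  refine iSup₂_le fun z hz => ?_
  rw [← Matrix.spectrum_toLin', ← Module.End.hasEigenvalue_iff_mem_spectrum] at hz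
  obtain ⟨v, hv⟩ := hz.exists_hasEigenvector
  have hvz : M.map (algebraMap ℝ ℂ) *ᵥ v = z • v := by
    rw [← Matrix.toLin'_apply]; exact hv.apply_eq_smul
  -- the real trajectory through the real part of an eigenvector
  have hre : ∀ w : ι → ℂ, M.map (algebraMap ℝ ℂ) *ᵥ w = z • w → ∀ t : ℕ, ∀ i,
      |(z ^ t * w i).re| ≤ B * (ρ ^ t * f fun i => (w i).re) := by
    intro w hw t i
    have hstep : ∀ t : ℕ, (fun i => (z ^ (t + 1) * w i).re) =
        M *ᵥ (fun i => (z ^ t * w i).re) := by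
      intro t
      funext i
      have h1 : z ^ (t + 1) * w i = ∑ j, (M i j : ℂ) * (z ^ t * w j) := by
        have h2 := congrFun hw i
        simp only [Matrix.mulVec, dotProduct, Matrix.map_apply, Complex.coe_algebraMap,
          Pi.smul_apply, smul_eq_mul] at h2
        rw [pow_succ, mul_assoc, ← h2, Finset.mul_sum]
        exact Finset.sum_congr rfl fun j _ => by ring
      rw [h1, Complex.re_sum]
      exact Finset.sum_congr rfl fun j _ => Complex.re_ofReal_mul _ _
    have hind : ∀ t : ℕ, f (fun i => (z ^ t * w i).re) ≤ ρ ^ t * f fun i => (w i).re := by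
      intro t
      induction t with
      | zero => simp
      | succ t ih =>
        rw [hstep]
        calc _ ≤ ρ * f (fun i => (z ^ t * w i).re) := hf _
          _ ≤ ρ * (ρ ^ t * f fun i => (w i).re) := by gcongr
          _ = _ := by ring
    calc |(z ^ t * w i).re| ≤ ‖fun i => (z ^ t * w i).re‖ :=
          norm_le_pi_norm (fun i => (z ^ t * w i).re) i
      _ ≤ B * f (fun i => (z ^ t * w i).re) := hfB _
      _ ≤ _ := by gcongr; exact hind t
  obtain ⟨i, hi⟩ : ∃ i, v i ≠ 0 := by
    by_contra! h
    exact hv.2 (funext h)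
  have hiv : M.map (algebraMap ℝ ℂ) *ᵥ ((-Complex.I) • v) = z • ((-Complex.I) • v) := by
    rw [Matrix.mulVec_smul, hvz, smul_comm]
  set K := B * (f (fun i => (v i).re)) + B * (f fun i => (((-Complex.I) • v) i).re) with hK
  have hb : ∀ t : ℕ, ‖z‖ ^ t * ‖v i‖ ≤ ρ ^ t * K := by
    intro t
    have h1 := hre v hvz t i
    have h2 := hre _ hiv t i
    have h3 : (z ^ t * ((-Complex.I) • v) i).re = (z ^ t * v i).im := by
      simp [Complex.mul_re, Complex.mul_im]
      ring
    rw [h3] at h2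
    rw [← norm_pow, ← norm_mul]
    refine (Complex.norm_le_abs_re_add_abs_im _).trans ?_
    rw [hK]
    linarith
  have hzρ : ‖z‖ ≤ ρ := by
    by_contra! hlt
    have h1 : 1 < ‖z‖ / ρ := (one_lt_div hρ).2 hlt
    obtain ⟨t, ht⟩ := pow_unbounded_of_one_lt (K / ‖v i‖) h1
    have h2 := hb t
    have h3 : 0 < ‖v i‖ := norm_pos_iff.2 hi
    rw [div_pow, div_lt_div_iff₀ h3 (by positivity)] at ht
    linarith
  rw [← enorm_eq_nnnorm, ← ofReal_norm]
  exact ENNReal.ofReal_le_ofReal hzρ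

/-! ### The eigenbasis of the Laplacian -/

/-- The columns of `V` are an orthonormal basis of eigenvectors of the Laplacian, with the
eigenvalues `μ`. -/
structure IsEigenbasis {N : ℕ} (g V : Matrix (Fin N) (Fin N) ℝ) (μ : Fin N → ℝ) : Prop where
  expand : ∀ (y : Fin N → ℝ) i, y i = ∑ l, V i l * ∑ v, V v l * y v
  abs_le : ∀ i l, |V i l| ≤ 1
  eigen : ∀ (y : Fin N → ℝ) l, ∑ v, V v l * (laplacian g *ᵥ y) v = μ l * ∑ v, V v l * y v
  hasEigenvalue : ∀ l, Module.End.HasEigenvalue (Matrix.toLin' (laplacian g)) (μ l)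
  kernel : ∀ l, μ l = 0 → ∀ i j, V i l = V j l

theorem laplacian_mulVec {N : ℕ} (g : Matrix (Fin N) (Fin N) ℝ) (y : Fin N → ℝ) (i : Fin N) :
    (laplacian g *ᵥ y) i = ∑ v, g i v * (y i - y v) := by
  rw [laplacian, Matrix.sub_mulVec, Pi.sub_apply, Matrix.mulVec_diagonal]
  simp only [Matrix.mulVec, dotProduct, mul_sub, Finset.sum_sub_distrib, Finset.sum_mul]

/-- The kernel of the Laplacian of a connected graph consists of the constant vectors. -/
theorem eq_of_laplacian_mulVec_eq_zero {N : ℕ} {𝒢 : SimpleGraph (Fin N)} (h𝒢 : 𝒢.Connected)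
    {g : Matrix (Fin N) (Fin N) ℝ} (hg : IsWeight 𝒢 g) {y : Fin N → ℝ}
    (hy : laplacian g *ᵥ y = 0) (i j : Fin N) : y i = y j := by
  have h1 : ∑ i, ∑ v, g i v * (y i - y v) ^ 2 = 0 := by
    have h2 : ∑ i, y i * (laplacian g *ᵥ y) i = 0 := by simp [hy]
    simp only [laplacian_mulVec, Finset.mul_sum] at h2
    have h3 : ∑ i, ∑ v, y v * (g i v * (y i - y v)) = -∑ i, ∑ v, y i * (g i v * (y i - y v)) := by
      rw [Finset.sum_comm, ← Finset.sum_neg_distrib]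
      refine Finset.sum_congr rfl fun i _ => ?_
      rw [← Finset.sum_neg_distrib]
      refine Finset.sum_congr rfl fun v _ => ?_
      rw [hg.symm v i]
      ring
    calc _ = ∑ i, ∑ v, y i * (g i v * (y i - y v)) - ∑ i, ∑ v, y v * (g i v * (y i - y v)) := by
          rw [← Finset.sum_sub_distrib]
          refine Finset.sum_congr rfl fun i _ => ?_
          rw [← Finset.sum_sub_distrib]
          exact Finset.sum_congr rfl fun v _ => by ring
      _ = 0 := by rw [h3, h2]; ring
  have hadj : ∀ a b, 𝒢.Adj a b → y a = y b := by
    intro a b hab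
    have hnn : ∀ i v, 0 ≤ g i v * (y i - y v) ^ 2 := fun i v =>
      mul_nonneg (hg.nonneg i v) (sq_nonneg _)
    have h2 := (Finset.sum_eq_zero_iff_of_nonneg fun i _ =>
      Finset.sum_nonneg fun v _ => hnn i v).1 h1 b (Finset.mem_univ b)
    have h3 := (Finset.sum_eq_zero_iff_of_nonneg fun v _ => hnn b v).1 h2 a (Finset.mem_univ a)
    have h4 : 0 < g b a := (hg.pos_iff b a).2 hab
    have h5 := pow_eq_zero_iff (two_ne_zero) |>.1 ((mul_eq_zero.1 h3).resolve_left h4.ne')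
    linarith
  obtain ⟨w⟩ := h𝒢.preconnected i j
  induction w with
  | nil => rfl
  | cons h _ ih => rw [hadj _ _ h, ih]

theorem exists_isEigenbasis {N : ℕ} {𝒢 : SimpleGraph (Fin N)} (h𝒢 : 𝒢.Connected)
    {g : Matrix (Fin N) (Fin N) ℝ} (hg : IsWeight 𝒢 g) :
    ∃ (V : Matrix (Fin N) (Fin N) ℝ) (μ : Fin N → ℝ), IsEigenbasis g V μ := by
  have hT : (laplacian g)ᵀ = laplacian g := by
    rw [laplacian, Matrix.transpose_sub, Matrix.diagonal_transpose]
    congr 1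
    ext i j
    exact hg.symm j i
  have hH : (laplacian g).IsHermitian := by
    rw [Matrix.IsHermitian, Matrix.conjTranspose_eq_transpose_of_trivial, hT]
  set V : Matrix (Fin N) (Fin N) ℝ := Matrix.of fun i l => hH.eigenvectorBasis l i with hV
  have hcol : ∀ l, laplacian g *ᵥ (fun i => V i l) = hH.eigenvalues l • fun i => V i l :=
    fun l => hH.mulVec_eigenvectorBasis l
  have horth : Vᵀ * V = 1 := by
    ext k l
    have h := orthonormal_iff_ite.1 hH.eigenvectorBasis.orthonormal l k
    rw [EuclideanSpace.inner_eq_star_dotProduct] at h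
    simp only [star_trivial, dotProduct] at h
    rw [Matrix.mul_apply, Matrix.one_apply]
    simp only [Matrix.transpose_apply, hV, Matrix.of_apply]
    rw [h]
    simp only [eq_comm]
  have horth' : V * Vᵀ = 1 := mul_eq_one_comm.1 horth
  refine ⟨V, hH.eigenvalues, ?_, ?_, ?_, ?_, ?_⟩
  · intro y i
    have h : (V * Vᵀ) *ᵥ y = y := by rw [horth', Matrix.one_mulVec]
    rw [← Matrix.mulVec_mulVec] at h
    exact (congrFun h i).symm
  · intro i l
    have h := congrFun (congrFun horth l) l
    rw [Matrix.mul_apply, Matrix.one_apply_eq] at h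
    have h2 : V i l * V i l ≤ 1 := by
      rw [← h]
      exact Finset.single_le_sum (f := fun j => V j l * V j l)
        (fun j _ => mul_self_nonneg _) (Finset.mem_univ i)
    exact abs_le_one_iff_mul_self_le_one.2 h2
  · intro y l
    have h : (fun i => V i l) ⬝ᵥ (laplacian g *ᵥ y) = (laplacian g *ᵥ fun i => V i l) ⬝ᵥ y := by
      rw [Matrix.dotProduct_mulVec, ← Matrix.mulVec_transpose, hT]
    rw [hcol, smul_dotProduct] at h
    exact h
  · intro l
    refine Module.End.hasEigenvalue_of_hasEigenvector (x := fun i => V i l) ⟨?_, ?_⟩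
    · rw [Module.End.mem_eigenspace_iff, Matrix.toLin'_apply, hcol]
    · intro h0
      have h := congrFun (congrFun horth l) l
      rw [Matrix.mul_apply, Matrix.one_apply_eq] at h
      refine zero_ne_one (α := ℝ) (h ▸ (Finset.sum_eq_zero fun i _ => ?_).symm)
      rw [show V i l = 0 from congrFun h0 i, mul_zero]
  · intro l hl i j
    refine eq_of_laplacian_mulVec_eq_zero h𝒢 hg (y := fun i => V i l) ?_ i j
    rw [hcol, hl, zero_smul]

theorem IsEigenbasis.exists_eq {N : ℕ} {g V : Matrix (Fin N) (Fin N) ℝ} {μ : Fin N → ℝ}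
    (hV : IsEigenbasis g V μ) {lam : ℝ}
    (hlam : Module.End.HasEigenvalue (Matrix.toLin' (laplacian g)) lam) : ∃ l, μ l = lam := by
  obtain ⟨y, hy⟩ := hlam.exists_hasEigenvector
  have hLy : laplacian g *ᵥ y = lam • y := by
    rw [← Matrix.toLin'_apply]; exact hy.apply_eq_smul
  by_contra! hne
  apply hy.2
  funext i
  rw [hV.expand y i]
  refine Finset.sum_eq_zero fun l _ => ?_
  have h := hV.eigen y l
  rw [hLy] at h
  have h2 : ∑ v, V v l * (lam • y) v = lam * ∑ v, V v l * y v := by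
    rw [Finset.mul_sum]
    exact Finset.sum_congr rfl fun v _ => by simp; ring
  rw [h2] at h
  have h3 : (μ l - lam) * ∑ v, V v l * y v = 0 := by linarith
  rw [(mul_eq_zero.1 h3).resolve_left (sub_ne_zero.2 (hne l)), mul_zero]

/-! ### Estimation errors of one agent -/

theorem IsEstimate.eq {m : ℕ} {hm : 2 ≤ m} {θ : ℝ} {p : ℕ → ℝ} {s : ℕ → ℤ}
    {z z' : ℕ → Fin (2 * m) → ℝ} (hz : IsEstimate hm θ p s z) (hz' : IsEstimate hm θ p s z')
    {t : ℕ} (ht : 2 * m ≤ t) : z t = z' t := by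
  have hfull : ∀ t, 2 * m ≤ t → (∀ τ, 1 ≤ τ → τ ≤ t → z τ (crd1 hm) = z' τ (crd1 hm)) →
      z t = z' t := by
    intro t ht h
    funext j
    by_cases hj : j = crd1 hm
    · rw [hj]; exact h t (by omega) le_rfl
    · rw [hz.others t ht j hj, hz'.others t ht j hj]
      refine Finset.sum_congr rfl fun n _ => ?_
      rw [h _ (by omega) (by have := n.2; omega)]
  have hfirst : ∀ t, ∀ τ, 1 ≤ τ → τ ≤ t → z τ (crd1 hm) = z' τ (crd1 hm) := by
    intro t
    induction t with
    | zero => intro τ h1 h2; omega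
    | succ t ih =>
      intro τ h1 h2
      rcases Nat.eq_or_lt_of_le h2 with rfl | h2
      · rcases lt_or_ge t (2 * m) with h3 | h3
        · rw [hz.first_init t h3, hz'.first_init t h3]
        · rw [hz.first_step t h3, hz'.first_step t h3, hfull t h3 ih]
      · exact ih τ h1 (by omega)
  exact hfull t ht (hfirst t)

theorem reconMatrix_crd1 {m : ℕ} (hm : 2 ≤ m) {θ : ℝ} (hθ : sin θ ≠ 0) (n : Fin (2 * m)) :
    reconMatrix hm θ (crd1 hm) n = if (n : ℕ) = 2 * m - 1 then 1 else 0 := by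
  have h1 : reconMatrix hm θ (crd1 hm) n =
      (obsMatrix hm θ * (obsMatrix hm θ)⁻¹) ⟨2 * m - 1, by omega⟩ n := rfl
  rw [h1, Matrix.mul_nonsing_inv _ (isUnit_obsMatrix hm hθ), Matrix.one_apply]
  simp only [Fin.ext_iff, eq_comm]

theorem IsEstimate.eq_reconMatrix_mulVec {m : ℕ} {hm : 2 ≤ m} {θ : ℝ} (hθ : sin θ ≠ 0)
    {p : ℕ → ℝ} {s : ℕ → ℤ} {z : ℕ → Fin (2 * m) → ℝ} (hz : IsEstimate hm θ p s z)
    {t : ℕ} (ht : 2 * m ≤ t) :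
    z t = reconMatrix hm θ *ᵥ fun n => z (t - (2 * m - 1) + n) (crd1 hm) := by
  funext j
  by_cases hj : j = crd1 hm
  · rw [hj, Matrix.mulVec, dotProduct, Finset.sum_eq_single (⟨2 * m - 1, by omega⟩ : Fin (2 * m))]
    · rw [reconMatrix_crd1 hm hθ, if_pos rfl, one_mul]
      simp only
      rw [show t - (2 * m - 1) + (2 * m - 1) = t by omega]
    · intro b _ hb
      rw [reconMatrix_crd1 hm hθ, if_neg, zero_mul]
      intro h
      exact hb (Fin.ext h)
    · simp
  · exact hz.others t ht j hj

theorem predict_eq {m : ℕ} (hm : 2 ≤ m) (θ : ℝ) (z : Fin (2 * m) → ℝ) :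
    predict hm θ z = (jordanBlock m θ *ᵥ z) (crd1 hm) := by
  have h := pad_jordanBlock_even θ z 0
  have h1 : pad z (2 * 0) = z (crd1 hm) := pad_val z (crd1 hm)
  have h2 : pad z (2 * 0 + 1) = z (crd2 hm) := pad_val z (crd2 hm)
  have h3 : pad z (2 * 0 + 2) = z (crd3 hm) := pad_val z (crd3 hm)
  have h4 : pad (jordanBlock m θ *ᵥ z) (2 * 0) = (jordanBlock m θ *ᵥ z) (crd1 hm) :=
    pad_val _ (crd1 hm)
  rw [h1, h2, h3, h4] at h
  exact h.symm

/-- The prediction is the linear recursion of order `2m` applied to the reconstructed outputs. -/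
theorem predict_reconMatrix_mulVec {m : ℕ} (hm : 2 ≤ m) {θ : ℝ} (hθ : sin θ ≠ 0)
    (y : Fin (2 * m) → ℝ) :
    predict hm θ (reconMatrix hm θ *ᵥ y) = ∑ n : Fin (2 * m), recCoeff m θ n * y n := by
  obtain ⟨w, rfl⟩ : ∃ w, obsMatrix hm θ *ᵥ w = y :=
    ⟨(obsMatrix hm θ)⁻¹ *ᵥ y, by
      rw [Matrix.mulVec_mulVec, Matrix.mul_nonsing_inv _ (isUnit_obsMatrix hm hθ),
        Matrix.one_mulVec]⟩
  rw [predict_eq, Matrix.mulVec_mulVec, Matrix.mulVec_mulVec, Matrix.mul_assoc,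
    reconMatrix_mul_obsMatrix hm hθ, ← pow_succ', show 2 * m - 1 + 1 = 2 * m by omega,
    jordanBlock_pow_two_mul, Matrix.sum_mulVec, Finset.sum_apply]
  refine Finset.sum_congr rfl fun n _ => ?_
  rw [Matrix.smul_mulVec, Pi.smul_apply, smul_eq_mul, obsMatrix_mulVec]

theorem inputVec_crd1 {m : ℕ} (hm : 2 ≤ m) : inputVec m (crd1 hm) = 0 := by
  refine if_neg ?_
  change ¬ (0 + 1 = 2 * m)
  omega

theorem norm_inputVec_le (m : ℕ) : ‖inputVec m‖ ≤ 1 := by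
  refine (pi_norm_le_iff_of_nonneg zero_le_one).2 fun i => ?_
  unfold inputVec
  split_ifs <;> simp

/-- The effect of the control on the state within a window. -/
theorem norm_sub_jordanBlock_pow_mulVec_le {m : ℕ} {θ : ℝ} {x : ℕ → Fin (2 * m) → ℝ}
    {u : ℕ → ℝ} (hx : ∀ t, x (t + 1) = jordanBlock m θ *ᵥ x t + u t • inputVec m)
    {U : ℝ} (hU : 0 ≤ U) (t : ℕ) (n : ℕ) :
    (∀ τ, t ≤ τ → τ < t + n → |u τ| ≤ U) →
      ‖x (t + n) - jordanBlock m θ ^ n *ᵥ x t‖ ≤ 4 ^ n * U := by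
  induction n with
  | zero => intro _; simpa using hU
  | succ n ih =>
    intro hu
    have h1 := ih fun τ h1 h2 => hu τ h1 (by omega)
    have h2 : x (t + (n + 1)) - jordanBlock m θ ^ (n + 1) *ᵥ x t =
        jordanBlock m θ *ᵥ (x (t + n) - jordanBlock m θ ^ n *ᵥ x t) + u (t + n) • inputVec m := by
      rw [← add_assoc, hx, pow_succ', ← Matrix.mulVec_mulVec, Matrix.mulVec_sub]
      abel
    have hsq : √2 ≤ 2 := by
      rw [Real.sqrt_le_left (by norm_num)]; norm_num
    have h3 : (1 : ℝ) ≤ 4 ^ n := one_le_pow₀ (by norm_num)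
    rw [h2]
    refine (norm_add_le _ _).trans ?_
    rw [norm_smul, Real.norm_eq_abs]
    calc _ ≤ (√2 + 1) * ‖x (t + n) - jordanBlock m θ ^ n *ᵥ x t‖ + U * 1 :=
          add_le_add (norm_jordanBlock_mulVec_le θ _)
            (mul_le_mul (hu _ (by omega) (by omega)) (norm_inputVec_le m) (norm_nonneg _) hU)
      _ ≤ 3 * (4 ^ n * U) + 4 ^ n * U := by
        have h4 : U ≤ 4 ^ n * U := le_mul_of_one_le_left hU h3
        have h5 : (√2 + 1) * ‖x (t + n) - jordanBlock m θ ^ n *ᵥ x t‖ ≤ 3 * (4 ^ n * U) :=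
          mul_le_mul (by linarith) h1 (norm_nonneg _) (by norm_num)
        linarith
      _ = _ := by ring

theorem norm_mulVec_le_sum {ι κ : Type*} [Fintype ι] [Fintype κ] (S : Matrix ι κ ℝ) (y : κ → ℝ) :
    ‖S *ᵥ y‖ ≤ (∑ i, ∑ j, |S i j|) * ‖y‖ := by
  refine (pi_norm_le_iff_of_nonneg (by positivity)).2 fun i => ?_
  rw [Real.norm_eq_abs, Matrix.mulVec, dotProduct]
  calc _ ≤ ∑ j, |S i j * y j| := Finset.abs_sum_le_sum_abs _ _
    _ ≤ ∑ j, |S i j| * ‖y‖ := Finset.sum_le_sum fun j _ => by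
        rw [abs_mul]; exact mul_le_mul_of_nonneg_left (norm_le_pi_norm y j) (abs_nonneg _)
    _ = (∑ j, |S i j|) * ‖y‖ := by rw [Finset.sum_mul]
    _ ≤ _ := by
      gcongr
      exact Finset.single_le_sum (f := fun i => ∑ j, |S i j|)
        (fun i _ => Finset.sum_nonneg fun j _ => abs_nonneg _) (Finset.mem_univ i)

/-- The estimation error is bounded by the output errors and the controls in the last `2m` steps.
The factor of the output errors in the prediction error is sharp. -/
theorem exists_estimate_bound {m : ℕ} (hm : 2 ≤ m) {θ : ℝ} (hθ : sin θ ≠ 0) : ∃ C₀, 0 < C₀ ∧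
    ∀ (x : ℕ → Fin (2 * m) → ℝ) (u : ℕ → ℝ) (p : ℕ → ℝ) (s : ℕ → ℤ) (z : ℕ → Fin (2 * m) → ℝ),
      (∀ t, x (t + 1) = jordanBlock m θ *ᵥ x t + u t • inputVec m) → IsEstimate hm θ p s z →
      ∀ t, 2 * m ≤ t → ∀ U E : ℝ, 0 ≤ U → 0 ≤ E →
        (∀ τ, t - (2 * m - 1) ≤ τ → τ < t → |u τ| ≤ U) →
        (∀ τ, t - (2 * m - 1) ≤ τ → τ ≤ t → |x τ (crd1 hm) - z τ (crd1 hm)| ≤ E) →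
        ‖x t - z t‖ ≤ C₀ * (U + E) ∧
        |x (t + 1) (crd1 hm) - predict hm θ (z t)| ≤
          ((2 + 2 * |cos θ|) ^ m - 1) * E + C₀ * U := by
  set cS := ∑ i, ∑ j, |reconMatrix hm θ i j| with hcS
  set a₀ := (2 + 2 * |cos θ|) ^ m - 1 with ha₀
  have hcS0 : 0 ≤ cS := by positivity
  have hrec := sum_abs_recCoeff_le m θ
  rw [← ha₀] at hrec
  have ha₀0 : 0 ≤ a₀ := le_trans (by positivity) hrec
  set P : ℝ := 4 ^ (2 * m) with hP
  have hP0 : 1 ≤ P := one_le_pow₀ (by norm_num)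
  refine ⟨3 * P + cS * (P + 1) + a₀ * P, by positivity,
    fun x u p s z hx hz t ht U E hU hE hu he => ?_⟩
  set t' := t - (2 * m - 1) with ht'
  have hwin : ∀ n, n ≤ 2 * m - 1 → ‖x (t' + n) - jordanBlock m θ ^ n *ᵥ x t'‖ ≤ P * U := by
    intro n hn
    refine (norm_sub_jordanBlock_pow_mulVec_le hx hU t' n fun τ h1 h2 =>
      hu τ h1 (by omega)).trans (mul_le_mul_of_nonneg_right ?_ hU)
    exact pow_le_pow_right₀ (by norm_num) (by omega)
  have htop := hwin (2 * m - 1) le_rfl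
  rw [show t' + (2 * m - 1) = t by omega] at htop
  set err : Fin (2 * m) → ℝ :=
    fun n => (obsMatrix hm θ *ᵥ x t') n - z (t' + n) (crd1 hm) with herr
  have herrb : ∀ n, |err n| ≤ P * U + E := by
    intro n
    have hn := n.2
    have h1 : err n = -((x (t' + n) - jordanBlock m θ ^ (n : ℕ) *ᵥ x t') (crd1 hm)) +
        (x (t' + n) (crd1 hm) - z (t' + n) (crd1 hm)) := by
      simp only [herr, obsMatrix_mulVec, Pi.sub_apply]
      ring
    rw [h1]
    refine (abs_add_le _ _).trans (add_le_add ?_ (he _ (by omega) (by omega)))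
    rw [abs_neg]
    exact (norm_le_pi_norm (x (t' + n) - jordanBlock m θ ^ (n : ℕ) *ᵥ x t') (crd1 hm)).trans
      (hwin n (by omega))
  have hPU : 0 ≤ P * U := by positivity
  have hz' := hz.eq_reconMatrix_mulVec hθ ht
  have hzdiff : jordanBlock m θ ^ (2 * m - 1) *ᵥ x t' - z t = reconMatrix hm θ *ᵥ err := by
    rw [hz', ← reconMatrix_mul_obsMatrix hm hθ, ← Matrix.mulVec_mulVec, ← Matrix.mulVec_sub]
    rfl
  constructor
  · have h1 : x t - z t = (x t - jordanBlock m θ ^ (2 * m - 1) *ᵥ x t') +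
        reconMatrix hm θ *ᵥ err := by rw [← hzdiff]; abel
    rw [h1]
    have h2 : ‖err‖ ≤ P * U + E := (pi_norm_le_iff_of_nonneg (by positivity)).2 herrb
    have h3 := (norm_mulVec_le_sum (reconMatrix hm θ) err).trans
      (mul_le_mul_of_nonneg_left h2 hcS0)
    refine (norm_add_le _ _).trans ((add_le_add htop h3).trans ?_)
    have e1 : 0 ≤ cS * (P * E) := by positivity
    have e2 : 0 ≤ cS * U := by positivity
    have e3 : 0 ≤ P * E := by positivity
    have e4 : 0 ≤ a₀ * (P * U) := by positivity
    have e5 : 0 ≤ a₀ * (P * E) := by positivity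
    nlinarith
  · have h1 : x (t + 1) (crd1 hm) = (jordanBlock m θ *ᵥ x t) (crd1 hm) := by
      rw [hx, Pi.add_apply, Pi.smul_apply, inputVec_crd1, smul_zero, add_zero]
    have h2 : x (t + 1) (crd1 hm) - predict hm θ (z t) =
        (jordanBlock m θ *ᵥ (x t - jordanBlock m θ ^ (2 * m - 1) *ᵥ x t')) (crd1 hm) +
          predict hm θ (reconMatrix hm θ *ᵥ err) := by
      rw [← hzdiff, h1, predict_eq, predict_eq, Matrix.mulVec_sub, Matrix.mulVec_sub,
        Pi.sub_apply, Pi.sub_apply]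
      ring
    have hsq : √2 ≤ 2 := by
      rw [Real.sqrt_le_left (by norm_num)]; norm_num
    have h3 : |(jordanBlock m θ *ᵥ (x t - jordanBlock m θ ^ (2 * m - 1) *ᵥ x t')) (crd1 hm)| ≤
        3 * (P * U) := by
      refine (norm_le_pi_norm (jordanBlock m θ *ᵥ _) (crd1 hm)).trans ?_
      refine (norm_jordanBlock_mulVec_le θ _).trans ?_
      exact mul_le_mul (by linarith) htop (norm_nonneg _) (by norm_num)
    have h4 : |predict hm θ (reconMatrix hm θ *ᵥ err)| ≤ a₀ * (P * U + E) := by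
      rw [predict_reconMatrix_mulVec hm hθ]
      calc _ ≤ ∑ n : Fin (2 * m), |recCoeff m θ n * err n| := Finset.abs_sum_le_sum_abs _ _
        _ ≤ ∑ n : Fin (2 * m), |recCoeff m θ n| * (P * U + E) := Finset.sum_le_sum fun n _ => by
            rw [abs_mul]; exact mul_le_mul_of_nonneg_left (herrb n) (abs_nonneg _)
        _ = (∑ n : Fin (2 * m), |recCoeff m θ n|) * (P * U + E) := by rw [Finset.sum_mul]
        _ ≤ _ := by gcongr
    rw [h2]
    refine (abs_add_le _ _).trans ((add_le_add h3 h4).trans ?_)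
    have e1 : 0 ≤ cS * (P + 1) * U := by positivity
    linarith

/-! ### The closed loop -/

/-- The component of the states of all agents along an eigenvector of the Laplacian. -/
def modal {N m : ℕ} (V : Matrix (Fin N) (Fin N) ℝ) (l : Fin N)
    (x : Fin N → Fin (2 * m) → ℝ) : Fin (2 * m) → ℝ := ∑ v, V v l • x v

theorem dotProduct_modal {N m : ℕ} (V : Matrix (Fin N) (Fin N) ℝ) (l : Fin N)
    (k : Fin (2 * m) → ℝ) (x : Fin N → Fin (2 * m) → ℝ) :
    k ⬝ᵥ modal V l x = ∑ v, V v l * (k ⬝ᵥ x v) := by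
  rw [modal, dotProduct_sum]
  exact Finset.sum_congr rfl fun v _ => by rw [dotProduct_smul, smul_eq_mul]

theorem norm_modal_le {N m : ℕ} {g V : Matrix (Fin N) (Fin N) ℝ} {μ : Fin N → ℝ}
    (hV : IsEigenbasis g V μ) (l : Fin N) (x : Fin N → Fin (2 * m) → ℝ) {r : ℝ}
    (hx : ∀ v, ‖x v‖ ≤ r) : ‖modal V l x‖ ≤ N * r := by
  refine (norm_sum_le _ _).trans ?_
  calc _ ≤ ∑ _v : Fin N, r := Finset.sum_le_sum fun v _ => by
        rw [norm_smul, Real.norm_eq_abs]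
        exact (mul_le_of_le_one_left (norm_nonneg _) (hV.abs_le v l)).trans (hx v)
    _ = N * r := by simp

/-- The differences of states are determined by the modes with nonzero eigenvalues. -/
theorem norm_sub_le_of_modal {N m : ℕ} {g V : Matrix (Fin N) (Fin N) ℝ} {μ : Fin N → ℝ}
    (hV : IsEigenbasis g V μ) (x : Fin N → Fin (2 * m) → ℝ) (c : Fin N → ℝ) (hc : ∀ l, 0 ≤ c l)
    (hx : ∀ l, μ l ≠ 0 → ‖modal V l x‖ ≤ c l) (i j : Fin N) : ‖x i - x j‖ ≤ ∑ l, 2 * c l := by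
  have h1 : ∀ i, x i = ∑ l, V i l • modal V l x := by
    intro i
    funext n
    rw [hV.expand (fun v => x v n) i]
    simp [modal, Finset.sum_apply]
  rw [h1 i, h1 j, ← Finset.sum_sub_distrib]
  refine (norm_sum_le _ _).trans (Finset.sum_le_sum fun l _ => ?_)
  rw [← sub_smul, norm_smul, Real.norm_eq_abs]
  by_cases hl : μ l = 0
  · rw [hV.kernel l hl i j, sub_self, abs_zero, zero_mul]
    linarith [hc l]
  · refine mul_le_mul ?_ (hx l hl) (norm_nonneg _) (by norm_num)
    exact (abs_sub _ _).trans (by linarith [hV.abs_le i l, hV.abs_le j l])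

theorem abs_gain_le (m : ℕ) (θ h : ℝ) {ε : ℝ} (hε : 0 ≤ ε) (hε1 : ε ≤ 1) (l : Fin (2 * m)) :
    |gain m θ h ε l| ≤ |gainConst m θ h l| * ε := by
  rw [gain, abs_mul]
  refine mul_le_mul_of_nonneg_left ?_ (abs_nonneg _)
  have hl := l.2
  split_ifs with h1
  · rw [abs_of_nonneg hε]
  · rw [abs_of_nonneg (by positivity)]
    calc ε ^ (m - 1 - (l : ℕ) / 2) ≤ ε ^ 1 := pow_le_pow_of_le_one hε hε1 (by omega)
      _ = ε := pow_one ε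

theorem abs_gain_dotProduct_le (m : ℕ) (θ h : ℝ) {ε : ℝ} (hε : 0 ≤ ε) (hε1 : ε ≤ 1)
    (x : Fin (2 * m) → ℝ) :
    |gain m θ h ε ⬝ᵥ x| ≤ (∑ l, |gainConst m θ h l|) * ε * ‖x‖ := by
  rw [dotProduct, Finset.sum_mul, Finset.sum_mul]
  refine (Finset.abs_sum_le_sum_abs _ _).trans (Finset.sum_le_sum fun l _ => ?_)
  rw [abs_mul]
  exact mul_le_mul (abs_gain_le m θ h hε hε1 l) (norm_le_pi_norm x l) (abs_nonneg _)
    (by positivity)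

section Loop

variable {N m : ℕ} {hm : 2 ≤ m} {θ : ℝ} {𝒢 : SimpleGraph (Fin N)}
  {g : Matrix (Fin N) (Fin N) ℝ} {k : Fin (2 * m) → ℝ} {p : ℕ → ℝ} {M : ℕ → ℕ}
  {R : Signals N m}

/-- The decoders reproduce the estimates of the encoders, so the control is the Laplacian applied to
the weighted estimates. -/
theorem IsClosedLoop.control_eq (hR : IsClosedLoop hm θ 𝒢 g k p M R) (hg : IsWeight 𝒢 g) {t : ℕ}
    (ht : 2 * m ≤ t) (i : Fin N) :
    R.u t i = -(laplacian g *ᵥ fun v => k ⬝ᵥ R.enc t v) i := by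
  rw [hR.control_step t ht, laplacian_mulVec]
  have h1 : ∀ v j, g i v * (R.dec t i v j - R.enc t i j) =
      g i v * (R.enc t v j - R.enc t i j) := by
    intro v j
    rcases (hg.nonneg i v).eq_or_lt with h0 | h0
    · rw [← h0, zero_mul, zero_mul]
    · have h2 := (hR.decoder v i ((hg.pos_iff i v).1 h0)).eq (hR.encoder v) ht
      rw [show R.dec t i v = R.enc t v from h2]
  simp only [h1, Finset.mul_sum, dotProduct]
  rw [Finset.sum_comm, ← Finset.sum_neg_distrib]
  refine Finset.sum_congr rfl fun v _ => ?_
  rw [← Finset.sum_sub_distrib, Finset.mul_sum, ← Finset.sum_neg_distrib]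
  exact Finset.sum_congr rfl fun j _ => by ring

/-- The modal component of the control. -/
theorem IsClosedLoop.modal_control_eq (hR : IsClosedLoop hm θ 𝒢 g k p M R) (hg : IsWeight 𝒢 g)
    {V : Matrix (Fin N) (Fin N) ℝ} {μ : Fin N → ℝ} (hV : IsEigenbasis g V μ) {t : ℕ}
    (ht : 2 * m ≤ t) (l : Fin N) :
    ∑ v, V v l * R.u t v = -(μ l * (k ⬝ᵥ modal V l (R.x t) -
      k ⬝ᵥ modal V l (fun v => R.x t v - R.enc t v))) := by
  have h1 : k ⬝ᵥ modal V l (R.x t) - k ⬝ᵥ modal V l (fun v => R.x t v - R.enc t v) =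
      ∑ v, V v l * (k ⬝ᵥ R.enc t v) := by
    rw [dotProduct_modal, dotProduct_modal, ← Finset.sum_sub_distrib]
    exact Finset.sum_congr rfl fun v _ => by rw [dotProduct_sub]; ring
  rw [h1, ← hV.eigen, ← Finset.sum_neg_distrib]
  exact Finset.sum_congr rfl fun v _ => by rw [hR.control_eq hg ht]; ring

theorem IsClosedLoop.modal_step (hR : IsClosedLoop hm θ 𝒢 g k p M R)
    (V : Matrix (Fin N) (Fin N) ℝ) (t : ℕ) (l : Fin N) :
    modal V l (R.x (t + 1)) = jordanBlock m θ *ᵥ modal V l (R.x t) +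
      (∑ v, V v l * R.u t v) • inputVec m := by
  rw [modal, modal, Matrix.mulVec_sum, Finset.sum_smul, ← Finset.sum_add_distrib]
  refine Finset.sum_congr rfl fun v _ => ?_
  rw [hR.dynamics, smul_add, Matrix.mulVec_smul, smul_smul]

/-- As long as no control acts, the states are bounded by the initial value of the scaling
function. -/
theorem IsClosedLoop.norm_x_le (hR : IsClosedLoop hm θ 𝒢 g k p M R) {C Cδ : ℝ}
    (hC : InitBound C Cδ (R.x 0)) {p₀ : ℝ} (hp : (√2 + 1) ^ (2 * m) * max C Cδ ≤ p₀)
    (hC0 : 0 < C) {t : ℕ} (ht : t ≤ 2 * m) (i : Fin N) : ‖R.x t i‖ ≤ p₀ := by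
  have h1 : ∀ t, t ≤ 2 * m → R.x t i = jordanBlock m θ ^ t *ᵥ R.x 0 i := by
    intro t
    induction t with
    | zero => simp
    | succ t ih =>
      intro ht
      rw [hR.dynamics, hR.control_init t (by omega), ih (by omega), zero_smul, add_zero,
        pow_succ', Matrix.mulVec_mulVec]
  have h2 : ‖R.x 0 i‖ ≤ C := by
    refine (pi_norm_le_iff_of_nonneg hC0.le).2 fun j => ?_
    exact (norm_le_pi_norm (fun i => R.x 0 i j) i).trans (hC j).1
  have h0 := Real.sqrt_nonneg 2
  rw [h1 t ht]
  calc _ ≤ (√2 + 1) ^ t * ‖R.x 0 i‖ := norm_jordanBlock_pow_mulVec_le θ _ t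
    _ ≤ (√2 + 1) ^ (2 * m) * max C Cδ := by
      refine mul_le_mul (pow_le_pow_right₀ (by linarith) ht) (h2.trans (le_max_left _ _))
        (norm_nonneg _) (by positivity)
    _ ≤ p₀ := hp

end Loop

/-- The conditions on `η = √ε` under which the closed loop is analysed: `f l` is adapted to the
mode `l`, `D l` is the bound of that mode relative to the scaling function, `C₀` is the constant of
the estimates, `c` bounds the control relative to the scaling function. The last condition says
that `η` is small. -/
structure IsSmall {N m : ℕ} (θ h : ℝ) (μ : Fin N → ℝ) (C₀ c η : ℝ) (C B D : Fin N → ℝ)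
    (f : Fin N → (Fin (2 * m) → ℝ) → ℝ) : Prop where
  pos : 0 < η
  le_one : η ≤ 1
  norms : ∀ l, μ l ≠ 0 → IsModeNorm θ h (μ l) (C l) (B l) η (f l)
  gap : 2 / 3 ≤ (1 - η ^ 2 / 4) ^ (2 * m)
  slack : ((2 + 2 * |cos θ|) ^ m - 1) * (1 / 2) + C₀ * c ≤
    (2 + 2 * |cos θ|) ^ m * (1 / 2) * (1 - η ^ 2 / 4) ^ (2 * m)
  D_init : ∀ l, 2 * C l * N ≤ D l
  D_step : ∀ l, 2 * (C l * (|μ l| * ((∑ l, |gainConst m θ h l|) *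
    (N * (2 * C₀ * (c + 1 / 2)))))) ≤ D l
  small : ∑ l, |μ l| * (C l * η * D l + (∑ l, |gainConst m θ h l|) * η ^ 2 *
    (N * (2 * C₀ * (c + 1 / 2)))) ≤ c

/-- The bounds at time `t ≥ 2m` that are propagated along the closed loop: no quantizer has
saturated, the controls are small, and the modes of the disagreement are of the order of the scaling
function. -/
structure Bounds {N m : ℕ} (hm : 2 ≤ m) (V : Matrix (Fin N) (Fin N) ℝ) (μ : Fin N → ℝ) (c : ℝ)
    (p : ℕ → ℝ) (D : Fin N → ℝ) (f : Fin N → (Fin (2 * m) → ℝ) → ℝ) (R : Signals N m)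
    (t : ℕ) : Prop where
  output : ∀ τ, τ < t → ∀ i,
    |R.x (τ + 1) i (crd1 hm) - R.enc (τ + 1) i (crd1 hm)| ≤ p τ * (1 / 2)
  control : ∀ τ, τ < t → ∀ i, |R.u τ i| ≤ c * p τ
  modes : ∀ l, μ l ≠ 0 → f l (modal V l (R.x t)) ≤ D l * p t

theorem two_thirds_mul_le {γ p₀ : ℝ} {m t : ℕ} (hγ0 : 0 ≤ γ) (hγ1 : γ ≤ 1) (hp : 0 ≤ p₀)
    (hgap : 2 / 3 ≤ γ ^ (2 * m)) (ht : t ≤ 2 * m) : 2 / 3 * p₀ ≤ p₀ * γ ^ t := by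
  have := pow_le_pow_of_le_one hγ0 hγ1 ht
  nlinarith

theorem abs_sub_mul_quantizer_le {M : ℕ} {y q : ℝ} (hq : 0 < q) (hy : |y| ≤ (M + 1 / 2) * q) :
    |y - q * quantizer M (y / q)| ≤ q * (1 / 2) := by
  have h1 : |y / q| ≤ M + 1 / 2 := by
    rw [abs_div, abs_of_pos hq, div_le_iff₀ hq]
    exact hy
  have h2 : y - q * quantizer M (y / q) = q * (y / q - quantizer M (y / q)) := by
    field_simp
  rw [h2, abs_mul, abs_of_pos hq]
  exact mul_le_mul_of_nonneg_left (abs_sub_quantizer_le h1) hq.le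

section Induction

variable {N m : ℕ} {hm : 2 ≤ m} {θ h : ℝ} {𝒢 : SimpleGraph (Fin N)}
  {g V : Matrix (Fin N) (Fin N) ℝ} {μ : Fin N → ℝ} {C₀ c η p₀ : ℝ} {C B D : Fin N → ℝ}
  {f : Fin N → (Fin (2 * m) → ℝ) → ℝ} {M : ℕ → ℕ} {R : Signals N m}

/-- The bounds hold at the end of the initial phase, where one level suffices. -/
theorem bounds_init (hS : IsSmall θ h μ C₀ c η C B D f) (hV : IsEigenbasis g V μ) (hc : 0 ≤ c)
    (hC : ∀ l, 0 < C l)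
    (hR : IsClosedLoop hm θ 𝒢 g (gain m θ h (η ^ 2)) (fun t => p₀ * (1 - η ^ 2 / 4) ^ t) M R)
    (hp₀ : 0 < p₀) (hx : ∀ t ≤ 2 * m, ∀ i, ‖R.x t i‖ ≤ p₀)
    (hM : ∀ t, 1 ≤ t → t ≤ 2 * m → 1 ≤ M t) :
    Bounds hm V μ c (fun t => p₀ * (1 - η ^ 2 / 4) ^ t) D f R (2 * m) := by
  have hη0 := hS.pos
  have hη1 := hS.le_one
  have hγ0 : 0 < 1 - η ^ 2 / 4 := by nlinarith
  have hγ1 : 1 - η ^ 2 / 4 ≤ 1 := by nlinarith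
  have hlow : ∀ t ≤ 2 * m, 2 / 3 * p₀ ≤ p₀ * (1 - η ^ 2 / 4) ^ t := fun t ht =>
    two_thirds_mul_le hγ0.le hγ1 hp₀.le hS.gap ht
  refine ⟨fun τ hτ i => ?_, fun τ hτ i => ?_, fun l hl => ?_⟩
  · have h1 : R.enc (τ + 1) i (crd1 hm) = p₀ * (1 - η ^ 2 / 4) ^ τ * R.s (τ + 1) i :=
      (hR.encoder i).first_init τ hτ
    rw [h1, hR.symbol_init τ hτ i]
    refine abs_sub_mul_quantizer_le (by positivity) ?_
    have h2 : (1 : ℝ) ≤ M (τ + 1) := by exact_mod_cast hM (τ + 1) (by omega) (by omega)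
    have h3 := hlow τ hτ.le
    have h4 : |R.x (τ + 1) i (crd1 hm)| ≤ p₀ :=
      (norm_le_pi_norm (R.x (τ + 1) i) (crd1 hm)).trans (hx (τ + 1) (by omega) i)
    nlinarith
  · rw [hR.control_init τ hτ i, abs_zero]
    positivity
  · have h1 := norm_modal_le hV l (R.x (2 * m)) (hx (2 * m) le_rfl)
    have h2 := (hS.norms l hl).le_norm (modal V l (R.x (2 * m)))
    have h3 := hlow (2 * m) le_rfl
    have h4 := hS.D_init l
    have hCl := hC l
    have h5 : 0 ≤ D l := le_trans (by positivity) h4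
    calc _ ≤ C l * (N * p₀) := h2.trans (mul_le_mul_of_nonneg_left h1 hCl.le)
      _ ≤ 3 / 2 * (C l * N) * (p₀ * (1 - η ^ 2 / 4) ^ (2 * m)) := by
        have : 0 ≤ C l * N := by positivity
        nlinarith
      _ ≤ D l * (p₀ * (1 - η ^ 2 / 4) ^ (2 * m)) := by
        have : 0 ≤ C l * N := by positivity
        gcongr
        linarith

/-- The bounds are propagated: the prediction error of each agent stays within the range of its
quantizer, since the coefficients of the recursion of the outputs have absolute sum at most
`(2 + 2 |cos θ|)^m - 1`. -/
theorem bounds_step (hS : IsSmall θ h μ C₀ c η C B D f) (hV : IsEigenbasis g V μ) (hc : 0 ≤ c)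
    (hC : ∀ l, 0 < C l) (hC₀ : 0 < C₀) (hg : IsWeight 𝒢 g)
    (hest : ∀ (x : ℕ → Fin (2 * m) → ℝ) (u : ℕ → ℝ) (p : ℕ → ℝ) (s : ℕ → ℤ)
      (z : ℕ → Fin (2 * m) → ℝ),
      (∀ t, x (t + 1) = jordanBlock m θ *ᵥ x t + u t • inputVec m) → IsEstimate hm θ p s z →
      ∀ t, 2 * m ≤ t → ∀ U E : ℝ, 0 ≤ U → 0 ≤ E →
        (∀ τ, t - (2 * m - 1) ≤ τ → τ < t → |u τ| ≤ U) →
        (∀ τ, t - (2 * m - 1) ≤ τ → τ ≤ t → |x τ (crd1 hm) - z τ (crd1 hm)| ≤ E) →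
        ‖x t - z t‖ ≤ C₀ * (U + E) ∧
        |x (t + 1) (crd1 hm) - predict hm θ (z t)| ≤
          ((2 + 2 * |cos θ|) ^ m - 1) * E + C₀ * U)
    (hR : IsClosedLoop hm θ 𝒢 g (gain m θ h (η ^ 2)) (fun t => p₀ * (1 - η ^ 2 / 4) ^ t) M R)
    (hp₀ : 0 < p₀) (hM : ∀ t, 2 * m < t → levelBound m θ ≤ (M t : ℝ)) {t : ℕ} (ht : 2 * m ≤ t)
    (hb : Bounds hm V μ c (fun t => p₀ * (1 - η ^ 2 / 4) ^ t) D f R t) :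
    Bounds hm V μ c (fun t => p₀ * (1 - η ^ 2 / 4) ^ t) D f R (t + 1) := by
  have hη0 := hS.pos
  have hη1 := hS.le_one
  have hη2 : η ^ 2 ≤ 1 := by nlinarith
  have hγ0 : 0 < 1 - η ^ 2 / 4 := by nlinarith
  have hγ1 : 1 - η ^ 2 / 4 ≤ 1 := by nlinarith
  have hgap := hS.gap
  have hslack := hS.slack
  have hsmall := hS.small
  have hDstep := hS.D_step
  set γ := 1 - η ^ 2 / 4 with hγ
  set K := ∑ l, |gainConst m θ h l| with hK
  have hK0 : 0 ≤ K := by positivity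
  set p : ℕ → ℝ := fun t => p₀ * γ ^ t with hp
  have hppos : ∀ t, 0 < p t := fun t => by positivity
  -- the value of the scaling function at the beginning of the window
  set q := p (t - 2 * m) with hq
  have hq0 : 0 < q := hppos _
  have hqt : q * γ ^ (2 * m) = p t := by
    simp only [hq, hp]
    rw [mul_assoc, ← pow_add, Nat.sub_add_cancel ht]
  have hmono : ∀ τ, t - 2 * m ≤ τ → p τ ≤ q := fun τ hτ =>
    mul_le_mul_of_nonneg_left (pow_le_pow_of_le_one hγ0.le hγ1 hτ) hp₀.le
  have hq2 : q ≤ 2 * p t := by nlinarith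
  have hwin : ∀ i, ‖R.x t i - R.enc t i‖ ≤ C₀ * (c * q + q * (1 / 2)) ∧
      |R.x (t + 1) i (crd1 hm) - predict hm θ (R.enc t i)| ≤
        ((2 + 2 * |cos θ|) ^ m - 1) * (q * (1 / 2)) + C₀ * (c * q) := by
    intro i
    refine hest (fun t => R.x t i) (fun t => R.u t i) p (fun t => R.s t i) (fun t => R.enc t i)
      (fun t => hR.dynamics t i) (hR.encoder i) t ht (c * q) (q * (1 / 2)) (by positivity)
      (by positivity) (fun τ h1 h2 => ?_) (fun τ h1 h2 => ?_)
    · exact (hb.control τ h2 i).trans (mul_le_mul_of_nonneg_left (hmono τ (by omega)) hc)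
    · obtain ⟨σ, rfl⟩ : ∃ σ, τ = σ + 1 := ⟨τ - 1, by omega⟩
      exact (hb.output σ (by omega) i).trans
        (mul_le_mul_of_nonneg_right (hmono σ (by omega)) (by norm_num))
  have herr : ∀ i, ‖R.x t i - R.enc t i‖ ≤ 2 * C₀ * (c + 1 / 2) * p t := by
    intro i
    refine (hwin i).1.trans ?_
    have : 0 ≤ C₀ * (c + 1 / 2) := by positivity
    nlinarith
  set Q := N * (2 * C₀ * (c + 1 / 2)) with hQ
  have hQ0 : 0 ≤ Q := by positivity
  have hkd : ∀ l, |gain m θ h (η ^ 2) ⬝ᵥ modal V l (fun v => R.x t v - R.enc t v)| ≤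
      K * η ^ 2 * Q * p t := by
    intro l
    refine (abs_gain_dotProduct_le m θ h (sq_nonneg η) hη2 _).trans ?_
    have h1 := norm_modal_le hV l (fun v => R.x t v - R.enc t v) herr
    calc _ ≤ K * η ^ 2 * (N * (2 * C₀ * (c + 1 / 2) * p t)) := by gcongr
      _ = _ := by rw [hQ]; ring
  have hu : ∀ i, |R.u t i| ≤ c * p t := by
    intro i
    rw [hV.expand (R.u t) i]
    have h1 : ∀ l, |V i l * ∑ v, V v l * R.u t v| ≤
        |μ l| * (C l * η * D l + K * η ^ 2 * Q) * p t := by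
      intro l
      rw [abs_mul]
      refine (mul_le_of_le_one_left (abs_nonneg _) (hV.abs_le i l)).trans ?_
      rw [hR.modal_control_eq hg hV ht, abs_neg, abs_mul, mul_assoc]
      by_cases hl : μ l = 0
      · simp [hl]
      · refine mul_le_mul_of_nonneg_left ?_ (abs_nonneg _)
        refine (abs_sub _ _).trans ?_
        have h2 := (hS.norms l hl).control (modal V l (R.x t))
        have h3 := mul_le_mul_of_nonneg_left (hb.modes l hl) (by have := hC l; positivity :
          0 ≤ C l * η)
        have h4 := hkd l
        linarith
    calc _ ≤ ∑ l, |V i l * ∑ v, V v l * R.u t v| := Finset.abs_sum_le_sum_abs _ _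
      _ ≤ ∑ l, |μ l| * (C l * η * D l + K * η ^ 2 * Q) * p t :=
        Finset.sum_le_sum fun l _ => h1 l
      _ = (∑ l, |μ l| * (C l * η * D l + K * η ^ 2 * Q)) * p t :=
        (Finset.sum_mul Finset.univ _ _).symm
      _ ≤ c * p t := mul_le_mul_of_nonneg_right hsmall (hppos t).le
  refine ⟨fun τ hτ i => ?_, fun τ hτ i => ?_, fun l hl => ?_⟩
  · rcases Nat.eq_or_lt_of_le (Nat.lt_succ_iff.1 hτ) with rfl | hτ
    · have h1 : R.enc (τ + 1) i (crd1 hm) = predict hm θ (R.enc τ i) + p τ * R.s (τ + 1) i :=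
        (hR.encoder i).first_step τ ht
      rw [h1, hR.symbol_step τ ht i, ← sub_sub]
      refine abs_sub_mul_quantizer_le (hppos τ) ((hwin i).2.trans ?_)
      have h2 := hM (τ + 1) (by omega)
      have h3 : (2 + 2 * |cos θ|) ^ m * (1 / 2) ≤ (M (τ + 1) : ℝ) + 1 / 2 := by
        have h4 : (2 + 2 * |cos θ|) ^ m * (1 / 2) = 2 ^ (m - 1) * (1 + |cos θ|) ^ m := by
          rw [show 2 + 2 * |cos θ| = 2 * (1 + |cos θ|) by ring, mul_pow]
          have : (2 : ℝ) ^ m = 2 * 2 ^ (m - 1) := by rw [← pow_succ']; congr 1; omega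
          rw [this]
          ring
        rw [h4]
        unfold levelBound at h2
        linarith
      calc _ = (((2 + 2 * |cos θ|) ^ m - 1) * (1 / 2) + C₀ * c) * q := by ring
        _ ≤ (2 + 2 * |cos θ|) ^ m * (1 / 2) * γ ^ (2 * m) * q := by gcongr
        _ = (2 + 2 * |cos θ|) ^ m * (1 / 2) * p τ := by rw [← hqt]; ring
        _ ≤ ((M (τ + 1) : ℝ) + 1 / 2) * p τ := by
          exact mul_le_mul_of_nonneg_right h3 (hppos τ).le
    · exact hb.output τ hτ i
  · rcases Nat.eq_or_lt_of_le (Nat.lt_succ_iff.1 hτ) with rfl | hτ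
    · exact hu i
    · exact hb.control τ hτ i
  · have hF := hS.norms l hl
    set w := gain m θ h (η ^ 2) ⬝ᵥ modal V l (fun v => R.x t v - R.enc t v) with hw
    have h1 : modal V l (R.x (t + 1)) =
        (jordanBlock m θ - μ l • gainMatrix m θ h (η ^ 2)) *ᵥ modal V l (R.x t) +
          (μ l * w) • inputVec m := by
      rw [hR.modal_step, hR.modal_control_eq hg hV ht, loop_mulVec, add_assoc, ← add_smul]
      congr 2
      ring
    have h2 : f l ((μ l * w) • inputVec m) ≤ C l * (|μ l| * (K * η ^ 2 * Q * p t)) := by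
      refine (hF.le_norm _).trans (mul_le_mul_of_nonneg_left ?_ (hC l).le)
      rw [norm_smul, Real.norm_eq_abs, abs_mul]
      refine (mul_le_of_le_one_right (by positivity) (norm_inputVec_le m)).trans ?_
      exact mul_le_mul_of_nonneg_left (hkd l) (abs_nonneg _)
    have h3 := hF.contr (modal V l (R.x t))
    have h4 : (1 - 3 * η ^ 2 / 4) * f l (modal V l (R.x t)) ≤
        (1 - 3 * η ^ 2 / 4) * (D l * p t) :=
      mul_le_mul_of_nonneg_left (hb.modes l hl) (by linarith)
    have h5 : p (t + 1) = γ * p t := by simp only [hp]; rw [pow_succ]; ring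
    have h6 : C l * (|μ l| * (K * η ^ 2 * Q * p t)) ≤ η ^ 2 / 2 * (D l * p t) := by
      have h7 : 2 * (C l * (|μ l| * (K * Q))) ≤ D l := hDstep l
      have h8 := mul_le_mul_of_nonneg_right h7 (by have := hppos t; positivity :
        0 ≤ η ^ 2 / 2 * p t)
      calc _ = 2 * (C l * (|μ l| * (K * Q))) * (η ^ 2 / 2 * p t) := by ring
        _ ≤ _ := h8
        _ = _ := by ring
    rw [h1]
    refine (hF.add_le _ _).trans ?_
    change _ ≤ D l * p (t + 1)
    rw [h5, hγ]
    linarith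

/-- Consensus of the closed loop for small `η`. -/
theorem consensusAtRate_of_isSmall (hS : IsSmall θ h μ C₀ c η C B D f) (hV : IsEigenbasis g V μ)
    (hC : ∀ l, 0 < C l) (hB : ∀ l, 0 < B l)
    (hp₀ : 0 < p₀) (hx : ∀ t ≤ 2 * m, ∀ i, ‖R.x t i‖ ≤ p₀)
    (hb : ∀ t, 2 * m ≤ t → Bounds hm V μ c (fun t => p₀ * (1 - η ^ 2 / 4) ^ t) D f R t) :
    ConsensusAtRate (p₀ * (3 + ∑ l, 2 * (B l * D l))) (1 - η ^ 2 / 4) R := by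
  have hη0 := hS.pos
  have hη1 := hS.le_one
  have hγ0 : 0 < 1 - η ^ 2 / 4 := by nlinarith
  have hγ1 : 1 - η ^ 2 / 4 < 1 := by nlinarith [pow_pos hη0 2]
  have hD : ∀ l, 0 ≤ D l := fun l => le_trans (by have := hC l; positivity) (hS.D_init l)
  have hBD : ∀ l, 0 ≤ B l * D l := fun l => mul_nonneg (hB l).le (hD l)
  have hsum : 0 ≤ ∑ l, 2 * (B l * D l) := Finset.sum_nonneg fun l _ => by linarith [hBD l]
  intro i j
  have hbound : ∀ t, ‖R.x t i - R.x t j‖ ≤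
      p₀ * (3 + ∑ l, 2 * (B l * D l)) * (1 - η ^ 2 / 4) ^ t := by
    intro t
    have hpt : 0 < p₀ * (1 - η ^ 2 / 4) ^ t := by positivity
    rcases le_total t (2 * m) with ht | ht
    · have h1 := two_thirds_mul_le hγ0.le hγ1.le hp₀.le hS.gap ht
      calc _ ≤ p₀ + p₀ := (norm_sub_le _ _).trans (add_le_add (hx t ht i) (hx t ht j))
        _ ≤ (p₀ * (1 - η ^ 2 / 4) ^ t) * (3 + ∑ l, 2 * (B l * D l)) := by nlinarith
        _ = _ := by ring
    · have h1 := norm_sub_le_of_modal hV (R.x t)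
        (fun l => B l * D l * (p₀ * (1 - η ^ 2 / 4) ^ t)) (fun l => mul_nonneg (hBD l) hpt.le)
        (fun l hl => ?_) i j
      · refine h1.trans ?_
        calc _ = (∑ l, 2 * (B l * D l)) * (p₀ * (1 - η ^ 2 / 4) ^ t) := by
              rw [Finset.sum_mul]
              exact Finset.sum_congr rfl fun l _ => by ring
          _ ≤ (3 + ∑ l, 2 * (B l * D l)) * (p₀ * (1 - η ^ 2 / 4) ^ t) := by
            gcongr
            linarith
          _ = _ := by ring
      · refine ((hS.norms l hl).norm_le _).trans ?_
        rw [mul_assoc]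
        exact mul_le_mul_of_nonneg_left ((hb t ht).modes l hl) (hB l).le
  refine ⟨?_, hbound⟩
  refine squeeze_zero_norm hbound ?_
  have h := (tendsto_pow_atTop_nhds_zero_of_lt_one hγ0.le hγ1).const_mul
    (p₀ * (3 + ∑ l, 2 * (B l * D l)))
  rwa [mul_zero] at h

end Induction

/-! ### Small gains -/

theorem eventually_pow_gap {m : ℕ} {a b : ℝ} (hab : a < b) :
    ∀ᶠ η : ℝ in 𝓝[>] 0, a ≤ b * (1 - η ^ 2 / 4) ^ (2 * m) := by
  have h1 : Tendsto (fun η : ℝ => b * (1 - η ^ 2 / 4) ^ (2 * m)) (𝓝[>] 0) (𝓝 b) := by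
    have h2 : Continuous fun η : ℝ => b * (1 - η ^ 2 / 4) ^ (2 * m) := by fun_prop
    have h3 := h2.tendsto 0
    simp only [ne_eq, OfNat.ofNat_ne_zero, not_false_eq_true, zero_pow, zero_div, sub_zero,
      one_pow, mul_one] at h3
    exact h3.mono_left nhdsWithin_le_nhds
  exact (h1.eventually_const_lt hab).mono fun _ h => h.le

/-- All conditions on `η` hold near `0`; the constants that do not involve `η` are chosen before. -/
theorem exists_isSmall {N m : ℕ} (hm : 2 ≤ m) {θ h : ℝ} (hθ : sin θ ≠ 0) (hpos : 0 < h)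
    {μ : Fin N → ℝ} (hμ : ∀ l, μ l ≠ 0 → h ≤ μ l) {C₀ : ℝ} (hC₀ : 0 < C₀) :
    ∃ (c : ℝ) (C D : Fin N → ℝ), 0 ≤ c ∧ (∀ l, 0 < C l) ∧
      ∀ᶠ η : ℝ in 𝓝[>] 0, ∃ (B : Fin N → ℝ) (f : Fin N → (Fin (2 * m) → ℝ) → ℝ),
        (∀ l, 0 < B l) ∧ IsSmall θ h μ C₀ c η C B D f := by
  have hmode : ∀ l, ∃ C, 0 < C ∧ ∀ᶠ η : ℝ in 𝓝[>] 0, ∃ B, 0 < B ∧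
      ∃ f : (Fin (2 * m) → ℝ) → ℝ, μ l ≠ 0 → IsModeNorm θ h (μ l) C B η f := by
    intro l
    by_cases hl : μ l = 0
    · exact ⟨1, one_pos, Eventually.of_forall fun η => ⟨1, one_pos, 0, fun h => absurd hl h⟩⟩
    · obtain ⟨C, hC, hev⟩ := exists_isModeNorm hm hθ hpos (hμ l hl)
      exact ⟨C, hC, hev.mono fun η ⟨B, hB, f, hf⟩ => ⟨B, hB, f, fun _ => hf⟩⟩
  choose C hC hev using hmode
  -- this choice makes `C₀ * c = 1 / 8`, a quarter of the slack of the quantizer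
  set c := 1 / (8 * C₀) with hc
  have hc0 : 0 < c := by positivity
  have hCc : C₀ * c = 1 / 8 := by rw [hc]; field_simp
  set K := ∑ l, |gainConst m θ h l| with hK
  set Q := N * (2 * C₀ * (c + 1 / 2)) with hQ
  have hK0 : 0 ≤ K := by positivity
  have hQ0 : 0 ≤ Q := by positivity
  set D : Fin N → ℝ := fun l => 2 * C l * N + 2 * (C l * (|μ l| * (K * Q))) with hD
  refine ⟨c, C, D, hc0.le, hC, ?_⟩
  have hsmall := eventually_small (∑ l, |μ l| * (C l * D l + K * Q)) c hc0
  have hgap := eventually_pow_gap (m := m) (show (2 / 3 : ℝ) < 1 by norm_num)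
  have hslack := eventually_pow_gap (m := m)
    (show ((2 + 2 * |cos θ|) ^ m - 1) * (1 / 2) + C₀ * c < (2 + 2 * |cos θ|) ^ m * (1 / 2) by
      rw [hCc]; linarith)
  have hone := eventually_small 1 1 one_pos
  filter_upwards [eventually_all.2 hev, hsmall, hgap, hslack, hone, self_mem_nhdsWithin] with
    η hη hsmall hgap hslack hone hη0
  choose B hB f hf using hη
  have hη0 : 0 < η := hη0
  have hη1 : η ≤ 1 := by linarith
  refine ⟨B, f, hB, ⟨hη0, hη1, hf, by linarith, hslack, fun l => ?_, fun l => ?_, ?_⟩⟩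
  · have := hC l
    simp only [hD]
    have : 0 ≤ 2 * (C l * (|μ l| * (K * Q))) := by positivity
    linarith
  · have := hC l
    have : 0 ≤ 2 * C l * N := by positivity
    change 2 * (C l * (|μ l| * (K * Q))) ≤ D l
    simp only [hD]
    linarith
  · change ∑ l, |μ l| * (C l * η * D l + K * η ^ 2 * Q) ≤ c
    have h1 : ∀ l, |μ l| * (C l * η * D l + K * η ^ 2 * Q) ≤
        |μ l| * (C l * D l + K * Q) * η := by
      intro l
      rw [mul_assoc |μ l|]
      refine mul_le_mul_of_nonneg_left ?_ (abs_nonneg (μ l))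
      have h2 : K * Q * η ^ 2 ≤ K * Q * η :=
        mul_le_mul_of_nonneg_left (by nlinarith) (by positivity)
      linarith
    calc _ ≤ ∑ l, |μ l| * (C l * D l + K * Q) * η := Finset.sum_le_sum fun l _ => h1 l
      _ = (∑ l, |μ l| * (C l * D l + K * Q)) * η := (Finset.sum_mul Finset.univ _ _).symm
      _ ≤ c := hsmall

theorem exists_pos_forall_lt_of_eventually {P : ℝ → Prop} (hP : ∀ᶠ η : ℝ in 𝓝[>] 0, P η) :
    ∃ ε₀ > 0, ∀ ε, 0 < ε → ε < ε₀ → P √ε := by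
  have h1 : Tendsto Real.sqrt (𝓝[>] 0) (𝓝[>] 0) := by
    refine tendsto_nhdsWithin_iff.2 ⟨?_, ?_⟩
    · have := Real.continuous_sqrt.tendsto 0
      rw [Real.sqrt_zero] at this
      exact this.mono_left nhdsWithin_le_nhds
    · filter_upwards [self_mem_nhdsWithin] with ε hε using Real.sqrt_pos.2 hε
  obtain ⟨ε₀, hε₀, hsub⟩ := mem_nhdsGT_iff_exists_Ioo_subset.1 (h1.eventually hP)
  exact ⟨ε₀, hε₀, fun ε h0 h1 => hsub ⟨h0, h1⟩⟩

end QuantizedConsensus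

end

/-! ### Consensus and the data rate -/

open QuantizedConsensus in
theorem theorem2 {N m : ℕ} (hm : 2 ≤ m) (θ : ℝ) (hθ : Real.sin θ ≠ 0)
    (𝒢 : SimpleGraph (Fin N)) (h𝒢 : 𝒢.Connected)
    (g : Matrix (Fin N) (Fin N) ℝ) (hg : QuantizedConsensus.IsWeight 𝒢 g)
    (h : ℝ) (hpos : 0 < h) (hle : ∀ lam, QuantizedConsensus.IsNonzeroEigenvalue g lam → h ≤ lam) :
    (∃ ε₀ > 0, ∀ ε, 0 < ε → ε < ε₀ →
      (0 < 1 - ε / 4 ∧ 1 - ε / 4 < 1) ∧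
      (∀ lam, QuantizedConsensus.IsNonzeroEigenvalue g lam →
        spectralRadius ℂ
            ((QuantizedConsensus.jordanBlock m θ -
              lam • QuantizedConsensus.gainMatrix m θ h ε).map (algebraMap ℝ ℂ))
          < ENNReal.ofReal (1 - ε / 2)) ∧
      ∀ C Cδ p₀ : ℝ, 0 < C → 0 < Cδ → (√2 + 1) ^ (2 * m) * max C Cδ ≤ p₀ →
        ∃ B : ℝ,
          -- every sufficiently fine quantizer
          (∀ M : ℕ → ℕ,
            (∀ t, 1 ≤ t → t ≤ 2 * m → 1 ≤ M t) →
            (∀ t, 2 * m < t → QuantizedConsensus.levelBound m θ ≤ (M t : ℝ)) →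
            ∀ R : QuantizedConsensus.Signals N m,
              QuantizedConsensus.IsClosedLoop hm θ 𝒢 g (QuantizedConsensus.gain m θ h ε)
                (fun t => p₀ * (1 - ε / 4) ^ t) M R →
              QuantizedConsensus.InitBound C Cδ (R.x 0) →
              QuantizedConsensus.ConsensusAtRate B (1 - ε / 4) R) ∧
          -- in particular with the stated number of bits; nothing is sent for the symbol zero
          ∃ (send : ℤ → Option (Fin (QuantizedConsensus.bits m θ) → Bool))
            (receive : Option (Fin (QuantizedConsensus.bits m θ) → Bool) → ℤ),
            send 0 = none ∧
            ∀ R : QuantizedConsensus.Signals N m,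
              QuantizedConsensus.IsClosedLoop hm θ 𝒢 g (QuantizedConsensus.gain m θ h ε)
                (fun t => p₀ * (1 - ε / 4) ^ t)
                (fun _ => ⌈QuantizedConsensus.levelBound m θ⌉₊) R →
              QuantizedConsensus.InitBound C Cδ (R.x 0) →
              (∀ t i, receive (send (R.s (t + 1) i)) = R.s (t + 1) i) ∧
              QuantizedConsensus.ConsensusAtRate B (1 - ε / 4) R) ∧
    m ≤ QuantizedConsensus.bits m θ ∧ QuantizedConsensus.bits m θ ≤ 2 * m := by
  obtain ⟨V, μ, hV⟩ := exists_isEigenbasis h𝒢 hg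
  obtain ⟨C₀, hC₀, hest⟩ := exists_estimate_bound hm hθ
  obtain ⟨c, K, D, hc, hK, hev⟩ := exists_isSmall (m := m) hm hθ hpos
    (fun l hl => hle (μ l) ⟨hl, hV.hasEigenvalue l⟩) hC₀
  obtain ⟨ε₀, hε₀, hsm⟩ := exists_pos_forall_lt_of_eventually hev
  refine ⟨⟨ε₀, hε₀, fun ε h0 h1 => ?_⟩, le_bits hm θ, bits_le hm θ⟩
  obtain ⟨B, f, hB, hS⟩ := hsm ε h0 h1
  obtain ⟨η, rfl, hη⟩ : ∃ η, ε = η ^ 2 ∧ √ε = η := ⟨√ε, (Real.sq_sqrt h0.le).symm, rfl⟩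
  rw [hη] at hS
  have hη2 : η ^ 2 ≤ 1 := pow_le_one₀ hS.pos.le hS.le_one
  refine ⟨⟨by linarith, by linarith⟩, fun lam hlam => ?_, fun C Cδ p₀ hC hCδ hp => ?_⟩
  · obtain ⟨l, rfl⟩ := hV.exists_eq hlam.2
    have hN := hS.norms l hlam.1
    refine (spectralRadius_le_of_contraction _ (by linarith : 0 < 1 - 3 * η ^ 2 / 4) (hB l).le
      (f l) hN.contr hN.norm_le).trans_lt ?_
    exact (ENNReal.ofReal_lt_ofReal_iff (by linarith)).2 (by linarith)
  · have hp₀ : 0 < p₀ := lt_of_lt_of_le (by positivity) hp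
    have hmain : ∀ M : ℕ → ℕ, (∀ t, 1 ≤ t → t ≤ 2 * m → 1 ≤ M t) →
        (∀ t, 2 * m < t → levelBound m θ ≤ (M t : ℝ)) → ∀ R : Signals N m,
        IsClosedLoop hm θ 𝒢 g (gain m θ h (η ^ 2)) (fun t => p₀ * (1 - η ^ 2 / 4) ^ t) M R →
        InitBound C Cδ (R.x 0) →
        ConsensusAtRate (p₀ * (3 + ∑ l, 2 * (B l * D l))) (1 - η ^ 2 / 4) R := by
      intro M hM1 hM2 R hR hI
      have hx : ∀ t ≤ 2 * m, ∀ i, ‖R.x t i‖ ≤ p₀ := fun t ht i => hR.norm_x_le hI hp hC ht i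
      refine consensusAtRate_of_isSmall (hm := hm) hS hV hK hB hp₀ hx fun t ht => ?_
      induction t, ht using Nat.le_induction with
      | base => exact bounds_init hS hV hc hK hR hp₀ hx hM1
      | succ t ht ih => exact bounds_step hS hV hc hK hC₀ hg hest hR hp₀ hM2 ht ih
    obtain ⟨send, receive, hsend, hcode⟩ := exists_code (two_mul_ceil_le_two_pow_bits m θ)
    refine ⟨_, hmain, send, receive, hsend, fun R hR hI => ⟨fun t i => hcode _ ?_, ?_⟩⟩
    · rcases lt_or_ge t (2 * m) with ht | ht
      · rw [hR.symbol_init t ht]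
        exact abs_quantizer_le _ _
      · rw [hR.symbol_step t ht]
        exact abs_quantizer_le _ _
    · refine hmain _ (fun t _ _ => ?_) (fun t _ => Nat.le_ceil _) R hR hI
      exact (Nat.one_le_two_pow).trans (two_pow_le_ceil_levelBound m θ)
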